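/- Let $X$ be a complete separable metric space with a $\sigma$-finite Borel measure $\mu$, let $m,n\ge 1$, and let $X_0,X_{m+1}$ be sets. Let $\phi_{r,r+1}:X\times X\to\mathbb{C}$ ($1\le r\le m-1$), $\phi_{0,1}:X_0\times X\to\mathbb{C}$ and $\phi_{m,m+1}:X\times X_{m+1}\to\mathbb{C}$ be measurable (the last two in the variable in $X$), and fix $x^0\in X_0^n$, $x^{m+1}\in X_{m+1}^n$. For $0\le r<s\le m+1$ put $\phi_{r,s}=\phi_{r,r+1}*\dots*\phi_{s-1,s}$, where $(\phi*\psi)(x,y)=\int_X\phi(x,z)\psi(z,y)\,d\mu(z)$, and put $\phi_{r,s}=0$ if $r\ge s$. Assume that these iterated integrals converge absolutely, that is, stay finite when all transition functions are replaced by their absolute values, for $\mu$-almost all values of the arguments in $X$, the arguments in $X_0$ and $X_{m+1}$ being the points $x^0_i$ and $x^{m+1}_j$. For $\underline x=(x^1,\dots,x^m)\in(X^n)^m$ let $$w(\underline x)=\prod_{r=0}^{m}\det\big(\phi_{r,r+1}(x^r_i,x^{r+1}_j)\big)_{1\le i,j\le n},\quad Z=\frac1{(n!)^m}\int_{(X^n)^m}w\,d\mu^{nm},\quad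 p=\frac{w}{(n!)^mZ},$$ and assume $Z\ne0$. Let $\Lambda=\{1,\dots,m\}\times X$, let $\lambda$ be the product of counting measure and $\mu$, and let $A=(\phi_{0,m+1}(x^0_i,x^{m+1}_j))_{1\le i,j\le n}$. Then $A$ is invertible; set $$K(r,x;s,y)=\sum_{i,j=1}^n\phi_{r,m+1}(x,x^{m+1}_i)(A^{-1})_{ij}\,\phi_{0,s}(x^0_j,y)-\phi_{r,s}(x,y)\qquad(1\le r,s\le m).$$ (a) For every $g\in L^\infty(\Lambda,\lambda)$, $$\int_{(X^n)^m}\prod_{r=1}^m\prod_{j=1}^n(1+g(r,x^r_j))\,p(\underline x)\,d\mu^{nm}(\underline x)=\sum_{k=0}^\infty\frac1{k!}\int_{\Lambda^k}\prod_{j=1}^kg(z_j)\det(K(z_i;z_j))_{1\le i,j\le k}\,d\lambda^k(z),$$ where all the integrals and the series converge absolutely. (b) Suppose moreover that $g$ vanishes outside the Borel set $B\subseteq\Lambda$, that the functions $(s,y)\mapsto\phi_{0,s}(x^0_i,y)g(s,y)$ and $(r,x)\mapsto\chi_B(r,x)\phi_{r,m+1}(x,x^{m+1}_j)$ belong to $L^2(\Lambda,\lambda)$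 for $1\le i,j\le n$, and that the kernel $\psi(r,x;s,y)=\chi_B(r,x)\phi_{r,s}(x,y)g(s,y)$ on $\Lambda\times\Lambda$ defines a trace class operator $\psi$ on $L^2(\Lambda,\lambda)$ with $\operatorname{Tr}\psi=\int_\Lambda\psi(z;z)\,d\lambda(z)$. Then the kernel $\chi_B(z)K(z;w)g(w)$ defines a trace class operator $\chi_BKg$ on $L^2(\Lambda,\lambda)$, and both sides of (a) are equal to its Fredholm determinant $\det(I+\chi_BKg)_{L^2(\Lambda,\lambda)}=\prod_i(1+\lambda_i)$, where the $\lambda_i$ are the nonzero eigenvalues of $\chi_BKg$ repeated according to algebraic multiplicity. (c) If $p\ge0$ $\mu^{nm}$-almost everywhere, then $p\,d\mu^{nm}$ is a probability measure, and the point process $\xi=\sum_{r=1}^m\sum_{j=1}^n\delta_{(r,x^r_j)}$ on $\Lambda$ is determinantal with correlation kernel $K$: for every $k$, the function $\det(K(z_i;z_j))_{1\le i,j\le k}$ is $\lambda^k$-almost everywhere nonnegative and is the density with respect to $\lambda^k$ of the $k$-th factorial moment measure of $\xi$ (the expected number of $k$-tuples of distinct points of $\xi$, counted with multiplicity, in a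 Borel subset of $\Lambda^k$), which is finite on bounded sets. -/

import Mathlib

open MeasureTheory
open scoped ENNReal InnerProductSpace

noncomputable section

namespace EynardMehta

/-! ### Transition functions and their compositions

The `m` copies of the state space `X` are numbered `0, …, m - 1`.  The values live in `R`, which is
`ℂ` for the transition functions themselves and `ℝ≥0∞` for their absolute values. -/

/-- Initial, intermediate and final transition functions: `init` leads from `X₀` to level `0`,
`step r` from level `r` to level `r + 1` (only `r + 1 < m` is used), and `final` from level `m - 1`
to `X₁`. -/
structure TransitionSystem (R X X₀ X₁ : Type*) where
  init : X₀ → X → R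
  step : ℕ → X → X → R
  final : X → X₁ → R

/-- Composition `(f ∗ g) a b = I (z ↦ f a z * g z b)` with respect to an integral `I` over `X`. -/
def compose {R X α β : Type*} [Mul R] (I : (X → R) → R) (f : α → X → R) (g : X → β → R) :
    α → β → R :=
  fun a b => I fun z => f a z * g z b

/-- The product measure `μ^{nm}` on `(X^n)^m`. -/
def configMeasure {X : Type*} [MeasurableSpace X] (μ : Measure X) (m n : ℕ) :
    Measure (Fin m → Fin n → X) :=
  Measure.pi fun _ => Measure.pi fun _ => μ

namespace TransitionSystem

variable {R X X₀ X₁ : Type*}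

section Composition

variable [Mul R] (φ : TransitionSystem R X X₀ X₁) (I : (X → R) → R)

/-- The composed transition function from level `r` to level `r + 1 + k`. -/
def run (r : ℕ) : ℕ → X → X → R
  | 0 => φ.step r
  | k + 1 => compose I (run r k) (φ.step (r + 1 + k))

/-- The composed transition function from level `r` to level `s`; it vanishes unless `r < s`. -/
def between [Zero R] (r s : ℕ) : X → X → R :=
  if r < s then φ.run I r (s - r - 1) else 0

/-- The composed transition function from the initial set to level `s`. -/
def fromInit : ℕ → X₀ → X → R
  | 0 => φ.init
  | s + 1 => compose I (fromInit s) (φ.step s)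

/-- The composed transition function from level `r < m` to the final set. -/
def toFinal [Zero R] (m r : ℕ) : X → X₁ → R :=
  if r + 1 = m then φ.final else compose I (φ.between I r (m - 1)) φ.final

/-- The composed transition function from the initial set to the final set. -/
def total (m : ℕ) : X₀ → X₁ → R :=
  compose I (φ.fromInit I (m - 1)) φ.final

end Composition

/-- The absolute values of the transition functions. -/
def abs (φ : TransitionSystem ℂ X X₀ X₁) : TransitionSystem ℝ≥0∞ X X₀ X₁ where
  init a x := ‖φ.init a x‖ₑ
  step r x y := ‖φ.step r x y‖ₑ
  final x b := ‖φ.final x b‖ₑ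

/-- The transition functions are measurable (the initial and final sets carry no measurable
structure). -/
structure IsMeasurable [MeasurableSpace X] (φ : TransitionSystem ℂ X X₀ X₁) (m : ℕ) : Prop where
  init : ∀ a, Measurable (φ.init a)
  step : ∀ r, r + 1 < m → Measurable (Function.uncurry (φ.step r))
  final : ∀ b, Measurable fun x => φ.final x b

/-- All composed transition functions are well defined: the iterated integrals converge absolutely,
for almost all values of the arguments that lie in `X`. -/
structure WellDefined [MeasurableSpace X] (φ : TransitionSystem ℂ X X₀ X₁) (μ : Measure X)
    (m : ℕ) {n : ℕ} (x₀ : Fin n → X₀) (x₁ : Fin n → X₁) : Prop where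
  between : ∀ r s : Fin m, r < s →
    ∀ᵐ p ∂(μ.prod μ), φ.abs.between (fun f => ∫⁻ z, f z ∂μ) r s p.1 p.2 < ∞
  fromInit : ∀ (s : Fin m) (i : Fin n),
    ∀ᵐ y ∂μ, φ.abs.fromInit (fun f => ∫⁻ z, f z ∂μ) s (x₀ i) y < ∞
  toFinal : ∀ (r : Fin m) (j : Fin n),
    ∀ᵐ x ∂μ, φ.abs.toFinal (fun f => ∫⁻ z, f z ∂μ) m r x (x₁ j) < ∞
  total : ∀ i j : Fin n, φ.abs.total (fun f => ∫⁻ z, f z ∂μ) m (x₀ i) (x₁ j) < ∞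

/-! ### The measure and the kernel -/

section Kernel

variable [MeasurableSpace X] (φ : TransitionSystem ℂ X X₀ X₁) (μ : Measure X) (m : ℕ) {n : ℕ}
  (x₀ : Fin n → X₀) (x₁ : Fin n → X₁)

/-- The product of determinants at a configuration `x ∈ (X^n)^m`. -/
def weight [NeZero m] (x : Fin m → Fin n → X) : ℂ :=
  (Matrix.of fun i j : Fin n => φ.init (x₀ i) (x ⟨0, NeZero.pos m⟩ j)).det *
  (∏ r : Fin (m - 1), (Matrix.of fun i j : Fin n =>
    φ.step r (x ⟨r, by omega⟩ i) (x ⟨r + 1, by omega⟩ j)).det) *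
  (Matrix.of fun i j : Fin n =>
    φ.final (x ⟨m - 1, Nat.sub_lt (NeZero.pos m) one_pos⟩ i) (x₁ j)).det

/-- The normalising constant `Z = (n!)^{-m} ∫ w dμ`. -/
def partitionFunction [NeZero m] : ℂ :=
  ((n.factorial : ℂ) ^ m)⁻¹ * ∫ x, φ.weight m x₀ x₁ x ∂(configMeasure μ m n)

/-- The density `p = w / ((n!)^m Z)`. -/
def density [NeZero m] (x : Fin m → Fin n → X) : ℂ :=
  ((n.factorial : ℂ) ^ m * φ.partitionFunction μ m x₀ x₁)⁻¹ * φ.weight m x₀ x₁ x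

/-- The matrix of total transition weights between the initial and the final points. -/
def totalMatrix : Matrix (Fin n) (Fin n) ℂ :=
  Matrix.of fun i j => φ.total (fun f => ∫ z, f z ∂μ) m (x₀ i) (x₁ j)

/-- The transition kernel `(r, x), (s, y) ↦ φ_{r,s}(x, y)` on `{0, …, m - 1} × X`. -/
def transitionKernel (z w : Fin m × X) : ℂ :=
  φ.between (fun f => ∫ t, f t ∂μ) z.1 w.1 z.2 w.2

/-- The function `(s, y) ↦ φ_{0,s}(x⁰_i, y)`. -/
def fromInitialPoint (i : Fin n) (w : Fin m × X) : ℂ :=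
  φ.fromInit (fun f => ∫ t, f t ∂μ) w.1 (x₀ i) w.2

/-- The function `(r, x) ↦ φ_{r,m+1}(x, x^{m+1}_j)`. -/
def toFinalPoint (j : Fin n) (z : Fin m × X) : ℂ :=
  φ.toFinal (fun f => ∫ t, f t ∂μ) m z.1 z.2 (x₁ j)

/-- The extended (Eynard–Mehta) kernel on `{0, …, m - 1} × X`. -/
def kernel (z w : Fin m × X) : ℂ :=
  (∑ i : Fin n, ∑ j : Fin n, φ.toFinalPoint μ m x₁ i z *
    (φ.totalMatrix μ m x₀ x₁)⁻¹ i j * φ.fromInitialPoint μ m x₀ j w) -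
  φ.transitionKernel μ m z w

end Kernel

end TransitionSystem

/-- The reference measure on `{0, …, m - 1} × X`: counting measure times `μ`. -/
def refMeasure {X : Type*} [MeasurableSpace X] (μ : Measure X) (m : ℕ) : Measure (Fin m × X) :=
  (Measure.count : Measure (Fin m)).prod μ

/-! ### Trace class operators and Fredholm determinants -/

section Operators

variable {H : Type*} [NormedAddCommGroup H] [InnerProductSpace ℂ H]

/-- Trace class (nuclear) operators on a Hilbert space: `T = ∑ₖ ⟪uₖ, ·⟫ vₖ` with
`∑ₖ ‖uₖ‖ ‖vₖ‖ < ∞`. -/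
def IsTraceClass (T : H →L[ℂ] H) : Prop :=
  ∃ u v : ℕ → H, (Summable fun k => ‖u k‖ * ‖v k‖) ∧
    ∀ f, HasSum (fun k => ⟪u k, f⟫_ℂ • v k) (T f)

/-- The trace `∑ᵢ ⟪eᵢ, T eᵢ⟫` over an orthonormal basis (for a trace class operator it does not
depend on the basis). -/
def trace [CompleteSpace H] (T : H →L[ℂ] H) : ℂ :=
  let e := (exists_hilbertBasis ℂ H).choose_spec.choose
  ∑' i, ⟪e i, T (e i)⟫_ℂ

/-- `d` is the Fredholm determinant `det (I + T)`: the product of `1 + z` over the eigenvalues `z`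
of `T`, repeated according to algebraic multiplicity. A number `z` that is not an eigenvalue
contributes the factor `1`, and so does `z = 0`. -/
def HasFredholmDet (T : H →L[ℂ] H) (d : ℂ) : Prop :=
  HasProd (fun z : ℂ =>
    (1 + z) ^ Module.finrank ℂ (Module.End.maxGenEigenspace (T : H →ₗ[ℂ] H) z)) d

/-- The bounded operator `T` on `L²` is the integral operator with kernel `k`. -/
def HasKernel {Λ : Type*} [MeasurableSpace Λ] {lam : Measure Λ}
    (T : Lp ℂ 2 lam →L[ℂ] Lp ℂ 2 lam) (k : Λ → Λ → ℂ) : Prop :=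
  ∀ f : Lp ℂ 2 lam, (∀ᵐ z ∂lam, Integrable (fun w => k z w * f w) lam) ∧
    T f =ᵐ[lam] fun z => ∫ w, k z w * f w ∂lam

end Operators

/-! ### Point processes -/

/-- Every subset of the finite set of levels is bounded. -/
instance levelBornology (m : ℕ) : Bornology (Fin m) := Bornology.cofinite

section PointProcess

variable {Λ Ω : Type*} [MeasurableSpace Λ] [MeasurableSpace Ω]

/-- Boundedly finite counting measures. -/
def IsCountingMeasure [Bornology Λ] (ξ : Measure Λ) : Prop :=
  ∀ A, MeasurableSet A → Bornology.IsBounded A → ∃ k : ℕ, ξ A = k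

/-- A point process defined on the measure space `(Ω, P)`. -/
structure IsPointProcess [Bornology Λ] (P : Measure Ω) (ξ : Ω → Measure Λ) : Prop where
  isProbabilityMeasure : IsProbabilityMeasure P
  measurable : Measurable ξ
  isCountingMeasure : ∀ ω, IsCountingMeasure (ξ ω)

/-- The points of `ξ`, with multiplicities, can be listed as `y`, i.e. `ξ = ∑ᵢ δ_{yᵢ}`. The index
set is a set of natural numbers, so that the list is finite or countably infinite. -/
def IsEnumeration (ξ : Measure Λ) (S : Set ℕ) (y : S → Λ) : Prop :=
  ξ = Measure.sum fun i => Measure.dirac (y i)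

open Classical in
/-- The counting measure on `Λ^k` of all `k`-tuples of distinct points of `ξ = ∑ᵢ δ_{yᵢ}`:
the sum of `δ_{(y_{i₁}, …, y_{i_k})}` over all `k`-tuples of distinct indices. It does not depend on
the enumeration of the points. -/
def tupleMeasure (ξ : Measure Λ) (k : ℕ) : Measure (Fin k → Λ) :=
  if h : ∃ (S : Set ℕ) (y : S → Λ), IsEnumeration ξ S y then
    Measure.sum fun f : Fin k ↪ h.choose => Measure.dirac fun i => h.choose_spec.choose (f i)
  else 0

/-- The factorial moment `M_k(A)`: expected number of `k`-tuples of distinct points in `A`. -/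
def factorialMoment (P : Measure Ω) (ξ : Ω → Measure Λ) (k : ℕ) (A : Set (Fin k → Λ)) : ℝ≥0∞ :=
  ∫⁻ ω, tupleMeasure (ξ ω) k A ∂P

/-- `ρ` is the `k`-th correlation function with respect to the reference measure `lam`:
it is nonnegative almost everywhere, and it is the density of the factorial moment measure. -/
def IsCorrelationFunction (P : Measure Ω) (ξ : Ω → Measure Λ) (lam : Measure Λ) (k : ℕ)
    (ρ : (Fin k → Λ) → ℂ) : Prop :=
  AEMeasurable ρ (Measure.pi fun _ => lam) ∧
  (∀ᵐ z ∂(Measure.pi fun _ : Fin k => lam), 0 ≤ (ρ z).re ∧ (ρ z).im = 0) ∧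
  ∀ A, MeasurableSet A → factorialMoment P ξ k A =
    ∫⁻ z in A, ENNReal.ofReal (ρ z).re ∂(Measure.pi fun _ : Fin k => lam)

/-- `ξ` is a determinantal point process with correlation kernel `K`: its factorial moment measures
are finite on bounded sets, and its correlation functions are `det (K (zᵢ, zⱼ))`. -/
structure IsDeterminantal [Bornology Λ] (P : Measure Ω) (ξ : Ω → Measure Λ) (lam : Measure Λ)
    (K : Λ → Λ → ℂ) : Prop where
  isPointProcess : IsPointProcess P ξ
  factorialMoment_lt_top : ∀ (k : ℕ) (A : Set (Fin k → Λ)), MeasurableSet A →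
    Bornology.IsBounded A → factorialMoment P ξ k A < ∞
  correlation : ∀ k : ℕ, IsCorrelationFunction P ξ lam k
    fun z => (Matrix.of fun i j : Fin k => K (z i) (z j)).det

/-- The counting measure `∑_{r,j} δ_{(r, x^r_j)}` on `{0, …, m - 1} × X`. -/
def configPoints {X : Type*} [MeasurableSpace X] {m n : ℕ} (x : Fin m → Fin n → X) :
    Measure (Fin m × X) :=
  ∑ r : Fin m, ∑ j : Fin n, Measure.dirac (r, x r j)

end PointProcess

end EynardMehta

end

open EynardMehta

noncomputable section

namespace EynardMehta

-- For points `z₁, …, z_k` of `Fin m × X`, form the square matrix of composed transitions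
-- (`configMatrix`). Its rows are the sources: the initial points and the `zᵢ`. Its columns are the
-- targets: the final points and the `zᵢ`. With the sign `(-1)^k`, its determinant `configDet` is
-- the unnormalised `k`-point correlation function, for three reasons. The upper left block is the
-- matrix `A` of total transitions, so the Schur complement gives `configDet = det A * det K(zᵢ,
-- zⱼ)` (`configDet_eq_det_mul_det_kernel`). For a full configuration, with `n` points on every
-- level, ordering rows and columns by level makes the matrix block triangular with the one-step
-- transition matrices on the diagonal. Hence `configDet` is the weight up to a fixed sign
-- (`configDet_pointAt`). Integrating out one point multiplies `configDet` by `m * n - k`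
-- (`integral_configDet_cons`): a bordered determinant is bilinear in the new column and row, the
-- composition rule integrates their products, and the sum that results counts sources and targets
-- below the level of the new point. This factor is also the number of ways to extend `k` distinct
-- labels by one more. Descending induction from `k = m * n` then identifies all correlation
-- integrals (`sum_integral_weight`). The case `k = 0` says that the integral of the weight is a
-- nonzero constant times `det A`, so `A` is invertible. The expansion (a) follows by expanding `∏
-- (1 + g)` over sets of labels, and (c) by testing against indicators.
--
-- For (b), the factors `1 + g` are absorbed into the transition functions (`tilt`). The case `k =
-- 0` for both systems makes the generating functional a ratio `det A' / det A`, where `A'` is the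
-- total matrix of the tilted system. The telescoping identity `∏ h_s = 1 + ∑ (h_s - 1) ∏_{s' > s}
-- h_{s'}` gives a resolvent equation (`tilt_transition_inl`), which expresses `A' - A` through the
-- tilted transitions to the final points. On the operator side, `χ_B K g = U A⁻¹ V - ψ` with `U`,
-- `V` of rank at most `n`. The operator `ψ` strictly moves between levels, so it is nilpotent. By
-- the resolvent equation, `R = (1 - ψ)⁻¹ U` consists of the tilted transitions cut off to `B`. The
-- eigenvalue product is therefore `det (1 + V R A⁻¹) = det (1 + (A' - A) A⁻¹) = det A' / det A`
-- (`hasProd_eigenvalues_finiteRank_sub_nilpotent`, `exists_hasFredholmDet`).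

local notation "bochner[" μ "]" => fun f => ∫ z, f z ∂μ
local notation "lebesgue[" μ "]" => fun f => ∫⁻ z, f z ∂μ

/-! ### Determinants -/

section Determinants

variable {ι : Type*} [Fintype ι] [DecidableEq ι]

/-- For invertible `M` this is the Schur complement. Both sides are continuous in `M`, and `M + t •
1` is singular only for the finitely many `t` that are eigenvalues of `-M`, so the general case
follows by density. -/
theorem det_bordered (M : Matrix ι ι ℂ) (u v : ι → ℂ) :
    (Matrix.fromBlocks M (Matrix.replicateCol Unit u) (Matrix.replicateRow Unit v) 0).det =
      -∑ a, ∑ b, M.adjugate b a * (u a * v b) := by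
  let N : ℂ → Matrix ι ι ℂ := fun t => M + t • 1
  have hN : Continuous N := by fun_prop
  have hdense : Dense {t : ℂ | (N t).det ≠ 0} := by
    have hfin : Set.Finite {t : ℂ | (N t).det = 0} := by
      refine ((-M).charpoly.roots.toFinset.finite_toSet).subset fun t ht => ?_
      have h0 : (-M).charpoly ≠ 0 := (Matrix.charpoly_monic _).ne_zero
      simp only [Finset.mem_coe, Multiset.mem_toFinset, Polynomial.mem_roots h0,
        Polynomial.IsRoot.def, Matrix.eval_charpoly]
      rw [← (show (N t).det = 0 from ht)]
      congr 1
      ext i j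
      simp [N, Matrix.scalar_apply, Matrix.diagonal_apply, Matrix.one_apply, add_comm]
    exact hfin.countable.dense_compl ℂ
  have key : (fun t => (Matrix.fromBlocks (N t) (Matrix.replicateCol Unit u)
      (Matrix.replicateRow Unit v) 0).det) =
      fun t => -∑ a, ∑ b, (N t).adjugate b a * (u a * v b) := by
    refine Continuous.ext_on hdense ?_ ?_ ?_
    · refine Continuous.matrix_det ?_
      exact Continuous.matrix_fromBlocks hN continuous_const continuous_const continuous_const
    · have := hN.matrix_adjugate
      refine (continuous_finsetSum _ fun a _ => continuous_finsetSum _ fun b _ => ?_).neg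
      exact (this.matrix_elem b a).mul continuous_const
    · intro t ht
      have hu : IsUnit (N t).det := isUnit_iff_ne_zero.2 ht
      let _ := Matrix.invertibleOfIsUnitDet _ hu
      simp only
      rw [Matrix.det_fromBlocks₁₁, Matrix.det_unique (n := Unit), Matrix.invOf_eq_nonsing_inv,
        Matrix.inv_def]
      simp only [Matrix.sub_apply, Matrix.zero_apply, zero_sub, Matrix.mul_apply, Matrix.smul_apply,
        Matrix.mul_smul, Matrix.smul_mul, Matrix.replicateRow_apply, Matrix.replicateCol_apply,
        smul_eq_mul, mul_neg]
      rw [← mul_assoc, Ring.mul_inverse_cancel _ hu, one_mul]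
      congr 1
      refine Finset.sum_congr rfl fun a _ => ?_
      rw [Finset.sum_mul]
      exact Finset.sum_congr rfl fun b _ => by ring
  simpa [N] using congrFun key 0

/-- Since `M` vanishes where both `p` and `q` fail, masking by `p ∧ q` is masking by rows in `p`
minus masking by columns outside `q`. Each full row or column of `adjugate * M` contributes one `det
M`. -/
theorem sum_adjugate_mul_ite (M : Matrix ι ι ℂ) (p q : ι → Prop) [DecidablePred p]
    [DecidablePred q] (h : ∀ a b, ¬p a → ¬q b → M a b = 0) :
    ∑ a, ∑ b, M.adjugate b a * (if p a ∧ q b then M a b else 0) =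
      ((Finset.univ.filter p).card - (Finset.univ.filter fun b => ¬q b).card : ℂ) * M.det := by
  have h1 : ∀ a b, (if p a ∧ q b then M a b else 0) =
      (if p a then M a b else 0) - (if ¬q b then M a b else 0) := by
    intro a b
    have := h a b
    by_cases ha : p a <;> by_cases hb : q b <;> simp_all
  simp only [h1, mul_sub, Finset.sum_sub_distrib, sub_mul]
  congr 1
  · have : ∀ a, ∑ b, M.adjugate b a * (if p a then M a b else 0) = if p a then M.det else 0 := by
      intro a
      split_ifs
      · have := congrFun (congrFun (Matrix.mul_adjugate M) a) a
        simp only [Matrix.mul_apply, Matrix.smul_apply, Matrix.one_apply_eq, smul_eq_mul,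
          mul_one] at this
        rw [← this]
        exact Finset.sum_congr rfl fun b _ => mul_comm _ _
      · simp
    simp only [this, ← Finset.sum_filter, Finset.sum_const, nsmul_eq_mul]
  · rw [Finset.sum_comm]
    have : ∀ b, ∑ a, M.adjugate b a * (if ¬q b then M a b else 0) =
        if ¬q b then M.det else 0 := by
      intro b
      split_ifs
      · simp
      · have := congrFun (congrFun (Matrix.adjugate_mul M) b) b
        simpa only [Matrix.mul_apply, Matrix.smul_apply, Matrix.one_apply_eq, smul_eq_mul,
          mul_one] using this
    simp only [this, ← Finset.sum_filter, Finset.sum_const, nsmul_eq_mul]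

/-- The columns in `q` are supported in the fewer rows in `p`, so by the pigeonhole principle every
permutation meets a zero entry. -/
theorem det_eq_zero_of_card_lt {M : Matrix ι ι ℂ} (p q : ι → Prop) [DecidablePred p]
    [DecidablePred q] (h : ∀ a b, ¬p a → q b → M a b = 0)
    (hpq : (Finset.univ.filter p).card < (Finset.univ.filter q).card) : M.det = 0 := by
  rw [Matrix.det_apply]
  refine Finset.sum_eq_zero fun σ _ => ?_
  obtain ⟨b, hb, hσ⟩ : ∃ b, q b ∧ ¬p (σ b) := by
    by_contra! hc
    refine hpq.not_ge (Finset.card_le_card_of_injOn σ (fun b hb => ?_) σ.injective.injOn)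
    simpa using hc b (by simpa using hb)
  have h0 : ∏ i, M (σ i) i = 0 := Finset.prod_eq_zero (Finset.mem_univ b) (h _ _ hσ hb)
  rw [h0, smul_zero]

end Determinants

/-! ### Finite rank perturbations of nilpotent operators -/

section Nilpotent

open Module Polynomial

/-- Both sides are, up to the same sign, the value of the characteristic polynomial at `-1`. -/
theorem prod_one_add_pow_finrank_maxGenEigenspace {V : Type*} [AddCommGroup V] [Module ℂ V]
    [FiniteDimensional ℂ V] (T : V →ₗ[ℂ] V) :
    ∏ z ∈ T.charpoly.roots.toFinset, (1 + z) ^ finrank ℂ (End.maxGenEigenspace T z) =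
      LinearMap.det (1 + T) := by
  have hs : T.charpoly.Splits := IsAlgClosed.splits _
  have h1 : T.charpoly.eval (-1) = (-1) ^ finrank ℂ V * LinearMap.det (1 + T) := by
    rw [LinearMap.eval_charpoly, ← LinearMap.det_smul]
    congr 1
    simp [sub_eq_add_neg, add_comm]
  have h2 : T.charpoly.eval (-1) =
      (-1) ^ finrank ℂ V * (T.charpoly.roots.map fun z => 1 + z).prod := by
    have hc : T.charpoly.roots.card = finrank ℂ V := by
      rw [← hs.natDegree_eq_card_roots, LinearMap.charpoly_natDegree]
    conv_lhs => rw [hs.eq_prod_roots_of_monic T.charpoly_monic]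
    rw [Polynomial.eval_multiset_prod, Multiset.map_map, ← hc, ← Multiset.card_map (fun z => 1 + z),
      ← Multiset.prod_map_neg, Multiset.map_map]
    congr 1
    refine Multiset.map_congr rfl fun z _ => ?_
    simp; ring
  rw [h1] at h2
  have h3 := mul_left_cancel₀ (pow_ne_zero _ (by norm_num)) h2
  rw [h3, Finset.prod_multiset_map_count]
  refine Finset.prod_congr rfl fun z _ => ?_
  rw [LinearMap.finrank_maxGenEigenspace_eq, count_roots]

theorem det_one_sub_of_isNilpotent {V : Type*} [AddCommGroup V] [Module ℂ V]
    [FiniteDimensional ℂ V] {P : V →ₗ[ℂ] V} (hP : IsNilpotent P) :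
    LinearMap.det (1 - P) = 1 := by
  have h := LinearMap.eval_charpoly P 1
  rw [hP.charpoly_eq_X_pow_finrank] at h
  simpa using h.symm

theorem det_one_add_comp_comm {V : Type*} [AddCommGroup V] [Module ℂ V] [FiniteDimensional ℂ V]
    {n : ℕ} (A : (Fin n → ℂ) →ₗ[ℂ] V) (B : V →ₗ[ℂ] (Fin n → ℂ)) :
    LinearMap.det (1 + A ∘ₗ B) = LinearMap.det (1 + B ∘ₗ A) := by
  let b := Module.finBasis ℂ V
  let c := Pi.basisFun ℂ (Fin n)
  rw [← LinearMap.det_toMatrix b, ← LinearMap.det_toMatrix c, map_add, map_add,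
    LinearMap.toMatrix_comp b c b, LinearMap.toMatrix_comp c b c, LinearMap.toMatrix_one,
    LinearMap.toMatrix_one, Matrix.det_one_add_mul_comm]

/-- The eigenvalue product of a finite rank perturbation of a nilpotent operator. -/
theorem hasProd_eigenvalues_finiteRank_sub_nilpotent {H : Type*} [AddCommGroup H] [Module ℂ H]
    {n m : ℕ} (P : H →ₗ[ℂ] H) (hP : P ^ m = 0) (U : (Fin n → ℂ) →ₗ[ℂ] H)
    (V : H →ₗ[ℂ] (Fin n → ℂ)) (R : (Fin n → ℂ) →ₗ[ℂ] H) (hR : R = U + P ∘ₗ R) :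
    HasProd (fun z : ℂ => (1 + z) ^ finrank ℂ (End.maxGenEigenspace (U ∘ₗ V - P) z))
      (LinearMap.det (1 + V ∘ₗ R)) := by
  set T : H →ₗ[ℂ] H := U ∘ₗ V - P with hT
  -- This finite-dimensional space is invariant under `P` and contains the range of `U`, hence is
  -- invariant under `T`. It carries all the spectral data of `T` away from `0`.
  let W : Submodule ℂ H := ⨆ k : Fin m, LinearMap.range ((P ^ (k : ℕ)) ∘ₗ U)
  have hmem : ∀ k c, (P ^ k) (U c) ∈ W := by
    intro k c
    by_cases hk : k < m
    · exact Submodule.mem_iSup_of_mem (⟨k, hk⟩ : Fin m) ⟨c, rfl⟩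
    · rw [← Nat.sub_add_cancel (not_lt.1 hk), pow_add, hP]
      simp
  have hPW : ∀ x ∈ W, P x ∈ W := by
    intro x hx
    have : W ≤ W.comap P := by
      refine iSup_le fun k => ?_
      rintro _ ⟨c, rfl⟩
      have := hmem (k + 1) c
      rwa [pow_succ'] at this
    exact this hx
  have hU : ∀ c, U c ∈ W := fun c => by simpa using hmem 0 c
  have hTW : ∀ x ∈ W, T x ∈ W := fun x hx => W.sub_mem (hU _) (hPW x hx)
  have hRW : ∀ c, R c ∈ W := by
    intro c
    -- Iterating `R = U + P R` telescopes; at `k = m` the subtracted term is zero.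
    have h : ∀ k, R c - (P ^ k) (R c) ∈ W := by
      intro k
      induction k with
      | zero => simp
      | succ k ih =>
        have h2 : (P ^ k) (R c) - (P ^ (k + 1)) (R c) = (P ^ k) (U c) := by
          rw [pow_succ, Module.End.mul_apply, ← map_sub]
          congr 1
          exact sub_eq_of_eq_add (LinearMap.congr_fun hR c)
        have := W.add_mem ih (hmem k c)
        rw [← h2] at this
        simpa using this
    simpa [hP] using h m
  let PW : W →ₗ[ℂ] W := P.restrict hPW
  let TW : W →ₗ[ℂ] W := T.restrict hTW
  let RW : (Fin n → ℂ) →ₗ[ℂ] W := R.codRestrict W hRW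
  let VW : W →ₗ[ℂ] (Fin n → ℂ) := V ∘ₗ W.subtype
  have hPWn : IsNilpotent PW := by
    refine ⟨m, ?_⟩
    rw [Module.End.pow_restrict]
    ext x
    simp [hP]
  have hdet : LinearMap.det (1 + TW) = LinearMap.det (1 + V ∘ₗ R) := by
    -- This uses `U = (1 - P) R`. The first factor has determinant one, since `P` is nilpotent.
    have h1 : 1 + TW = (1 - PW) * (1 + RW ∘ₗ VW) := by
      ext x
      have : U (V x) = R (V x) - P (R (V x)) := by
        exact eq_sub_of_add_eq (LinearMap.congr_fun hR (V x)).symm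
      simp [TW, PW, RW, VW, hT, this, mul_add, sub_mul]
      abel
    rw [h1, map_mul, det_one_sub_of_isNilpotent hPWn, one_mul, det_one_add_comp_comm]
    rfl
  -- Modulo `W`, the operator `T` acts as `-P`; thus `T ^ m` maps everything into `W`.
  have hpow : ∀ k x, ∃ w ∈ W, (T ^ k) x = w + (-1) ^ k • (P ^ k) x := by
    intro k x
    induction k with
    | zero => exact ⟨0, W.zero_mem, by simp⟩
    | succ k ih =>
      obtain ⟨w, hw, h⟩ := ih
      refine ⟨T w + (-1) ^ k • U (V ((P ^ k) x)),
        W.add_mem (hTW _ hw) (W.smul_of_tower_mem _ (hU _)), ?_⟩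
      rw [pow_succ', Module.End.mul_apply, h, map_add, map_zsmul, pow_succ' P,
        Module.End.mul_apply]
      simp only [hT, LinearMap.sub_apply, LinearMap.comp_apply, smul_sub, pow_succ, mul_neg,
        mul_one, neg_smul]
      abel
  have hgen : ∀ z ≠ 0, End.maxGenEigenspace T z ≤ W := by
    intro z hz x hx
    rw [End.mem_maxGenEigenspace] at hx
    obtain ⟨k, hk⟩ := hx
    -- `(X - z)^k` and `X^m` are coprime
    have hcop : IsCoprime ((X - C z : ℂ[X]) ^ k) (X ^ m) := by
      refine IsCoprime.pow ?_
      have := Polynomial.isCoprime_X_sub_C_of_isUnit_sub (a := z) (b := 0) (by simpa using hz)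
      simpa using this
    obtain ⟨a, b, hab⟩ := hcop
    have h1 := congrArg (fun p => aeval T p x) hab
    simp only [map_add, map_mul, map_pow, map_sub, aeval_X, aeval_C, map_one,
      LinearMap.add_apply, Module.End.mul_apply, Module.End.one_apply] at h1
    have h2 : ((T - algebraMap ℂ (End ℂ H) z) ^ k) x = 0 := by
      rw [← hk, Algebra.algebraMap_eq_smul_one]
    have hc := ((Commute.all b (X ^ m)).map (aeval T)).eq
    simp only [map_pow, aeval_X] at hc
    rw [h2, map_zero, zero_add, ← Module.End.mul_apply, hc, Module.End.mul_apply] at h1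
    obtain ⟨w, hw, hw2⟩ := hpow m (aeval T b x)
    rw [← h1, hw2, hP]
    simpa using hw
  have hfin : ∀ z ≠ 0, finrank ℂ (End.maxGenEigenspace T z) =
      finrank ℂ (End.maxGenEigenspace TW z) := by
    intro z hz
    have := Submodule.inf_genEigenspace T W (k := ⊤) (μ := z) hTW
    rw [inf_eq_right.2 (hgen z hz)] at this
    change finrank ℂ (End.genEigenspace T z ⊤) = _
    rw [show End.genEigenspace T z ⊤ = _ from this]
    exact (Submodule.equivMapOfInjective _ W.injective_subtype _).symm.finrank_eq
  have hfun : (fun z : ℂ => (1 + z) ^ finrank ℂ (End.maxGenEigenspace T z)) =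
      fun z : ℂ => (1 + z) ^ finrank ℂ (End.maxGenEigenspace TW z) := by
    funext z
    -- The generalised eigenspace at `0` may be infinite-dimensional, but its base `1 + 0` makes the
    -- factor `1`.
    by_cases hz : z = 0
    · simp [hz]
    · rw [hfin z hz]
  rw [hfun, ← hdet, ← prod_one_add_pow_finrank_maxGenEigenspace TW]
  refine hasProd_prod_of_ne_finset_one fun z hz => ?_
  rw [LinearMap.finrank_maxGenEigenspace_eq, ← count_roots, Multiset.count_eq_zero.2 (by simpa using hz),
    pow_zero]

end Nilpotent

/-! ### Associativity of composition -/

section Associativity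

variable {X : Type*} [MeasurableSpace X] {μ : Measure X} [SFinite μ]

theorem lintegral_compose_assoc {f : X → ℝ≥0∞} {g : X → X → ℝ≥0∞} {h : X → ℝ≥0∞}
    (hf : Measurable f) (hg : Measurable (Function.uncurry g)) (hh : Measurable h) :
    ∫⁻ u, (∫⁻ z, f z * g z u ∂μ) * h u ∂μ = ∫⁻ z, f z * ∫⁻ u, g z u * h u ∂μ ∂μ := by
  have h1 : ∀ u, (∫⁻ z, f z * g z u ∂μ) * h u = ∫⁻ z, f z * g z u * h u ∂μ := fun u =>
    (lintegral_mul_const _ (hf.mul hg.of_uncurry_right)).symm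
  have h2 : ∀ z, f z * ∫⁻ u, g z u * h u ∂μ = ∫⁻ u, f z * g z u * h u ∂μ := fun z => by
    simp only [mul_assoc]
    exact (lintegral_const_mul _ (hg.of_uncurry_left.mul hh)).symm
  simp only [h1, h2]
  refine lintegral_lintegral_swap (Measurable.aemeasurable ?_)
  exact (((hf.comp measurable_snd).mul (hg.comp measurable_swap)).mul (hh.comp measurable_fst))

theorem integral_compose_assoc {f : X → ℂ} {g : X → X → ℂ} {h : X → ℂ}
    (hf : Measurable f) (hg : Measurable (Function.uncurry g)) (hh : Measurable h)
    (hfin : ∫⁻ u, (∫⁻ z, ‖f z‖ₑ * ‖g z u‖ₑ ∂μ) * ‖h u‖ₑ ∂μ < ∞) :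
    ∫ u, (∫ z, f z * g z u ∂μ) * h u ∂μ = ∫ z, f z * ∫ u, g z u * h u ∂μ ∂μ := by
  have hm : Measurable (Function.uncurry fun u z => f z * g z u * h u) :=
    ((hf.comp measurable_snd).mul (hg.comp measurable_swap)).mul (hh.comp measurable_fst)
  have h1 : ∀ u, (∫ z, f z * g z u ∂μ) * h u = ∫ z, f z * g z u * h u ∂μ := fun u =>
    (integral_mul_const _ _).symm
  have h2 : ∀ z, f z * ∫ u, g z u * h u ∂μ = ∫ u, f z * g z u * h u ∂μ := fun z => by
    simp only [mul_assoc, integral_const_mul]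
  simp only [h1, h2]
  refine integral_integral_swap ⟨hm.aestronglyMeasurable, ?_⟩
  rw [HasFiniteIntegral, lintegral_prod _ hm.enorm.aemeasurable]
  refine lt_of_eq_of_lt (lintegral_congr fun u => ?_) hfin
  simp only [Function.uncurry, enorm_mul]
  exact lintegral_mul_const _ (hf.enorm.mul hg.of_uncurry_right.enorm)

theorem measurable_compose_lintegral {α β : Type*} [MeasurableSpace α] [MeasurableSpace β]
    {f : α → X → ℝ≥0∞} {g : X → β → ℝ≥0∞} (hf : Measurable (Function.uncurry f))
    (hg : Measurable (Function.uncurry g)) :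
    Measurable (Function.uncurry (compose (lebesgue[μ]) f g)) := by
  have : Measurable (Function.uncurry fun (p : α × β) z => f p.1 z * g z p.2) :=
    (hf.comp (by fun_prop : Measurable fun q : (α × β) × X => (q.1.1, q.2))).mul
      (hg.comp (by fun_prop : Measurable fun q : (α × β) × X => (q.2, q.1.2)))
  exact this.lintegral_prod_right

theorem measurable_compose_integral {α β : Type*} [MeasurableSpace α] [MeasurableSpace β]
    {f : α → X → ℂ} {g : X → β → ℂ} (hf : Measurable (Function.uncurry f))
    (hg : Measurable (Function.uncurry g)) :
    Measurable (Function.uncurry (compose (bochner[μ]) f g)) := by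
  have : Measurable (Function.uncurry fun (p : α × β) z => f p.1 z * g z p.2) :=
    (hf.comp (by fun_prop : Measurable fun q : (α × β) × X => (q.1.1, q.2))).mul
      (hg.comp (by fun_prop : Measurable fun q : (α × β) × X => (q.2, q.1.2)))
  exact this.stronglyMeasurable.integral_prod_right.measurable

end Associativity

namespace TransitionSystem

variable {R X X₀ X₁ : Type*} {m n : ℕ}

/-! ### Transitions between sources and targets

A source is an initial point or a point of `Fin m × X`; a target is a final point or a point of
`Fin m × X`. A transition from `a` to `b` vanishes unless `sourceLevel a ≤ targetLevel b`. -/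

/-- The first level that can be reached from a source. -/
def sourceLevel : Fin n ⊕ (Fin m × X) → ℕ :=
  Sum.elim (fun _ => 0) fun z => z.1 + 1

/-- The level of a target. -/
def targetLevel : Fin n ⊕ (Fin m × X) → ℕ :=
  Sum.elim (fun _ => m) fun z => z.1

section Algebra

variable [Mul R] [Zero R] (φ : TransitionSystem R X X₀ X₁) (I : (X → R) → R)
  (x₀ : Fin n → X₀) (x₁ : Fin n → X₁)

/-- The transition function from a source to a level. -/
def fromSource : Fin n ⊕ (Fin m × X) → ℕ → X → R
  | .inl i, t => φ.fromInit I t (x₀ i)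
  | .inr z, t => φ.between I z.1 t z.2

/-- The transition function from a source to a target. -/
def transition : Fin n ⊕ (Fin m × X) → Fin n ⊕ (Fin m × X) → R
  | .inl i, .inl j => φ.total I m (x₀ i) (x₁ j)
  | .inr z, .inl j => φ.toFinal I m z.1 z.2 (x₁ j)
  | a, .inr w => φ.fromSource I x₀ a w.1 w.2

theorem between_succ_self (r : ℕ) : φ.between I r (r + 1) = φ.step r := by
  simp [between, run]

theorem between_succ {r t : ℕ} (h : r < t) :
    φ.between I r (t + 1) = compose I (φ.between I r t) (φ.step t) := by
  obtain ⟨k, rfl⟩ := Nat.exists_eq_add_of_lt h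
  have h1 : r + k + 1 + 1 - r - 1 = k + 1 := by omega
  have h2 : r + k + 1 - r - 1 = k := by omega
  rw [between, between, if_pos (by omega), if_pos (by omega), h1, h2, run]
  congr 2
  omega

theorem between_eq_zero {r t : ℕ} (h : t ≤ r) (x y : X) : φ.between I r t x y = 0 := by
  simp [between, not_lt.2 h]

theorem fromSource_succ {a : Fin n ⊕ (Fin m × X)} {t : ℕ} (h : sourceLevel a ≤ t) (y : X) :
    φ.fromSource I x₀ a (t + 1) y = I fun z => φ.fromSource I x₀ a t z * φ.step t z y := by
  rcases a with i | z
  · rfl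
  · simp only [fromSource, φ.between_succ I (show (z.1 : ℕ) < t from h), compose]

theorem transition_inr (a : Fin n ⊕ (Fin m × X)) (w : Fin m × X) :
    φ.transition I x₀ x₁ a (.inr w) = φ.fromSource I x₀ a w.1 w.2 := by
  cases a <;> rfl

theorem transition_inl_of_lt {a : Fin n ⊕ (Fin m × X)} (h : sourceLevel a < m) (j : Fin n) :
    φ.transition I x₀ x₁ a (.inl j) =
      I fun z => φ.fromSource I x₀ a (m - 1) z * φ.final z (x₁ j) := by
  rcases a with i | z
  · rfl
  · have h1 : (z.1 : ℕ) + 1 < m := h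
    simp [transition, toFinal, compose, h1.ne, fromSource]

theorem transition_eq_zero {a b : Fin n ⊕ (Fin m × X)} (h : targetLevel b < sourceLevel a) :
    φ.transition I x₀ x₁ a b = 0 := by
  rcases b with j | w
  · rcases a with i | z
    · simp [sourceLevel] at h
    · have h : m < (z.1 : ℕ) + 1 := h
      have := z.1.2
      omega
  · rcases a with i | z
    · simp [sourceLevel] at h
    · rw [transition_inr]
      exact φ.between_eq_zero I (Nat.lt_succ_iff.1 h) _ _

end Algebra

section Domination

variable [MeasurableSpace X] {μ : Measure X} {φ : TransitionSystem ℂ X X₀ X₁}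
  {x₀ : Fin n → X₀} {x₁ : Fin n → X₁}

theorem enorm_fromSource_le {a : Fin n ⊕ (Fin m × X)} {t : ℕ} (h : sourceLevel a ≤ t) (y : X) :
    ‖φ.fromSource (bochner[μ]) x₀ a t y‖ₑ ≤ φ.abs.fromSource (lebesgue[μ]) x₀ a t y := by
  induction t, h using Nat.le_induction generalizing y with
  | base =>
    rcases a with i | z
    · exact le_rfl
    · simp only [fromSource, sourceLevel, Sum.elim_inr, between_succ_self]
      exact le_rfl
  | succ t h ih =>
    rw [φ.fromSource_succ _ _ h, φ.abs.fromSource_succ _ _ h]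
    refine (enorm_integral_le_lintegral_enorm _).trans (lintegral_mono fun z => ?_)
    rw [enorm_mul]
    exact mul_le_mul' (ih z) le_rfl

theorem enorm_transition_le (a b : Fin n ⊕ (Fin m × X)) :
    ‖φ.transition (bochner[μ]) x₀ x₁ a b‖ₑ ≤ φ.abs.transition (lebesgue[μ]) x₀ x₁ a b := by
  rcases lt_or_ge (targetLevel b) (sourceLevel a) with h | h
  · rw [φ.transition_eq_zero _ _ _ h]
    simp
  rcases b with j | w
  · rcases h.lt_or_eq with h | h
    · rw [φ.transition_inl_of_lt _ _ _ h, φ.abs.transition_inl_of_lt _ _ _ h]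
      refine (enorm_integral_le_lintegral_enorm _).trans (lintegral_mono fun z => ?_)
      rw [enorm_mul]
      exact mul_le_mul' (enorm_fromSource_le (Nat.le_sub_one_of_lt h) z) le_rfl
    · rcases a with i | z
      · simp only [transition, total, compose]
        refine (enorm_integral_le_lintegral_enorm _).trans (lintegral_mono fun z => ?_)
        rw [enorm_mul]
        exact mul_le_mul' (enorm_fromSource_le (m := m) (a := .inl i) (Nat.zero_le _) z) le_rfl
      · have h : (z.1 : ℕ) + 1 = m := h
        simp only [transition, toFinal, if_pos h]
        exact le_rfl
  · rw [transition_inr, transition_inr]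
    exact enorm_fromSource_le h _

end Domination

section Measurability

variable [MeasurableSpace X] {μ : Measure X} [SFinite μ] {φ : TransitionSystem ℂ X X₀ X₁}

theorem measurable_between (hφ : φ.IsMeasurable m) (r : ℕ) :
    ∀ {t : ℕ}, t < m → Measurable (Function.uncurry (φ.between (bochner[μ]) r t))
  | 0, _ => by
    rw [between, if_neg (by omega)]
    exact measurable_const
  | t + 1, ht => by
    rcases lt_trichotomy t r with h | rfl | h
    · rw [between, if_neg (by omega)]
      exact measurable_const
    · rw [between_succ_self]
      exact hφ.step t ht
    · rw [φ.between_succ _ h]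
      exact measurable_compose_integral (measurable_between hφ r (by omega)) (hφ.step t ht)

theorem measurable_abs_between (hφ : φ.IsMeasurable m) (r : ℕ) :
    ∀ {t : ℕ}, t < m → Measurable (Function.uncurry (φ.abs.between (lebesgue[μ]) r t))
  | 0, _ => by
    rw [between, if_neg (by omega)]
    exact measurable_const
  | t + 1, ht => by
    rcases lt_trichotomy t r with h | rfl | h
    · rw [between, if_neg (by omega)]
      exact measurable_const
    · rw [between_succ_self]
      exact (hφ.step t ht).enorm
    · rw [φ.abs.between_succ _ h]
      exact measurable_compose_lintegral (measurable_abs_between hφ r (by omega))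
        (hφ.step t ht).enorm

theorem measurable_fromInit (hφ : φ.IsMeasurable m) (a : X₀) :
    ∀ {t : ℕ}, t < m → Measurable (φ.fromInit (bochner[μ]) t a)
  | 0, _ => hφ.init a
  | t + 1, ht => (measurable_compose_integral (f := fun _ : Unit => φ.fromInit (bochner[μ]) t a)
      ((measurable_fromInit hφ a (by omega)).comp measurable_snd)
      (hφ.step t ht)).of_uncurry_left (x := ())

theorem measurable_abs_fromInit (hφ : φ.IsMeasurable m) (a : X₀) :
    ∀ {t : ℕ}, t < m → Measurable (φ.abs.fromInit (lebesgue[μ]) t a)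
  | 0, _ => (hφ.init a).enorm
  | t + 1, ht => (measurable_compose_lintegral
      (f := fun _ : Unit => φ.abs.fromInit (lebesgue[μ]) t a)
      ((measurable_abs_fromInit hφ a (by omega)).comp measurable_snd)
      (hφ.step t ht).enorm).of_uncurry_left (x := ())

theorem measurable_toFinal (hφ : φ.IsMeasurable m) {r : ℕ} (hr : r < m) (b : X₁) :
    Measurable fun x => φ.toFinal (bochner[μ]) m r x b := by
  unfold toFinal
  split_ifs with h
  · exact hφ.final b
  · exact (measurable_compose_integral (g := fun z (_ : Unit) => φ.final z b)
      (measurable_between hφ r (by omega)) ((hφ.final b).comp measurable_fst)).of_uncurry_right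
      (y := ())

variable {x₀ : Fin n → X₀} {x₁ : Fin n → X₁}

theorem measurable_fromSource (hφ : φ.IsMeasurable m) (a : Fin n ⊕ (Fin m × X)) {t : ℕ}
    (ht : t < m) : Measurable (φ.fromSource (bochner[μ]) x₀ a t) := by
  rcases a with i | z
  · exact measurable_fromInit hφ _ ht
  · exact (measurable_between hφ _ ht).of_uncurry_left

theorem measurable_abs_fromSource (hφ : φ.IsMeasurable m) (a : Fin n ⊕ (Fin m × X)) {t : ℕ}
    (ht : t < m) : Measurable (φ.abs.fromSource (lebesgue[μ]) x₀ a t) := by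
  rcases a with i | z
  · exact measurable_abs_fromInit hφ _ ht
  · exact (measurable_abs_between hφ _ ht).of_uncurry_left

/-! ### Compositions at an intermediate level -/

/-- Compositions are built by adding steps on the right, so splitting them at an intermediate level
`s` requires associativity, that is Tonelli's theorem, at each step. -/
theorem lintegral_fromSource_mul_between (hφ : φ.IsMeasurable m) {a : Fin n ⊕ (Fin m × X)}
    {s t : ℕ} (ha : sourceLevel a ≤ s) (hst : s + 1 ≤ t) (ht : t < m) (y : X) :
    ∫⁻ z, φ.abs.fromSource (lebesgue[μ]) x₀ a s z * φ.abs.between (lebesgue[μ]) s t z y ∂μ =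
      φ.abs.fromSource (lebesgue[μ]) x₀ a t y := by
  induction t, hst using Nat.le_induction generalizing y with
  | base => simp only [between_succ_self, φ.abs.fromSource_succ _ _ ha]
  | succ t h ih =>
    rw [φ.abs.fromSource_succ _ _ (by omega), φ.abs.between_succ _ h]
    simp only [compose]
    rw [← lintegral_compose_assoc (h := fun u => φ.abs.step t u y)
      (measurable_abs_fromSource hφ a (by omega))
      (measurable_abs_between hφ s (by omega)) (hφ.step t ht).of_uncurry_right.enorm]
    exact lintegral_congr fun u => by rw [ih (by omega)]

theorem integral_fromSource_mul_between (hφ : φ.IsMeasurable m) {a : Fin n ⊕ (Fin m × X)}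
    {s t : ℕ} (ha : sourceLevel a ≤ s) (hst : s + 1 ≤ t) (ht : t < m) {y : X}
    (hfin : φ.abs.fromSource (lebesgue[μ]) x₀ a t y < ∞) :
    ∫ z, φ.fromSource (bochner[μ]) x₀ a s z * φ.between (bochner[μ]) s t z y ∂μ =
      φ.fromSource (bochner[μ]) x₀ a t y := by
  induction t, hst using Nat.le_induction generalizing y with
  | base => simp only [between_succ_self, φ.fromSource_succ _ _ ha]
  | succ t h ih =>
    have hfin' := hfin
    rw [φ.abs.fromSource_succ _ _ (by omega)] at hfin
    rw [φ.fromSource_succ _ _ (by omega), φ.between_succ _ h]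
    simp only [compose]
    rw [← integral_compose_assoc (measurable_fromSource hφ a (by omega))
      (measurable_between hφ s (by omega)) (hφ.step t ht).of_uncurry_right]
    · have hmeas : Measurable fun u => φ.abs.fromSource (lebesgue[μ]) x₀ a t u * φ.abs.step t u y :=
        (measurable_abs_fromSource hφ a (by omega)).mul (hφ.step t ht).of_uncurry_right.enorm
      refine integral_congr_ae ?_
      filter_upwards [ae_lt_top hmeas hfin.ne] with u hu
      -- Finiteness of the product bounds the composed transition at `u` only where the last step
      -- does not vanish; elsewhere the integrand is zero anyway.
      by_cases h0 : φ.step t u y = 0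
      · simp [h0]
      · rw [ih (by omega)]
        refine lt_top_iff_ne_top.2 fun htop => ?_
        rw [htop, ENNReal.top_mul] at hu
        · exact lt_irrefl _ hu
        · exact enorm_ne_zero.2 h0
    · refine lt_of_le_of_lt (lintegral_mono fun u => mul_le_mul' ?_ le_rfl) hfin
      rw [← lintegral_fromSource_mul_between hφ ha h (by omega)]
      refine lintegral_mono fun z => mul_le_mul' (enorm_fromSource_le ha z) ?_
      -- A transition between two levels is read as one from a source at `(s, z)`, in a system
      -- without initial points.
      exact enorm_fromSource_le (m := s + 1) (n := 0) (x₀ := Fin.elim0)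
        (a := .inr (⟨s, by omega⟩, z)) h u

theorem lintegral_transition_mul_transition (hφ : φ.IsMeasurable m) {a b : Fin n ⊕ (Fin m × X)}
    {s : Fin m} (ha : sourceLevel a ≤ s) (hb : s < targetLevel b) :
    ∫⁻ z, φ.abs.transition (lebesgue[μ]) x₀ x₁ a (.inr (s, z)) *
        φ.abs.transition (lebesgue[μ]) x₀ x₁ (.inr (s, z)) b ∂μ =
      φ.abs.transition (lebesgue[μ]) x₀ x₁ a b := by
  simp only [transition_inr]
  rcases b with j | w
  · rw [φ.abs.transition_inl_of_lt _ _ _ (by omega)]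
    by_cases hs : (s : ℕ) + 1 = m
    · have : m - 1 = (s : ℕ) := by omega
      simp only [transition, toFinal, if_pos hs, this]
    · simp only [transition, toFinal, if_neg hs, compose]
      rw [← lintegral_compose_assoc (h := fun u => φ.abs.final u (x₁ j))
        (measurable_abs_fromSource hφ a s.2)
        (measurable_abs_between hφ s (t := m - 1) (by omega)) (hφ.final _).enorm]
      refine lintegral_congr fun u => ?_
      rw [lintegral_fromSource_mul_between hφ ha (by omega) (by omega)]
  · rw [transition_inr]
    exact lintegral_fromSource_mul_between hφ ha hb w.1.2 _

theorem integral_transition_mul_transition (hφ : φ.IsMeasurable m) {a b : Fin n ⊕ (Fin m × X)}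
    {s : Fin m} (ha : sourceLevel a ≤ s) (hb : s < targetLevel b)
    (hfin : φ.abs.transition (lebesgue[μ]) x₀ x₁ a b < ∞) :
    ∫ z, φ.transition (bochner[μ]) x₀ x₁ a (.inr (s, z)) *
        φ.transition (bochner[μ]) x₀ x₁ (.inr (s, z)) b ∂μ =
      φ.transition (bochner[μ]) x₀ x₁ a b := by
  simp only [transition_inr]
  rcases b with j | w
  · rw [φ.abs.transition_inl_of_lt _ _ _ (by omega)] at hfin
    rw [φ.transition_inl_of_lt _ _ _ (by omega)]
    by_cases hs : (s : ℕ) + 1 = m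
    · have : m - 1 = (s : ℕ) := by omega
      simp only [transition, toFinal, if_pos hs, this]
    · simp only [transition, toFinal, if_neg hs, compose]
      rw [← integral_compose_assoc (measurable_fromSource hφ a s.2)
        (measurable_between hφ s (by omega)) (hφ.final _)]
      · have hmeas : Measurable fun u =>
            φ.abs.fromSource (lebesgue[μ]) x₀ a (m - 1) u * φ.abs.final u (x₁ j) :=
          (measurable_abs_fromSource hφ a (by omega)).mul (hφ.final _).enorm
        refine integral_congr_ae ?_
        filter_upwards [ae_lt_top hmeas hfin.ne] with u hu
        by_cases h0 : φ.final u (x₁ j) = 0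
        · simp [h0]
        · rw [integral_fromSource_mul_between hφ ha (by omega) (by omega)]
          refine lt_top_iff_ne_top.2 fun htop => ?_
          rw [htop, ENNReal.top_mul] at hu
          · exact lt_irrefl _ hu
          · exact enorm_ne_zero.2 h0
      · refine lt_of_le_of_lt (lintegral_mono fun u => mul_le_mul' ?_ le_rfl) hfin
        rw [← lintegral_fromSource_mul_between hφ ha (show (s : ℕ) + 1 ≤ m - 1 by omega) (by omega)]
        refine lintegral_mono fun z => mul_le_mul' (enorm_fromSource_le ha z) ?_
        exact enorm_fromSource_le (x₀ := x₀) (a := .inr (s, z))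
          (show (s : ℕ) + 1 ≤ m - 1 by omega) u
  · rw [transition_inr] at hfin ⊢
    exact integral_fromSource_mul_between hφ ha hb w.1.2 hfin

theorem measurable_transition_left (hφ : φ.IsMeasurable m) (b : Fin n ⊕ (Fin m × X)) (s : Fin m) :
    Measurable fun z => φ.transition (bochner[μ]) x₀ x₁ (.inr (s, z)) b := by
  rcases b with j | w
  · exact measurable_toFinal hφ s.2 _
  · exact (measurable_between hφ s w.1.2).of_uncurry_right

theorem integrable_transition_mul_transition (hφ : φ.IsMeasurable m)
    {a b : Fin n ⊕ (Fin m × X)} {s : Fin m} (ha : sourceLevel a ≤ s) (hb : s < targetLevel b)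
    (hfin : φ.abs.transition (lebesgue[μ]) x₀ x₁ a b < ∞) :
    Integrable (fun z => φ.transition (bochner[μ]) x₀ x₁ a (.inr (s, z)) *
        φ.transition (bochner[μ]) x₀ x₁ (.inr (s, z)) b) μ := by
  refine ⟨Measurable.aestronglyMeasurable ?_, ?_⟩
  · refine Measurable.mul ?_ (measurable_transition_left hφ b s)
    simp only [transition_inr]
    exact measurable_fromSource hφ a s.2
  · rw [← lintegral_transition_mul_transition hφ ha hb] at hfin
    refine lt_of_le_of_lt (lintegral_mono fun z => ?_) hfin
    rw [enorm_mul]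
    exact mul_le_mul' (enorm_transition_le _ _) (enorm_transition_le _ _)

end Measurability

end TransitionSystem

/-! ### The reference measure -/

section RefMeasure

variable {X : Type*} [MeasurableSpace X] {μ : Measure X} [SigmaFinite μ] {m : ℕ}

instance : SigmaFinite (refMeasure μ m) := by
  unfold refMeasure
  infer_instance

theorem refMeasure_apply {s : Set (Fin m × X)} (hs : MeasurableSet s) :
    refMeasure μ m s = ∑ r, μ (Prod.mk r ⁻¹' s) := by
  rw [refMeasure, Measure.prod_apply hs, lintegral_count, tsum_fintype]

theorem refMeasure_eq_sum : refMeasure μ m = ∑ r : Fin m, μ.map (Prod.mk r) := by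
  ext s hs
  rw [refMeasure_apply hs, Measure.finsetSum_apply]
  exact Finset.sum_congr rfl fun r _ => (Measure.map_apply (by fun_prop) hs).symm

theorem measurableEmbedding_prodMk (r : Fin m) :
    MeasurableEmbedding (Prod.mk r : X → Fin m × X) :=
  MeasurableEmbedding.prodMk_left r .id

theorem integrable_refMeasure_iff {f : Fin m × X → ℂ} :
    Integrable f (refMeasure μ m) ↔ ∀ r, Integrable (fun x => f (r, x)) μ := by
  rw [refMeasure_eq_sum, integrable_finsetSum_measure]
  simp only [Finset.mem_univ, forall_const, (measurableEmbedding_prodMk _).integrable_map_iff]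
  rfl

theorem integral_refMeasure {f : Fin m × X → ℂ} (hf : Integrable f (refMeasure μ m)) :
    ∫ z, f z ∂(refMeasure μ m) = ∑ r, ∫ x, f (r, x) ∂μ := by
  rw [refMeasure_eq_sum, integrable_finsetSum_measure] at hf
  rw [refMeasure_eq_sum, integral_finsetSum_measure hf]
  exact Finset.sum_congr rfl fun r _ => (measurableEmbedding_prodMk r).integral_map _

theorem ae_refMeasure_iff {p : Fin m × X → Prop} :
    (∀ᵐ z ∂(refMeasure μ m), p z) ↔ ∀ r, ∀ᵐ x ∂μ, p (r, x) := by
  have h : ∀ z, p z ↔ z ∈ {z | p z} := fun _ => Iff.rfl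
  rw [refMeasure_eq_sum, ← Measure.sum_fintype, Measure.ae_sum_iff]
  exact forall_congr' fun r => (measurableEmbedding_prodMk r).ae_map_iff

theorem measurable_prod_fin {β : Type*} [MeasurableSpace β] {f : Fin m × X → β}
    (hf : ∀ r, Measurable fun x => f (r, x)) : Measurable f :=
  measurable_from_prod_countable_right hf

theorem measurable_prod_fin_prod_fin {β : Type*} [MeasurableSpace β]
    {f : (Fin m × X) × (Fin m × X) → β}
    (hf : ∀ r s, Measurable fun p : X × X => f ((r, p.1), (s, p.2))) : Measurable f := by
  have h : Measurable fun q : (Fin m × Fin m) × (X × X) => f ((q.1.1, q.2.1), (q.1.2, q.2.2)) :=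
    measurable_from_prod_countable_right fun rs => hf rs.1 rs.2
  exact h.comp (by fun_prop : Measurable fun q : (Fin m × X) × (Fin m × X) =>
    ((q.1.1, q.2.1), (q.1.2, q.2.2)))

/-- Distinctness is essential: a repeated coordinate would land on the diagonal, which can be a null
set. The map preserves null sets only, as the remaining factors may have infinite mass. -/
theorem quasiMeasurePreserving_eval_pair {Λ : Type*} [MeasurableSpace Λ] (lam : Measure Λ)
    [SigmaFinite lam] {k : ℕ} {i j : Fin k} (hij : i ≠ j) :
    Measure.QuasiMeasurePreserving (fun z : Fin k → Λ => (z i, z j))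
      (Measure.pi fun _ => lam) (lam.prod lam) := by
  rcases k with _ | k
  · exact i.elim0
  · obtain ⟨j, rfl⟩ := Fin.exists_succAbove_eq hij.symm
    exact (QuasiMeasurePreserving.prodMap (Measure.QuasiMeasurePreserving.id lam)
      (Measure.quasiMeasurePreserving_eval (fun _ : Fin k => lam) j)).comp
      (measurePreserving_piFinSuccAbove (fun _ => lam) i).quasiMeasurePreserving

end RefMeasure

theorem measurable_det {α ι : Type*} [MeasurableSpace α] [Fintype ι] [DecidableEq ι]
    {M : α → Matrix ι ι ℂ} (hM : ∀ i j, Measurable fun x => M x i j) :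
    Measurable fun x => (M x).det := by
  simp only [Matrix.det_apply]
  refine Finset.measurable_fun_sum _ fun σ _ => Measurable.const_smul ?_ _
  exact Finset.measurable_fun_prod _ fun i _ => hM _ _

namespace TransitionSystem

/-! ### Counting sources and targets -/

section Counting

variable {X : Type*} {m n : ℕ}

theorem card_filter_sum {ι : Type*} [Fintype ι] (p : Fin n ⊕ ι → Prop)
    [DecidablePred p] : (Finset.univ.filter p).card =
      (Finset.univ.filter fun i => p (.inl i)).card +
        (Finset.univ.filter fun i => p (.inr i)).card := by
  simp only [Finset.card_filter, Fintype.sum_sum_type]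

theorem card_sourceLevel_le {ι : Type*} [Fintype ι] (z : ι → Fin m × X) (s : Fin m) :
    (Finset.univ.filter fun a : Fin n ⊕ ι => sourceLevel (Sum.map id z a) ≤ s).card =
      n + (Finset.univ.filter fun i => (z i).1 < s).card := by
  rw [card_filter_sum]
  simp [sourceLevel]

theorem card_targetLevel_le {ι : Type*} [Fintype ι] (z : ι → Fin m × X) (s : Fin m) :
    (Finset.univ.filter fun b : Fin n ⊕ ι => targetLevel (Sum.map id z b) ≤ s).card =
      (Finset.univ.filter fun i => (z i).1 < s).card +
        (Finset.univ.filter fun i => (z i).1 = s).card := by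
  classical
  rw [card_filter_sum, ← Finset.card_union_of_disjoint]
  · have : ¬m ≤ (s : ℕ) := by omega
    simp only [targetLevel, Sum.map_inl, Sum.elim_inl, this, Finset.filter_false, Finset.card_empty,
      zero_add, Sum.map_inr, Sum.elim_inr]
    congr 1
    ext i
    simp [← le_iff_lt_or_eq]
  · rw [Finset.disjoint_filter]
    exact fun i _ h => h.ne

end Counting

variable {X X₀ X₁ : Type*} [MeasurableSpace X] {m n : ℕ}

/-! ### Configuration determinants -/

section ConfigDet

variable (φ : TransitionSystem ℂ X X₀ X₁) (μ : Measure X) (x₀ : Fin n → X₀) (x₁ : Fin n → X₁)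

/-- The matrix of transitions between the sources and the targets among the initial points, the
final points, and the points of a configuration. -/
def configMatrix {ι : Type*} (z : ι → Fin m × X) : Matrix (Fin n ⊕ ι) (Fin n ⊕ ι) ℂ :=
  Matrix.of fun a b => φ.transition (bochner[μ]) x₀ x₁ (Sum.map id z a) (Sum.map id z b)

/-- The signed determinant of `configMatrix`; it is the unnormalised correlation function. -/
def configDet {ι : Type*} [Fintype ι] [DecidableEq ι] (z : ι → Fin m × X) : ℂ :=
  (-1) ^ Fintype.card ι * (φ.configMatrix μ x₀ x₁ z).det

variable {φ μ x₀ x₁}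

theorem configDet_comp_equiv {ι κ : Type*} [Fintype ι] [DecidableEq ι] [Fintype κ] [DecidableEq κ]
    (e : κ ≃ ι) (z : ι → Fin m × X) :
    φ.configDet μ x₀ x₁ (z ∘ e) = φ.configDet μ x₀ x₁ z := by
  have h : φ.configMatrix μ x₀ x₁ (z ∘ e) = (φ.configMatrix μ x₀ x₁ z).submatrix
      (Equiv.sumCongr (Equiv.refl _) e) (Equiv.sumCongr (Equiv.refl _) e) := by
    ext a b
    rcases a with a | a <;> rcases b with b | b <;> rfl
  rw [configDet, configDet, h, Matrix.det_submatrix_equiv_self, Fintype.card_congr e]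

theorem configMatrix_eq_zero {ι : Type*} (z : ι → Fin m × X) {a b : Fin n ⊕ ι}
    (h : targetLevel (Sum.map id z b) < sourceLevel (Sum.map id z a)) :
    φ.configMatrix μ x₀ x₁ z a b = 0 :=
  φ.transition_eq_zero _ _ _ h

/-- The columns with target level at most `s` vanish outside the rows with source level at most `s`.
With more than `n` points on level `s` there are more such columns than such rows. -/
theorem configDet_eq_zero {ι : Type*} [Fintype ι] [DecidableEq ι] (z : ι → Fin m × X) (s : Fin m)
    (h : n < (Finset.univ.filter fun i => (z i).1 = s).card) : φ.configDet μ x₀ x₁ z = 0 := by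
  rw [configDet, det_eq_zero_of_card_lt (fun a => sourceLevel (Sum.map id z a) ≤ s)
    (fun b => targetLevel (Sum.map id z b) ≤ s), mul_zero]
  · exact fun a b ha hb => configMatrix_eq_zero z (by omega)
  · rw [card_sourceLevel_le, card_targetLevel_le]
    omega

theorem configDet_eq_zero_of_card_lt {ι : Type*} [Fintype ι] [DecidableEq ι] (z : ι → Fin m × X)
    (h : m * n < Fintype.card ι) : φ.configDet μ x₀ x₁ z = 0 := by
  obtain ⟨s, hs⟩ : ∃ s, n < (Finset.univ.filter fun i => (z i).1 = s).card := by
    by_contra! hc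
    have := Finset.sum_le_sum fun s (_ : s ∈ Finset.univ) => hc s
    rw [← Finset.card_eq_sum_card_fiberwise (fun _ _ => Finset.mem_univ _)] at this
    simp at this
    omega
  exact configDet_eq_zero z s hs

theorem configDet_of_isEmpty {ι : Type*} [Fintype ι] [DecidableEq ι] [IsEmpty ι]
    (z : ι → Fin m × X) : φ.configDet μ x₀ x₁ z = (φ.totalMatrix μ m x₀ x₁).det := by
  have h : φ.configMatrix μ x₀ x₁ z =
      (φ.totalMatrix μ m x₀ x₁).submatrix (Equiv.sumEmpty _ _) (Equiv.sumEmpty _ _) := by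
    ext a b
    rcases a with a | a
    · rcases b with b | b
      · rfl
      · exact isEmptyElim b
    · exact isEmptyElim a
  rw [configDet, h, Matrix.det_submatrix_equiv_self]
  simp

/-- The kernel matrix is minus the Schur complement of the block `A`; the sign `(-1)^k` in
`configDet` absorbs the minus. -/
theorem configDet_eq_det_mul_det_kernel {ι : Type*} [Fintype ι] [DecidableEq ι]
    (hA : IsUnit (φ.totalMatrix μ m x₀ x₁)) (z : ι → Fin m × X) :
    φ.configDet μ x₀ x₁ z = (φ.totalMatrix μ m x₀ x₁).det *
      (Matrix.of fun i j => φ.kernel μ m x₀ x₁ (z i) (z j)).det := by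
  set A := φ.totalMatrix μ m x₀ x₁
  let B : Matrix (Fin n) ι ℂ := Matrix.of fun i j => φ.fromInitialPoint μ m x₀ i (z j)
  let C : Matrix ι (Fin n) ℂ := Matrix.of fun i j => φ.toFinalPoint μ m x₁ j (z i)
  let D : Matrix ι ι ℂ := Matrix.of fun i j => φ.transitionKernel μ m (z i) (z j)
  have h : φ.configMatrix μ x₀ x₁ z = Matrix.fromBlocks A B C D := by
    ext a b
    rcases a with a | a <;> rcases b with b | b <;> rfl
  have hA' : IsUnit A.det := (Matrix.isUnit_iff_isUnit_det A).1 hA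
  let _ := Matrix.invertibleOfIsUnitDet A hA'
  have hK : (Matrix.of fun i j => φ.kernel μ m x₀ x₁ (z i) (z j)) = -(D - C * ⅟A * B) := by
    ext i j
    rw [Matrix.invOf_eq_nonsing_inv]
    simp only [Matrix.of_apply, kernel, Matrix.neg_apply, Matrix.sub_apply, neg_sub, Matrix.mul_apply,
      D, C, B, A, Finset.sum_mul]
    rw [Finset.sum_comm]
  rw [configDet, h, Matrix.det_fromBlocks₁₁, hK, Matrix.det_neg]
  ring

/-- Integrating out one point at a given level. -/
theorem integral_configDet_cons_level [SFinite μ] (hφ : φ.IsMeasurable m) {k : ℕ}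
    (z : Fin k → Fin m × X)
    (hz : ∀ a b, φ.abs.transition (lebesgue[μ]) x₀ x₁ (Sum.map id z a) (Sum.map id z b) < ∞)
    (s : Fin m) :
    Integrable (fun y => φ.configDet μ x₀ x₁ (Fin.cons (s, y) z : Fin (k + 1) → Fin m × X)) μ ∧
    ∫ y, φ.configDet μ x₀ x₁ (Fin.cons (s, y) z : Fin (k + 1) → Fin m × X) ∂μ =
      (n - (Finset.univ.filter fun i => (z i).1 = s).card : ℂ) * φ.configDet μ x₀ x₁ z := by
  set M := φ.configMatrix μ x₀ x₁ z
  let T : Fin n ⊕ (Fin m × X) → Fin n ⊕ (Fin m × X) → ℂ := φ.transition (bochner[μ]) x₀ x₁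
  let u : X → Fin n ⊕ Fin k → ℂ := fun y a => T (Sum.map id z a) (.inr (s, y))
  let v : X → Fin n ⊕ Fin k → ℂ := fun y b => T (.inr (s, y)) (Sum.map id z b)
  let e : (Fin n ⊕ Fin k) ⊕ Unit ≃ Fin n ⊕ Fin (k + 1) :=
    (Equiv.sumAssoc _ _ _).trans (Equiv.sumCongr (Equiv.refl _)
      ((Equiv.optionEquivSumPUnit (Fin k)).symm.trans (finSuccEquiv k).symm))
  have h1 : ∀ y, φ.configDet μ x₀ x₁ (Fin.cons (s, y) z : Fin (k + 1) → Fin m × X) =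
      (-1) ^ k * ∑ a, ∑ b, M.adjugate b a * (u y a * v y b) := by
    intro y
    have h : (φ.configMatrix μ x₀ x₁ (Fin.cons (s, y) z : Fin (k + 1) → Fin m × X)).submatrix e e =
        Matrix.fromBlocks M (Matrix.replicateCol Unit (u y)) (Matrix.replicateRow Unit (v y)) 0 := by
      ext a b
      rcases a with (a | a) | a <;> rcases b with (b | b) | b <;> try rfl
      -- The corner of the bordered matrix is zero because there is no transition from a level to
      -- itself.
      exact φ.transition_eq_zero (bochner[μ]) x₀ x₁ (a := .inr (s, y)) (b := .inr (s, y))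
        (Nat.lt_succ_self (s : ℕ))
    rw [configDet, ← Matrix.det_submatrix_equiv_self e, h, det_bordered, Fintype.card_fin]
    ring
  -- If `s` lies between the levels of `a` and `b`, this is the composition rule. Otherwise one of
  -- the two factors vanishes identically.
  have h2 : ∀ a b, Integrable (fun y => u y a * v y b) μ ∧ ∫ y, u y a * v y b ∂μ =
      if sourceLevel (Sum.map id z a) ≤ s ∧ s < targetLevel (Sum.map id z b) then M a b else 0 := by
    intro a b
    by_cases ha : sourceLevel (Sum.map id z a) ≤ s
    · by_cases hb : s < targetLevel (Sum.map id z b)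
      · rw [if_pos ⟨ha, hb⟩]
        exact ⟨integrable_transition_mul_transition hφ ha hb (hz a b),
          integral_transition_mul_transition hφ ha hb (hz a b)⟩
      · have : ∀ y, v y b = 0 := fun y =>
          φ.transition_eq_zero _ _ _ (Nat.lt_succ_of_le (not_lt.1 hb))
        simp [this, hb]
    · have : ∀ y, u y a = 0 := fun y => φ.transition_eq_zero _ _ _ (not_le.1 ha)
      simp [this, ha]
  have hint : ∀ a b, Integrable (fun y => M.adjugate b a * (u y a * v y b)) μ := fun a b =>
    (h2 a b).1.const_mul _
  simp only [h1]
  refine ⟨Integrable.const_mul (integrable_finsetSum _ fun a _ =>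
    integrable_finsetSum _ fun b _ => hint a b) _, ?_⟩
  rw [integral_const_mul, integral_finsetSum _ fun a _ =>
    integrable_finsetSum _ fun b _ => hint a b]
  simp only [integral_finsetSum _ fun b _ => hint _ b, integral_const_mul, (h2 _ _).2]
  -- Below or at level `s` there are `n + #{< s}` sources and `#{< s} + #{= s}` targets, so the
  -- difference is `n - #{= s}`.
  rw [sum_adjugate_mul_ite M _ _ fun a b ha hb => configMatrix_eq_zero z (by omega)]
  simp only [not_lt]
  rw [card_sourceLevel_le, card_targetLevel_le, configDet, Fintype.card_fin]
  push_cast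
  ring

/-- Integrating out one point. -/
theorem integral_configDet_cons [SigmaFinite μ] (hφ : φ.IsMeasurable m) {k : ℕ}
    (z : Fin k → Fin m × X)
    (hz : ∀ a b, φ.abs.transition (lebesgue[μ]) x₀ x₁ (Sum.map id z a) (Sum.map id z b) < ∞) :
    ∫ w, φ.configDet μ x₀ x₁ (Fin.cons w z : Fin (k + 1) → Fin m × X) ∂(refMeasure μ m) =
      (m * n - k : ℂ) * φ.configDet μ x₀ x₁ z := by
  rw [integral_refMeasure (integrable_refMeasure_iff.2 fun s =>
    (integral_configDet_cons_level hφ z hz s).1)]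
  simp only [(integral_configDet_cons_level hφ z hz _).2, ← Finset.sum_mul]
  congr 1
  rw [Finset.sum_sub_distrib, ← Nat.cast_sum,
    ← Nat.cast_sum, ← Finset.card_eq_sum_card_fiberwise (f := fun i => (z i).1)
      (fun _ _ => Finset.mem_univ _)]
  simp

/-- For two different points this follows from absolute convergence almost everywhere on the
product. A point paired with itself is not covered by that, but there the transition is zero. -/
theorem ae_transition_lt_top [SigmaFinite μ] (hφ : φ.IsMeasurable m)
    (hwd : φ.WellDefined μ m x₀ x₁) (k : ℕ) :
    ∀ᵐ z : Fin k → Fin m × X ∂(Measure.pi fun _ => refMeasure μ m), ∀ a b,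
      φ.abs.transition (lebesgue[μ]) x₀ x₁ (Sum.map id z a) (Sum.map id z b) < ∞ := by
  refine ae_all_iff.2 fun a => ae_all_iff.2 fun b => ?_
  rcases a with i | i <;> rcases b with j | j
  · exact Filter.Eventually.of_forall fun z => hwd.total i j
  · have h : ∀ᵐ w ∂(refMeasure μ m), φ.abs.fromInit (lebesgue[μ]) w.1 (x₀ i) w.2 < ∞ :=
      ae_refMeasure_iff.2 fun s => hwd.fromInit s i
    exact (Measure.quasiMeasurePreserving_eval (fun _ => refMeasure μ m) j).ae h
  · have h : ∀ᵐ w ∂(refMeasure μ m), φ.abs.toFinal (lebesgue[μ]) m w.1 w.2 (x₁ j) < ∞ :=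
      ae_refMeasure_iff.2 fun s => hwd.toFinal s j
    exact (Measure.quasiMeasurePreserving_eval (fun _ => refMeasure μ m) i).ae h
  · by_cases hij : i = j
    · subst hij
      refine Filter.Eventually.of_forall fun z => ?_
      rw [φ.abs.transition_eq_zero _ _ _ (Nat.lt_succ_self _)]
      exact ENNReal.zero_lt_top
    · have hmeas : Measurable fun p : (Fin m × X) × (Fin m × X) =>
          φ.abs.between (lebesgue[μ]) p.1.1 p.2.1 p.1.2 p.2.2 :=
        measurable_prod_fin_prod_fin fun r s => measurable_abs_between hφ r s.2
      have h : ∀ᵐ p ∂(refMeasure μ m).prod (refMeasure μ m),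
          φ.abs.between (lebesgue[μ]) p.1.1 p.2.1 p.1.2 p.2.2 < ∞ := by
        refine (Measure.ae_prod_iff_ae_ae (hmeas measurableSet_Iio)).2 ?_
        refine ae_refMeasure_iff.2 fun r => ?_
        simp only [ae_refMeasure_iff]
        refine ae_all_iff.2 fun s => ?_
        by_cases hrs : r < s
        · exact Measure.ae_ae_of_ae_prod (hwd.between r s hrs)
        · refine Filter.Eventually.of_forall fun x => Filter.Eventually.of_forall fun y => ?_
          rw [φ.abs.between_eq_zero _ (not_lt.1 hrs)]
          exact ENNReal.zero_lt_top
      exact (quasiMeasurePreserving_eval_pair (refMeasure μ m) hij).ae h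

theorem measurable_transitionKernel [SigmaFinite μ] (hφ : φ.IsMeasurable m) :
    Measurable fun p : (Fin m × X) × (Fin m × X) => φ.transitionKernel μ m p.1 p.2 :=
  measurable_prod_fin_prod_fin fun r s => measurable_between hφ r s.2

theorem measurable_fromInitialPoint [SigmaFinite μ] (hφ : φ.IsMeasurable m) (i : Fin n) :
    Measurable (φ.fromInitialPoint μ m x₀ i) :=
  measurable_prod_fin fun s => measurable_fromInit hφ _ s.2

theorem measurable_toFinalPoint [SigmaFinite μ] (hφ : φ.IsMeasurable m) (j : Fin n) :
    Measurable (φ.toFinalPoint μ m x₁ j) :=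
  measurable_prod_fin fun s => measurable_toFinal hφ s.2 _

theorem measurable_kernel [SigmaFinite μ] (hφ : φ.IsMeasurable m) :
    Measurable fun p : (Fin m × X) × (Fin m × X) => φ.kernel μ m x₀ x₁ p.1 p.2 := by
  refine Measurable.sub ?_ (measurable_transitionKernel hφ)
  refine Finset.measurable_fun_sum _ fun i _ => Finset.measurable_fun_sum _ fun j _ => ?_
  exact (((measurable_toFinalPoint hφ i).comp measurable_fst).mul_const _).mul
    ((measurable_fromInitialPoint hφ j).comp measurable_snd)

theorem measurable_configDet [SigmaFinite μ] (hφ : φ.IsMeasurable m) {ι : Type*} [Fintype ι]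
    [DecidableEq ι] : Measurable fun z : ι → Fin m × X => φ.configDet μ x₀ x₁ z := by
  refine Measurable.const_mul (measurable_det fun a b => ?_) _
  rcases a with i | i <;> rcases b with j | j
  · exact measurable_const
  · exact (measurable_fromInitialPoint hφ i).comp (measurable_pi_apply j)
  · exact (measurable_toFinalPoint hφ j).comp (measurable_pi_apply i)
  · exact (measurable_transitionKernel hφ).comp
      (by fun_prop : Measurable fun z : ι → Fin m × X => (z i, z j))

end ConfigDet

end TransitionSystem

/-! ### Enumerating the levels -/

section Levels

variable {m n : ℕ}

/-- The initial points come first, followed by the levels. -/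
def rowEquiv (m n : ℕ) : Fin (m + 1) × Fin n ≃ Fin n ⊕ (Fin m × Fin n) :=
  (Equiv.prodCongr (finSuccEquiv' 0) (Equiv.refl _)).trans optionProdEquiv

/-- The levels come first, followed by the final points. -/
def colEquiv (m n : ℕ) : Fin (m + 1) × Fin n ≃ Fin n ⊕ (Fin m × Fin n) :=
  (Equiv.prodCongr (finSuccEquiv' (Fin.last m)) (Equiv.refl _)).trans optionProdEquiv

theorem rowEquiv_zero (i : Fin n) : rowEquiv m n (0, i) = .inl i := by
  simp [rowEquiv]

theorem rowEquiv_succ (r : Fin m) (i : Fin n) : rowEquiv m n (r.succ, i) = .inr (r, i) := by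
  have h := finSuccEquiv'_succAbove (0 : Fin (m + 1)) r
  rw [Fin.succAbove_zero] at h
  simp [rowEquiv, h]

theorem colEquiv_last (i : Fin n) : colEquiv m n (Fin.last m, i) = .inl i := by
  simp [colEquiv]

theorem colEquiv_castSucc (r : Fin m) (i : Fin n) :
    colEquiv m n (r.castSucc, i) = .inr (r, i) := by
  have h := finSuccEquiv'_succAbove (Fin.last m) r
  rw [Fin.succAbove_last] at h
  simp [colEquiv, h]

/-- The sign that relates the determinant of a full configuration to its weight. -/
def levelSign (m n : ℕ) : ℂ :=
  (-1) ^ (m * n) * (Equiv.Perm.sign ((colEquiv m n).trans (rowEquiv m n).symm) : ℂ)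

theorem levelSign_ne_zero (m n : ℕ) : levelSign m n ≠ 0 := by
  refine mul_ne_zero (pow_ne_zero _ (by norm_num)) ?_
  simp

/-- The number of self-embeddings of the full set of labels that preserve the levels. -/
def levelCard (m n : ℕ) : ℕ :=
  Fintype.card {ρ : Fin m × Fin n ↪ Fin m × Fin n // ∀ q, (ρ q).1 = q.1}

theorem levelCard_ne_zero (m n : ℕ) : levelCard m n ≠ 0 :=
  (Fintype.card_pos_iff.2 ⟨⟨Function.Embedding.refl _, fun _ => rfl⟩⟩).ne'

/-- Relabelling along `f₀` turns the embeddings with the same levels into level-preserving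
self-embeddings, so their number does not depend on the level pattern. -/
theorem card_embedding_fst_eq {N : ℕ} (f₀ : Fin N ≃ Fin m × Fin n) :
    (Finset.univ.filter fun f : Fin N ↪ Fin m × Fin n =>
      (fun i => (f i).1) = fun i => (f₀ i).1).card = levelCard m n := by
  rw [← Fintype.card_subtype, levelCard]
  refine Fintype.card_congr ((Equiv.embeddingCongr f₀ (Equiv.refl _)).subtypeEquiv fun f => ?_)
  rw [funext_iff, ← f₀.symm.forall_congr_right]
  simp

/-- The points assigned to a level are at most `n` in number, so they can be given distinct second
labels, level by level. -/
theorem exists_embedding_fst_eq {N : ℕ} (ε : Fin N → Fin m)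
    (h : ∀ s, (Finset.univ.filter fun i => ε i = s).card ≤ n) :
    ∃ f : Fin N ↪ Fin m × Fin n, (fun i => (f i).1) = ε := by
  have : ∀ s, Nonempty ({i // ε i = s} ↪ Fin n) := fun s =>
    Function.Embedding.nonempty_of_card_le (by simpa [Fintype.card_subtype] using h s)
  let emb := fun s => (this s).some
  have hemb : ∀ s t, s = t → ∀ (i : {i // ε i = s}) (j : {j // ε j = t}),
      emb s i = emb t j → (i : Fin N) = j := by
    rintro s _ rfl i j h
    rw [(emb s).injective h]
  refine ⟨⟨fun i => (ε i, emb (ε i) ⟨i, rfl⟩), fun i j hij => ?_⟩, rfl⟩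
  obtain ⟨h1, h2⟩ := Prod.mk.inj hij
  exact hemb _ _ h1 ⟨i, rfl⟩ ⟨j, rfl⟩ h2

end Levels

/-- The points of a configuration, labelled by `Fin m × Fin n`. -/
def pointAt {X : Type*} {m n : ℕ} (x : Fin m → Fin n → X) (q : Fin m × Fin n) : Fin m × X :=
  (q.1, x q.1 q.2)

section Measures

variable {X : Type*} [MeasurableSpace X] {μ : Measure X} [SigmaFinite μ] {m n : ℕ}

/-- The reference measure is a sum over levels, so its power is a sum over all assignments `ε` of
levels to the coordinates. -/
theorem pi_refMeasure {ι : Type*} [Fintype ι] [DecidableEq ι] :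
    (Measure.pi fun _ : ι => refMeasure μ m) =
      ∑ ε : ι → Fin m, (Measure.pi fun _ : ι => μ).map fun y i => (ε i, y i) := by
  refine Measure.pi_eq fun s hs => ?_
  have hm : ∀ ε : ι → Fin m, Measurable fun (y : ι → X) i => (ε i, y i) := fun ε => by fun_prop
  rw [Measure.finsetSum_apply]
  simp only [Measure.map_apply (hm _) (MeasurableSet.univ_pi hs), refMeasure_apply (hs _)]
  rw [Finset.prod_univ_sum]
  simp only [Fintype.piFinset_univ, ← Measure.pi_pi]
  refine Finset.sum_congr rfl fun ε _ => ?_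
  congr 1

theorem measurePreserving_config {ι : Type*} [Fintype ι] (e : ι ≃ Fin m × Fin n) :
    MeasurePreserving (fun (x : Fin m → Fin n → X) i => x (e i).1 (e i).2)
      (configMeasure μ m n) (Measure.pi fun _ : ι => μ) := by
  have hm : Measurable fun (x : Fin m → Fin n → X) i => x (e i).1 (e i).2 := by fun_prop
  refine ⟨hm, (Measure.pi_eq fun s hs => ?_).symm⟩
  rw [Measure.map_apply hm (MeasurableSet.univ_pi hs)]
  have : (fun (x : Fin m → Fin n → X) i => x (e i).1 (e i).2) ⁻¹' Set.univ.pi s =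
      Set.univ.pi fun r => Set.univ.pi fun j => s (e.symm (r, j)) := by
    ext x
    simp only [Set.mem_preimage, Set.mem_univ_pi]
    refine ⟨fun h r j => by simpa using h (e.symm (r, j)), fun h i => ?_⟩
    simpa using h (e i).1 (e i).2
  rw [this, configMeasure, Measure.pi_pi]
  simp only [Measure.pi_pi]
  rw [← Fintype.prod_prod_type', ← e.symm.prod_comp]

end Measures

/-! ### The determinant of a full configuration -/

namespace TransitionSystem

variable {X X₀ X₁ : Type*} [MeasurableSpace X] {m n : ℕ} {φ : TransitionSystem ℂ X X₀ X₁}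
  {μ : Measure X} {x₀ : Fin n → X₀} {x₁ : Fin n → X₁}

/-- Rows are ordered with the initial points first, columns with the final points last. Row block
`ρ` then has source level `ρ` and column block `c` has target level `c`, so the blocks with `c < ρ`
vanish and the diagonal blocks are the one-step transitions. -/
theorem configDet_pointAt [NeZero m] (x : Fin m → Fin n → X) :
    φ.configDet μ x₀ x₁ (pointAt x) = levelSign m n * φ.weight m x₀ x₁ x := by
  set M := φ.configMatrix μ x₀ x₁ (pointAt x)
  let N : Matrix (Fin (m + 1) × Fin n) (Fin (m + 1) × Fin n) ℂ :=
    M.submatrix (rowEquiv m n) (colEquiv m n)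
  have hN : N.det = (Equiv.Perm.sign ((colEquiv m n).trans (rowEquiv m n).symm) : ℂ) * M.det := by
    rw [← Matrix.det_submatrix_equiv_self (rowEquiv m n) M, ← Matrix.det_permute']
    congr 1
    ext a b
    simp [N]
  have htri : N.BlockTriangular Prod.fst := by
    rintro ⟨ρ, i⟩ ⟨c, j⟩ h
    refine configMatrix_eq_zero _ ?_
    simp only at h
    induction ρ using Fin.cases with
    | zero => simp at h
    | succ ρ =>
      induction c using Fin.lastCases with
      | last => exact absurd h (not_lt.2 (Fin.le_last _))
      | cast c =>
        rw [rowEquiv_succ, colEquiv_castSucc]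
        simpa [sourceLevel, targetLevel, pointAt, Fin.lt_def] using h
  have hblock : ∀ k, (N.toSquareBlock Prod.fst k).det =
      (Matrix.of fun i j : Fin n => N (k, i) (k, j)).det := by
    intro k
    let e : Fin n ≃ {a : Fin (m + 1) × Fin n // a.1 = k} :=
      ⟨fun i => ⟨(k, i), rfl⟩, fun a => a.1.2, fun _ => rfl, fun ⟨⟨a, b⟩, h⟩ => by
        simp only at h; subst h; rfl⟩
    rw [← Matrix.det_submatrix_equiv_self e]
    rfl
  have hw : N.det = φ.weight m x₀ x₁ x := by
    rw [htri.det_fintype]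
    simp only [hblock]
    obtain ⟨m, rfl⟩ := Nat.exists_eq_succ_of_ne_zero (NeZero.ne m)
    rw [Fin.prod_univ_succ, Fin.prod_univ_castSucc, ← mul_assoc, weight]
    refine congrArg₂ _ (congrArg₂ _ ?_ ?_) ?_
    · refine congrArg Matrix.det (Matrix.ext fun i j => ?_)
      have h0 : colEquiv (m + 1) n (0, j) = .inr (0, j) := colEquiv_castSucc 0 j
      simp only [Matrix.of_apply, N, Matrix.submatrix_apply, rowEquiv_zero, h0]
      rfl
    · refine Finset.prod_congr rfl fun r _ => congrArg Matrix.det (Matrix.ext fun i j => ?_)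
      have h0 : colEquiv (m + 1) n (r.castSucc.succ, j) = .inr (r.succ, j) :=
        colEquiv_castSucc r.succ j
      simp only [Matrix.of_apply, N, Matrix.submatrix_apply, rowEquiv_succ, h0]
      exact congrFun (congrFun (φ.between_succ_self _ r) _) _
    · refine congrArg Matrix.det (Matrix.ext fun i j => ?_)
      have h0 : colEquiv (m + 1) n ((Fin.last m).succ, j) = .inl j := colEquiv_last j
      simp only [Matrix.of_apply, N, Matrix.submatrix_apply, rowEquiv_succ, h0]
      change φ.toFinal _ (m + 1) m _ _ = _
      simp only [toFinal, pointAt, if_true]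
      rfl
  rw [configDet, levelSign, ← hw, hN]
  have hs : (Equiv.Perm.sign ((colEquiv m n).trans (rowEquiv m n).symm) : ℂ) *
      (Equiv.Perm.sign ((colEquiv m n).trans (rowEquiv m n).symm) : ℂ) = 1 := by
    rcases Int.units_eq_one_or (Equiv.Perm.sign ((colEquiv m n).trans (rowEquiv m n).symm)) with
      h | h <;> simp [h]
  rw [mul_assoc, ← mul_assoc (_ : ℂ) (_ : ℂ) M.det, hs, one_mul]
  simp [M]

end TransitionSystem

theorem measurable_pointAt {X : Type*} [MeasurableSpace X] {m n : ℕ} :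
    Measurable (pointAt : (Fin m → Fin n → X) → Fin m × Fin n → Fin m × X) := by
  unfold pointAt
  fun_prop

theorem measurable_withLevels {X : Type*} [MeasurableSpace X] {ι : Type*} {m : ℕ}
    (ε : ι → Fin m) : Measurable fun (y : ι → X) i => (ε i, y i) :=
  measurable_pi_lambda _ fun i => measurable_const.prodMk (measurable_pi_apply i)

/-! ### Correlation integrals by descending induction on the number of points -/

namespace TransitionSystem

variable {X X₀ X₁ : Type*} [MeasurableSpace X] {m n : ℕ} {φ : TransitionSystem ℂ X X₀ X₁}
  {μ : Measure X} {x₀ : Fin n → X₀} {x₁ : Fin n → X₁}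

theorem integrable_bdd_mul' {α : Type*} [MeasurableSpace α] {ν : Measure α} {F f : α → ℂ}
    (hf : Integrable f ν) (hF : Measurable F) {c : ℝ} (hc : ∀ z, ‖F z‖ ≤ c) :
    Integrable (fun z => F z * f z) ν :=
  hf.bdd_mul hF.aestronglyMeasurable (Filter.Eventually.of_forall hc)

/-- By Fubini's theorem, integrating out the first point gives `(m * n - k) * configDet` almost
everywhere. As `k < m * n`, the factor is nonzero, so integrability passes down from `k + 1` to `k`
points. -/
theorem integrable_configDet_and_integral_tail [SigmaFinite μ] (hφ : φ.IsMeasurable m)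
    (hwd : φ.WellDefined μ m x₀ x₁) {k : ℕ} (hk : k < m * n)
    (hint : Integrable (fun z : Fin (k + 1) → Fin m × X => φ.configDet μ x₀ x₁ z)
      (Measure.pi fun _ => refMeasure μ m)) :
    Integrable (fun z : Fin k → Fin m × X => φ.configDet μ x₀ x₁ z)
      (Measure.pi fun _ => refMeasure μ m) ∧
    ∀ F : (Fin k → Fin m × X) → ℂ, Measurable F → ∀ c : ℝ, (∀ z, ‖F z‖ ≤ c) →
      ∫ z : Fin (k + 1) → Fin m × X, F (Fin.tail z) * φ.configDet μ x₀ x₁ z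
          ∂(Measure.pi fun _ => refMeasure μ m) =
        (m * n - k : ℂ) * ∫ z, F z * φ.configDet μ x₀ x₁ z
          ∂(Measure.pi fun _ => refMeasure μ m) := by
  set lam := refMeasure μ m
  have hN : (m * n - k : ℂ) ≠ 0 := by
    rw [sub_ne_zero]
    exact_mod_cast hk.ne'
  have hmp := measurePreserving_piFinSuccAbove (fun _ : Fin (k + 1) => lam) 0
  have hint' : Integrable (fun p : (Fin m × X) × (Fin k → Fin m × X) =>
      φ.configDet μ x₀ x₁ (Fin.cons p.1 p.2 : Fin (k + 1) → Fin m × X))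
      (lam.prod (Measure.pi fun _ => lam)) := by
    rw [← hmp.integrable_comp_emb (MeasurableEquiv.measurableEmbedding _)]
    refine hint.congr (Filter.Eventually.of_forall fun z => ?_)
    simp only [Function.comp]
    congr 1
    exact (Fin.cons_self_tail z).symm
  have hae : ∀ᵐ z : Fin k → Fin m × X ∂(Measure.pi fun _ => lam),
      ∫ w, φ.configDet μ x₀ x₁ (Fin.cons w z : Fin (k + 1) → Fin m × X) ∂lam =
        (m * n - k : ℂ) * φ.configDet μ x₀ x₁ z := by
    filter_upwards [ae_transition_lt_top hφ hwd k] with z hz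
    exact integral_configDet_cons hφ z hz
  refine ⟨?_, fun F hF c hc => ?_⟩
  · refine (integrable_const_mul_iff (isUnit_iff_ne_zero.2 hN) _).1 ?_
    exact hint'.integral_prod_right.congr hae
  · have hF' := integrable_bdd_mul' hint' (hF.comp measurable_snd) (fun p => hc p.2)
    simp only [Function.comp_apply] at hF'
    have h1 : ∫ z : Fin (k + 1) → Fin m × X, F (Fin.tail z) * φ.configDet μ x₀ x₁ z
          ∂(Measure.pi fun _ => lam) =
        ∫ p : (Fin m × X) × (Fin k → Fin m × X), F p.2 *
          φ.configDet μ x₀ x₁ (Fin.cons p.1 p.2 : Fin (k + 1) → Fin m × X)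
          ∂(lam.prod (Measure.pi fun _ => lam)) := by
      rw [← hmp.integral_comp (MeasurableEquiv.measurableEmbedding _)]
      refine integral_congr_ae (Filter.Eventually.of_forall fun z => ?_)
      exact congrArg (fun y => F (Fin.tail z) * φ.configDet μ x₀ x₁ y) (Fin.cons_self_tail z).symm
    rw [h1, integral_prod_symm _ hF', ← integral_const_mul]
    refine integral_congr_ae ?_
    filter_upwards [hae] with z hz
    rw [integral_const_mul, hz]
    ring

variable [SigmaFinite μ] [NeZero m]

theorem integrable_configDet_level (hw : Integrable (φ.weight m x₀ x₁) (configMeasure μ m n))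
    (hφ : φ.IsMeasurable m) (ε : Fin (m * n) → Fin m) :
    Integrable (fun y : Fin (m * n) → X => φ.configDet μ x₀ x₁ fun i => (ε i, y i))
      (Measure.pi fun _ => μ) := by
  -- With `m * n` points and at most `n` on each level, every level is full and the configuration is
  -- a relabelling of a full one. Otherwise some level is overfull and the determinant vanishes.
  by_cases h : ∀ s, (Finset.univ.filter fun i => ε i = s).card ≤ n
  · obtain ⟨f, rfl⟩ := exists_embedding_fst_eq ε h
    let e : Fin (m * n) ≃ Fin m × Fin n := Equiv.ofBijective f
      ((Fintype.bijective_iff_injective_and_card f).2 ⟨f.injective, by simp⟩)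
    have hm : Measurable fun y : Fin (m * n) → X =>
        φ.configDet μ x₀ x₁ fun i => ((f i).1, y i) :=
      (measurable_configDet hφ).comp (by fun_prop)
    rw [← (measurePreserving_config e).integrable_comp hm.aestronglyMeasurable]
    refine (hw.const_mul (levelSign m n)).congr (Filter.Eventually.of_forall fun x => ?_)
    simp only
    rw [← configDet_pointAt (μ := μ), ← configDet_comp_equiv e]
    rfl
  · push Not at h
    obtain ⟨s, hs⟩ := h
    simp [fun y : Fin (m * n) → X => configDet_eq_zero (φ := φ) (μ := μ) (x₀ := x₀) (x₁ := x₁)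
      (fun i => (ε i, y i)) s hs]

theorem integral_embedding_weight (hφ : φ.IsMeasurable m) (f : Fin (m * n) ↪ Fin m × Fin n)
    {F : (Fin (m * n) → Fin m × X) → ℂ} (hF : Measurable F) :
    ∫ y : Fin (m * n) → X, F (fun i => ((f i).1, y i)) *
        φ.configDet μ x₀ x₁ (fun i => ((f i).1, y i)) ∂(Measure.pi fun _ => μ) =
      levelSign m n * ∫ x, F (pointAt x ∘ f) * φ.weight m x₀ x₁ x ∂(configMeasure μ m n) := by
  let e : Fin (m * n) ≃ Fin m × Fin n := Equiv.ofBijective f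
    ((Fintype.bijective_iff_injective_and_card f).2 ⟨f.injective, by simp⟩)
  have hl : Measurable fun (y : Fin (m * n) → X) i => ((f i).1, y i) := by fun_prop
  have hm : Measurable fun y : Fin (m * n) → X => F (fun i => ((f i).1, y i)) *
      φ.configDet μ x₀ x₁ (fun i => ((f i).1, y i)) :=
    (hF.comp hl).mul ((measurable_configDet hφ).comp hl)
  rw [← (measurePreserving_config (μ := μ) e).map_eq, integral_map
    (measurePreserving_config (μ := μ) e).measurable.aemeasurable hm.aestronglyMeasurable,
    ← integral_const_mul]
  refine integral_congr_ae (Filter.Eventually.of_forall fun x => ?_)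
  simp only
  rw [mul_left_comm, ← configDet_pointAt (μ := μ), ← configDet_comp_equiv e]
  rfl

theorem integrable_configDet_full (hφ : φ.IsMeasurable m)
    (hw : Integrable (φ.weight m x₀ x₁) (configMeasure μ m n)) :
    Integrable (fun z : Fin (m * n) → Fin m × X => φ.configDet μ x₀ x₁ z)
      (Measure.pi fun _ => refMeasure μ m) := by
  rw [pi_refMeasure, integrable_finsetSum_measure]
  intro ε _
  rw [integrable_map_measure (measurable_configDet hφ).aestronglyMeasurable
    (measurable_withLevels ε).aemeasurable]
  exact integrable_configDet_level hw hφ ε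

/-- The factor between the unnormalised correlation functions and the determinants `configDet`. -/
def levelConst (m n : ℕ) : ℂ := (levelSign m n)⁻¹ * levelCard m n

theorem levelConst_ne_zero (m n : ℕ) : levelConst m n ≠ 0 :=
  mul_ne_zero (inv_ne_zero (levelSign_ne_zero m n)) (Nat.cast_ne_zero.2 (levelCard_ne_zero m n))

/-- Embeddings are grouped by their level pattern `ε`. Every pattern without an overfull level comes
from `levelCard` embeddings with equal integrals; the other patterns contribute zero to both sides.
-/
theorem sum_integral_weight_full (hφ : φ.IsMeasurable m)
    (hw : Integrable (φ.weight m x₀ x₁) (configMeasure μ m n))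
    {F : (Fin (m * n) → Fin m × X) → ℂ} (hF : Measurable F) {c : ℝ} (hc : ∀ z, ‖F z‖ ≤ c) :
    ∑ f : Fin (m * n) ↪ Fin m × Fin n,
        ∫ x, F (pointAt x ∘ f) * φ.weight m x₀ x₁ x ∂(configMeasure μ m n) =
      levelConst m n * ∫ z, F z * φ.configDet μ x₀ x₁ z ∂(Measure.pi fun _ => refMeasure μ m) := by
  let I : (Fin (m * n) → Fin m) → ℂ := fun ε => ∫ y : Fin (m * n) → X, F (fun i => (ε i, y i)) *
    φ.configDet μ x₀ x₁ (fun i => (ε i, y i)) ∂(Measure.pi fun _ => μ)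
  have hm : Measurable fun z => F z * φ.configDet μ x₀ x₁ z := hF.mul (measurable_configDet hφ)
  have h1 : ∫ z, F z * φ.configDet μ x₀ x₁ z ∂(Measure.pi fun _ => refMeasure μ m) =
      ∑ ε, I ε := by
    have hint := integrable_bdd_mul' (integrable_configDet_full hφ hw) hF hc
    rw [pi_refMeasure] at hint ⊢
    rw [integral_finsetSum_measure (integrable_finsetSum_measure.1 hint)]
    exact Finset.sum_congr rfl fun ε _ => integral_map
      (measurable_withLevels ε).aemeasurable hm.aestronglyMeasurable
  have h2 : ∀ f : Fin (m * n) ↪ Fin m × Fin n,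
      ∫ x, F (pointAt x ∘ f) * φ.weight m x₀ x₁ x ∂(configMeasure μ m n) =
        (levelSign m n)⁻¹ * I fun i => (f i).1 := by
    intro f
    rw [eq_inv_mul_iff_mul_eq₀ (levelSign_ne_zero m n)]
    exact (integral_embedding_weight hφ f hF).symm
  have h3 : ∑ f : Fin (m * n) ↪ Fin m × Fin n, I (fun i => (f i).1) =
      ∑ ε, (levelCard m n : ℂ) * I ε := by
    rw [← Finset.sum_fiberwise Finset.univ fun (f : Fin (m * n) ↪ Fin m × Fin n) i => (f i).1]
    refine Finset.sum_congr rfl fun ε _ => ?_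
    rw [Finset.sum_congr rfl fun f hf => by rw [(Finset.mem_filter.1 hf).2], Finset.sum_const,
      nsmul_eq_mul]
    by_cases h : ∀ s, (Finset.univ.filter fun i => ε i = s).card ≤ n
    · obtain ⟨f, rfl⟩ := exists_embedding_fst_eq ε h
      let e : Fin (m * n) ≃ Fin m × Fin n := Equiv.ofBijective f
        ((Fintype.bijective_iff_injective_and_card f).2 ⟨f.injective, by simp⟩)
      rw [← card_embedding_fst_eq e]
      rfl
    · push Not at h
      obtain ⟨s, hs⟩ := h
      simp [I, fun y : Fin (m * n) → X => configDet_eq_zero (φ := φ) (μ := μ) (x₀ := x₀) (x₁ := x₁)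
        (fun i => (ε i, y i)) s hs]
  simp only [h2]
  rw [← Finset.mul_sum, h3, ← Finset.mul_sum, h1, levelConst, mul_assoc]

/-- The unnormalised correlation functions are given by the determinants `configDet`. -/
theorem sum_integral_weight (hφ : φ.IsMeasurable m) (hwd : φ.WellDefined μ m x₀ x₁)
    (hw : Integrable (φ.weight m x₀ x₁) (configMeasure μ m n)) (k : ℕ) :
    Integrable (fun z : Fin k → Fin m × X => φ.configDet μ x₀ x₁ z)
      (Measure.pi fun _ => refMeasure μ m) ∧
    ∀ F : (Fin k → Fin m × X) → ℂ, Measurable F → ∀ c : ℝ, (∀ z, ‖F z‖ ≤ c) →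
      ∑ f : Fin k ↪ Fin m × Fin n,
          ∫ x, F (pointAt x ∘ f) * φ.weight m x₀ x₁ x ∂(configMeasure μ m n) =
        levelConst m n * ∫ z, F z * φ.configDet μ x₀ x₁ z
          ∂(Measure.pi fun _ => refMeasure μ m) := by
  rcases lt_or_ge (m * n) k with hk | hk
  · have h0 : ∀ z : Fin k → Fin m × X, φ.configDet μ x₀ x₁ z = 0 := fun z =>
      configDet_eq_zero_of_card_lt z (by simpa using hk)
    have : IsEmpty (Fin k ↪ Fin m × Fin n) :=
      Function.Embedding.isEmpty_of_card_lt (by simpa using hk)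
    simp [h0]
  · induction hk using Nat.decreasingInduction with
    | self => exact ⟨integrable_configDet_full hφ hw, fun F hF c hc =>
        sum_integral_weight_full hφ hw hF hc⟩
    | of_succ k hk ih =>
      obtain ⟨ih1, ih2⟩ := ih
      obtain ⟨h1, h2⟩ := integrable_configDet_and_integral_tail hφ hwd hk ih1
      refine ⟨h1, fun F hF c hc => ?_⟩
      have hN : (m * n - k : ℂ) ≠ 0 := by
        rw [sub_ne_zero]
        exact_mod_cast hk.ne'
      have h3 := ih2 (fun z => F (Fin.tail z)) (hF.comp (by unfold Fin.tail; fun_prop)) c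
        fun z => hc _
      rw [h2 F hF c hc] at h3
      refine mul_left_cancel₀ hN ?_
      -- An embedding of `k + 1` labels is an embedding of `k` labels together with one of the `m *
      -- n - k` unused labels, on which `F ∘ Fin.tail` does not depend. This matches the factor
      -- obtained by integrating out a point.
      rw [mul_left_comm, ← h3, ← (Equiv.embeddingFinSucc k (Fin m × Fin n)).symm.sum_comp,
        Fintype.sum_sigma, Finset.mul_sum]
      refine Finset.sum_congr rfl fun f _ => ?_
      have h4 : ∀ q : {q // q ∉ Set.range f}, ∀ x : Fin m → Fin n → X,
          Fin.tail (pointAt x ∘ (Equiv.embeddingFinSucc k (Fin m × Fin n)).symm ⟨f, q⟩) =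
            pointAt x ∘ f := by
        intro q x
        rw [Equiv.coe_embeddingFinSucc_symm]
        rfl
      simp only [h4, Finset.sum_const, nsmul_eq_mul]
      congr 1
      rw [Finset.card_univ, Fintype.card_subtype_compl, Set.card_range_of_injective f.injective]
      simp
      push_cast [hk.le]
      ring

end TransitionSystem

/-! ### Expanding products over embeddings -/

/-- Each `k`-element subset is the range of exactly `k!` embeddings. -/
theorem sum_embedding_prod {J : Type*} [Fintype J] [DecidableEq J] (a : J → ℂ) (k : ℕ) :
    ∑ f : Fin k ↪ J, ∏ i, a (f i) =
      k.factorial * ∑ t ∈ (Finset.univ : Finset J).powersetCard k, ∏ q ∈ t, a q := by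
  rw [← Finset.sum_fiberwise_of_maps_to (s := Finset.univ)
    (t := (Finset.univ : Finset J).powersetCard k)
    (g := fun f : Fin k ↪ J => Finset.univ.map f)
    (fun f _ => by simp [Finset.mem_powersetCard]), Finset.mul_sum]
  refine Finset.sum_congr rfl fun t ht => ?_
  rw [Finset.sum_congr rfl fun f hf => show ∏ i, a (f i) = ∏ q ∈ t, a q by
    rw [← (Finset.mem_filter.1 hf).2, Finset.prod_map], Finset.sum_const, nsmul_eq_mul]
  congr 2
  have htc : t.card = k := (Finset.mem_powersetCard.1 ht).2
  rw [← Fintype.card_subtype]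
  let e : {f : Fin k ↪ J // Finset.univ.map f = t} ≃ (Fin k ≃ t) :=
    { toFun := fun f => Equiv.ofBijective
        (fun i => (⟨f.1 i, by
          have h := Finset.mem_map_of_mem f.1 (Finset.mem_univ i)
          rwa [f.2] at h⟩ : t))
        ((Fintype.bijective_iff_injective_and_card _).2
          ⟨fun i j h => f.1.injective (congrArg Subtype.val h), by simp [htc]⟩)
      invFun := fun e => ⟨e.toEmbedding.trans (Function.Embedding.subtype _), by
        ext q
        simp only [Finset.mem_map, Finset.mem_univ, true_and]
        exact ⟨fun ⟨i, hi⟩ => hi ▸ (e i).2, fun hq => ⟨e.symm ⟨q, hq⟩, by simp⟩⟩⟩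
      left_inv := fun f => by ext; rfl
      right_inv := fun e => by ext; rfl }
  rw [Fintype.card_congr e, Fintype.card_equiv (Fintype.equivOfCardEq (by simp [htc]))]
  simp

theorem prod_one_add_eq_sum_embedding {J : Type*} [Fintype J] [DecidableEq J] (a : J → ℂ) :
    ∏ q, (1 + a q) = ∑ k ∈ Finset.range (Fintype.card J + 1),
      (k.factorial : ℂ)⁻¹ * ∑ f : Fin k ↪ J, ∏ i, a (f i) := by
  rw [Finset.prod_one_add, Finset.sum_powerset, Finset.card_univ]
  refine Finset.sum_congr rfl fun k _ => ?_
  rw [sum_embedding_prod, inv_mul_cancel_left₀ (Nat.cast_ne_zero.2 k.factorial_ne_zero)]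

/-! ### Bounded representatives -/

theorem exists_measurable_bounded_ae_eq {α : Type*} [MeasurableSpace α] {ν : Measure α} {g : α → ℂ}
    (hg : MemLp g ∞ ν) :
    ∃ g' : α → ℂ, Measurable g' ∧ (∃ c : ℝ, ∀ z, ‖g' z‖ ≤ c) ∧ g =ᵐ[ν] g' := by
  obtain ⟨c, hc⟩ : ∃ c : ℝ, ∀ᵐ z ∂ν, ‖g z‖ ≤ c := by
    have h := hg.2
    rw [eLpNorm_exponent_top] at h
    refine ⟨(eLpNormEssSup g ν).toReal, ?_⟩
    filter_upwards [enorm_ae_le_eLpNormEssSup g ν] with z hz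
    rw [← toReal_enorm]
    exact ENNReal.toReal_mono h.ne hz
  have hm := hg.1.stronglyMeasurable_mk.measurable
  refine ⟨{z | ‖hg.1.mk g z‖ ≤ c}.indicator (hg.1.mk g),
    hm.indicator (measurableSet_le hm.norm measurable_const), ⟨max c 0, fun z => ?_⟩, ?_⟩
  · by_cases hz : ‖hg.1.mk g z‖ ≤ c
    · rw [Set.indicator_of_mem (by exact hz)]
      exact hz.trans (le_max_left _ _)
    · rw [Set.indicator_of_notMem (by exact hz), norm_zero]
      exact le_max_right _ _
  · filter_upwards [hc, hg.1.ae_eq_mk] with z h1 h2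
    rw [Set.indicator_of_mem, h2]
    rw [Set.mem_ofPred_eq, ← h2]
    exact h1

theorem ae_config {X : Type*} [MeasurableSpace X] {μ : Measure X} [SigmaFinite μ] {m n : ℕ}
    {p : Fin m × X → Prop} (h : ∀ᵐ z ∂(refMeasure μ m), p z) :
    ∀ᵐ x ∂(configMeasure μ m n), ∀ q, p (pointAt x q) := by
  refine ae_all_iff.2 fun q => ?_
  have h1 := (Measure.quasiMeasurePreserving_eval (fun _ : Fin n => μ) q.2).comp
    (Measure.quasiMeasurePreserving_eval (fun _ : Fin m => Measure.pi fun _ : Fin n => μ) q.1)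
  exact h1.ae (ae_refMeasure_iff.1 h q.1)

/-! ### Normalisation and expansion of the generating functional -/

namespace TransitionSystem

variable {X X₀ X₁ : Type*} [MeasurableSpace X] {m n : ℕ} {φ : TransitionSystem ℂ X X₀ X₁}
  {μ : Measure X} {x₀ : Fin n → X₀} {x₁ : Fin n → X₁} [NeZero m]

theorem density_eq (x : Fin m → Fin n → X) : φ.density μ m x₀ x₁ x =
    (∫ x, φ.weight m x₀ x₁ x ∂(configMeasure μ m n))⁻¹ * φ.weight m x₀ x₁ x := by
  rw [density, partitionFunction, mul_inv_cancel_left₀]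
  exact pow_ne_zero _ (Nat.cast_ne_zero.2 n.factorial_ne_zero)

theorem integral_weight_ne_zero (hZ : φ.partitionFunction μ m x₀ x₁ ≠ 0) :
    ∫ x, φ.weight m x₀ x₁ x ∂(configMeasure μ m n) ≠ 0 :=
  right_ne_zero_of_mul hZ

/-- The Bochner integral of a function that is not integrable is zero by convention, so a nonzero
normalising constant forces integrability. -/
theorem integrable_weight (hZ : φ.partitionFunction μ m x₀ x₁ ≠ 0) :
    Integrable (φ.weight m x₀ x₁) (configMeasure μ m n) :=
  not_imp_comm.1 integral_undef (integral_weight_ne_zero hZ)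

theorem integrable_density (hZ : φ.partitionFunction μ m x₀ x₁ ≠ 0) :
    Integrable (φ.density μ m x₀ x₁) (configMeasure μ m n) := by
  rw [show φ.density μ m x₀ x₁ = _ from funext density_eq]
  exact (integrable_weight hZ).const_mul _

theorem integral_density (hZ : φ.partitionFunction μ m x₀ x₁ ≠ 0) :
    ∫ x, φ.density μ m x₀ x₁ x ∂(configMeasure μ m n) = 1 := by
  simp only [density_eq]
  rw [integral_const_mul, inv_mul_cancel₀ (integral_weight_ne_zero hZ)]

variable [SigmaFinite μ]

/-- This is the correlation identity for `k = 0` and `F = 1`: the space of empty tuples is a single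
point, where `configDet` is `det A`. -/
theorem integral_weight (hφ : φ.IsMeasurable m) (hwd : φ.WellDefined μ m x₀ x₁)
    (hw : Integrable (φ.weight m x₀ x₁) (configMeasure μ m n)) :
    ∫ x, φ.weight m x₀ x₁ x ∂(configMeasure μ m n) =
      levelConst m n * (φ.totalMatrix μ m x₀ x₁).det := by
  have h := (sum_integral_weight hφ hwd hw 0).2 (fun _ => 1) measurable_const 1 (by simp)
  rw [Measure.pi_of_empty (fun _ : Fin 0 => refMeasure μ m) (fun i => i.elim0), integral_dirac] at h
  simpa [configDet_of_isEmpty] using h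

theorem isUnit_totalMatrix (hφ : φ.IsMeasurable m) (hwd : φ.WellDefined μ m x₀ x₁)
    (hZ : φ.partitionFunction μ m x₀ x₁ ≠ 0) : IsUnit (φ.totalMatrix μ m x₀ x₁) := by
  have h := integral_weight_ne_zero hZ
  rw [integral_weight hφ hwd (integrable_weight hZ)] at h
  exact (Matrix.isUnit_iff_isUnit_det _).2 (isUnit_iff_ne_zero.2 (right_ne_zero_of_mul h))

theorem integrable_det_kernel (hφ : φ.IsMeasurable m) (hwd : φ.WellDefined μ m x₀ x₁)
    (hZ : φ.partitionFunction μ m x₀ x₁ ≠ 0) (k : ℕ) :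
    Integrable (fun z : Fin k → Fin m × X =>
      (Matrix.of fun i j : Fin k => φ.kernel μ m x₀ x₁ (z i) (z j)).det)
      (Measure.pi fun _ => refMeasure μ m) := by
  have hA := isUnit_totalMatrix hφ hwd hZ
  have h := (sum_integral_weight hφ hwd (integrable_weight hZ) k).1
  simp only [configDet_eq_det_mul_det_kernel hA] at h
  exact (integrable_const_mul_iff ((Matrix.isUnit_iff_isUnit_det _).1 hA) _).1 h

/-- The correlation functions are the minors of the kernel. -/
theorem sum_integral_density (hφ : φ.IsMeasurable m) (hwd : φ.WellDefined μ m x₀ x₁)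
    (hZ : φ.partitionFunction μ m x₀ x₁ ≠ 0) {k : ℕ} {F : (Fin k → Fin m × X) → ℂ}
    (hF : Measurable F) {c : ℝ} (hc : ∀ z, ‖F z‖ ≤ c) :
    ∑ f : Fin k ↪ Fin m × Fin n,
        ∫ x, F (pointAt x ∘ f) * φ.density μ m x₀ x₁ x ∂(configMeasure μ m n) =
      ∫ z, F z * (Matrix.of fun i j : Fin k => φ.kernel μ m x₀ x₁ (z i) (z j)).det
        ∂(Measure.pi fun _ => refMeasure μ m) := by
  have hw := integrable_weight hZ
  have hA := isUnit_totalMatrix hφ hwd hZ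
  have h := (sum_integral_weight hφ hwd hw k).2 F hF c hc
  simp only [configDet_eq_det_mul_det_kernel hA, mul_left_comm (F _), integral_const_mul] at h
  simp only [density_eq, mul_left_comm (F _), integral_const_mul]
  rw [← Finset.mul_sum, h, inv_mul_eq_iff_eq_mul₀ (integral_weight_ne_zero hZ),
    integral_weight hφ hwd hw, mul_assoc]

/-- This makes the expansion of the generating functional a finite sum. -/
theorem det_kernel_eq_zero (hφ : φ.IsMeasurable m) (hwd : φ.WellDefined μ m x₀ x₁)
    (hZ : φ.partitionFunction μ m x₀ x₁ ≠ 0) {k : ℕ} (hk : m * n < k) (z : Fin k → Fin m × X) :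
    (Matrix.of fun i j : Fin k => φ.kernel μ m x₀ x₁ (z i) (z j)).det = 0 := by
  have hA := isUnit_totalMatrix hφ hwd hZ
  have h := configDet_eq_det_mul_det_kernel hA z
  rw [configDet_eq_zero_of_card_lt z (by simpa using hk)] at h
  exact (mul_eq_zero.1 h.symm).resolve_left ((Matrix.isUnit_iff_isUnit_det _).1 hA).ne_zero

/-- The expansion of the generating functional. -/
theorem generatingFunctional_expansion (hφ : φ.IsMeasurable m) (hwd : φ.WellDefined μ m x₀ x₁)
    (hZ : φ.partitionFunction μ m x₀ x₁ ≠ 0) {g : Fin m × X → ℂ} (hg : Measurable g) {c : ℝ}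
    (hc : ∀ z, ‖g z‖ ≤ c) :
    Integrable (fun x => (∏ r : Fin m, ∏ j : Fin n, (1 + g (r, x r j))) *
        φ.density μ m x₀ x₁ x) (configMeasure μ m n) ∧
      (∀ k : ℕ, Integrable (fun z : Fin k → Fin m × X => (∏ j, g (z j)) *
          (Matrix.of fun i j : Fin k => φ.kernel μ m x₀ x₁ (z i) (z j)).det)
        (Measure.pi fun _ => refMeasure μ m)) ∧
      HasSum (fun k : ℕ => ((k.factorial : ℂ))⁻¹ *
          ∫ z : Fin k → Fin m × X, (∏ j, g (z j)) *
            (Matrix.of fun i j : Fin k => φ.kernel μ m x₀ x₁ (z i) (z j)).det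
            ∂(Measure.pi fun _ => refMeasure μ m))
        (∫ x, (∏ r : Fin m, ∏ j : Fin n, (1 + g (r, x r j))) * φ.density μ m x₀ x₁ x
          ∂(configMeasure μ m n)) := by
  have hprod : ∀ k : ℕ, Measurable fun z : Fin k → Fin m × X => ∏ j, g (z j) := fun k =>
    Finset.measurable_fun_prod _ fun j _ => hg.comp (measurable_pi_apply j)
  have hbound : ∀ (k : ℕ) (z : Fin k → Fin m × X), ‖∏ j, g (z j)‖ ≤ c ^ k := fun k z => by
    rw [norm_prod]
    simpa using Finset.prod_le_prod (s := Finset.univ) (fun j _ => norm_nonneg (g (z j)))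
      fun j _ => hc (z j)
  have hint : ∀ (k : ℕ) (f : Fin k ↪ Fin m × Fin n), Integrable
      (fun x => (∏ i, g (pointAt x (f i))) * φ.density μ m x₀ x₁ x) (configMeasure μ m n) :=
    fun k f => integrable_bdd_mul' (F := fun x => ∏ i, g (pointAt x (f i)))
      (integrable_density hZ) (Finset.measurable_fun_prod _ fun i _ =>
        hg.comp ((measurable_pi_apply _).comp measurable_pointAt)) (fun x => hbound k _)
  -- The product over all labels is expanded into sums over `k`-tuples of distinct labels, the form
  -- in which the correlation identity applies.
  have hexp : ∀ x : Fin m → Fin n → X,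
      (∏ r : Fin m, ∏ j : Fin n, (1 + g (r, x r j))) * φ.density μ m x₀ x₁ x =
      ∑ k ∈ Finset.range (m * n + 1), (k.factorial : ℂ)⁻¹ * ∑ f : Fin k ↪ Fin m × Fin n,
        (∏ i, g (pointAt x (f i))) * φ.density μ m x₀ x₁ x := by
    intro x
    rw [← Fintype.prod_prod_type' (fun r j => 1 + g (r, x r j))]
    have h := prod_one_add_eq_sum_embedding fun q => g (pointAt x q)
    rw [show ∏ q : Fin m × Fin n, (1 + g (q.1, x q.1 q.2)) = _ from h, Finset.sum_mul]
    simp [Finset.sum_mul, mul_assoc]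
  refine ⟨?_, fun k => integrable_bdd_mul' (integrable_det_kernel hφ hwd hZ k) (hprod k)
    (hbound k), ?_⟩
  · simp only [hexp]
    exact integrable_finsetSum _ fun k _ => (integrable_finsetSum _ fun f _ => hint k f).const_mul _
  · have hval : ∫ x, (∏ r : Fin m, ∏ j : Fin n, (1 + g (r, x r j))) * φ.density μ m x₀ x₁ x
          ∂(configMeasure μ m n) = ∑ k ∈ Finset.range (m * n + 1), (k.factorial : ℂ)⁻¹ *
          ∫ z : Fin k → Fin m × X, (∏ j, g (z j)) *
            (Matrix.of fun i j : Fin k => φ.kernel μ m x₀ x₁ (z i) (z j)).det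
            ∂(Measure.pi fun _ => refMeasure μ m) := by
      simp only [hexp]
      rw [integral_finsetSum _ fun k _ => (integrable_finsetSum _ fun f _ => hint k f).const_mul _]
      refine Finset.sum_congr rfl fun k _ => ?_
      rw [integral_const_mul, integral_finsetSum _ fun f _ => hint k f,
        ← sum_integral_density hφ hwd hZ (hprod k) (hbound k)]
      rfl
    rw [hval]
    refine hasSum_sum_of_ne_finset_zero fun k hk => ?_
    have hk : m * n < k := by simpa [Nat.lt_succ_iff] using hk
    simp [det_kernel_eq_zero hφ hwd hZ hk]

end TransitionSystem

/-! ### Enumerations of counting measures -/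

section Enumeration

variable {Λ : Type*} [MeasurableSpace Λ] [MeasurableSingletonClass Λ]

theorem sum_dirac_singleton {ι : Type*} (y : ι → Λ) (p : Λ) :
    Measure.sum (fun i => Measure.dirac (y i)) {p} = ({i | y i = p} : Set ι).encard := by
  rw [Measure.sum_apply _ (measurableSet_singleton p), ← ENNReal.tsum_set_one,
    tsum_subtype {i | y i = p} fun _ => (1 : ℝ≥0∞)]
  refine tsum_congr fun i => ?_
  rw [Measure.dirac_apply' _ (measurableSet_singleton p)]
  rfl

/-- Two enumerations of the same counting measure, one of them finite, differ by a bijection. -/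
theorem exists_equiv_of_sum_dirac_eq {ι J : Type*} [Finite J] {y : ι → Λ} {x : J → Λ}
    (h : Measure.sum (fun i => Measure.dirac (y i)) = Measure.sum fun j => Measure.dirac (x j)) :
    ∃ e : ι ≃ J, ∀ i, y i = x (e i) := by
  have hp : ∀ p, Nonempty ({i // y i = p} ≃ {j // x j = p}) := by
    intro p
    have h1 : ({i | y i = p} : Set ι).encard = ({j | x j = p} : Set J).encard := by
      have := congrArg (fun ν : Measure Λ => ν {p}) h
      simp only [sum_dirac_singleton] at this
      exact_mod_cast this
    have hJ : ({j | x j = p} : Set J).Finite := Set.toFinite _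
    have hI : ({i | y i = p} : Set ι).Finite := by
      rw [← Set.encard_lt_top_iff, h1, Set.encard_lt_top_iff]
      exact hJ
    have : Finite {i // y i = p} := hI.to_subtype
    exact Finite.card_eq.1 (congrArg ENat.toNat h1)
  let e := fun p => (hp p).some
  exact ⟨(Equiv.sigmaFiberEquiv y).symm.trans
    ((Equiv.sigmaCongrRight e).trans (Equiv.sigmaFiberEquiv x)),
    fun i => ((e (y i) ⟨i, rfl⟩).2).symm⟩

variable {J : Type*} [Fintype J]

open Classical in
-- `tupleMeasure` is defined through a chosen enumeration. The multiplicities of singletons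
-- determine a finite enumeration up to a bijection of the indices, which permutes the embeddings.
theorem tupleMeasure_sum_dirac (x : J → Λ) (k : ℕ) :
    tupleMeasure (Measure.sum fun j => Measure.dirac (x j)) k =
      Measure.sum fun f : Fin k ↪ J => Measure.dirac fun i => x (f i) := by
  have hex : ∃ (S : Set ℕ) (y : S → Λ),
      IsEnumeration (Measure.sum fun j => Measure.dirac (x j)) S y := by
    let e : {i | i < Fintype.card J} ≃ J := Fin.equivSubtype.symm.trans (Fintype.equivFin J).symm
    refine ⟨{i | i < Fintype.card J}, x ∘ e, ?_⟩
    ext s hs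
    rw [Measure.sum_apply _ hs, Measure.sum_apply _ hs]
    exact (e.tsum_eq fun j => Measure.dirac (x j) s).symm
  rw [tupleMeasure, dif_pos hex]
  obtain ⟨e, he⟩ := exists_equiv_of_sum_dirac_eq (y := hex.choose_spec.choose) (x := x)
    hex.choose_spec.choose_spec.symm
  ext s hs
  rw [Measure.sum_apply _ hs, Measure.sum_apply _ hs,
    ← ((Equiv.refl (Fin k)).embeddingCongr e).tsum_eq]
  refine tsum_congr fun f => ?_
  congr 2
  ext1 i
  exact he _

end Enumeration

section Config

variable {X : Type*} [MeasurableSpace X] {m n : ℕ}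

theorem configPoints_eq_sum (x : Fin m → Fin n → X) :
    configPoints x = Measure.sum fun q => Measure.dirac (pointAt x q) := by
  rw [configPoints, Measure.sum_fintype, Fintype.sum_prod_type]
  rfl

theorem measurable_configPoints :
    Measurable (configPoints : (Fin m → Fin n → X) → Measure (Fin m × X)) := by
  refine Measure.measurable_of_measurable_coe _ fun s hs => ?_
  simp only [configPoints_eq_sum, Measure.sum_apply _ hs, tsum_fintype]
  refine Finset.measurable_fun_sum _ fun q _ => ?_
  exact ((Measure.measurable_coe hs).comp Measure.measurable_dirac).comp
    ((measurable_pi_apply q).comp measurable_pointAt)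

theorem isCountingMeasure_configPoints [Bornology X] (x : Fin m → Fin n → X) :
    IsCountingMeasure (configPoints x) := by
  classical
  intro A hA _
  refine ⟨(Finset.univ.filter fun q => pointAt x q ∈ A).card, ?_⟩
  rw [configPoints_eq_sum, Measure.sum_apply _ hA, tsum_fintype, Finset.card_filter]
  push_cast
  refine Finset.sum_congr rfl fun q _ => ?_
  rw [Measure.dirac_apply' _ hA, Set.indicator_apply]
  simp

end Config

/-! ### The determinantal point process -/

namespace TransitionSystem

variable {X X₀ X₁ : Type*} [MeasurableSpace X] {m n : ℕ}
  {φ : TransitionSystem ℂ X X₀ X₁}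
  {μ : Measure X} {x₀ : Fin n → X₀} {x₁ : Fin n → X₁}

theorem measurable_kernel_eval [SigmaFinite μ] (hφ : φ.IsMeasurable m) {k : ℕ} (i j : Fin k) :
    Measurable fun z : Fin k → Fin m × X => φ.kernel μ m x₀ x₁ (z i) (z j) :=
  Measurable.comp (f := fun z : Fin k → Fin m × X => (z i, z j)) (measurable_kernel hφ)
    ((measurable_pi_apply i).prodMk (measurable_pi_apply j))

variable [NeZero m]

/-- The law of the configurations. -/
def configLaw (φ : TransitionSystem ℂ X X₀ X₁) (μ : Measure X) (x₀ : Fin n → X₀)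
    (x₁ : Fin n → X₁) : Measure (Fin m → Fin n → X) :=
  (configMeasure μ m n).withDensity fun x => ENNReal.ofReal (φ.density μ m x₀ x₁ x).re

theorem sum_setIntegral_density [SigmaFinite μ] (hφ : φ.IsMeasurable m) (hwd : φ.WellDefined μ m x₀ x₁)
    (hZ : φ.partitionFunction μ m x₀ x₁ ≠ 0) {k : ℕ} {A : Set (Fin k → Fin m × X)}
    (hA : MeasurableSet A) :
    ∑ f : Fin k ↪ Fin m × Fin n, ∫ x in {x | pointAt x ∘ f ∈ A}, φ.density μ m x₀ x₁ x
        ∂(configMeasure μ m n) =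
      ∫ z in A, (Matrix.of fun i j : Fin k => φ.kernel μ m x₀ x₁ (z i) (z j)).det
        ∂(Measure.pi fun _ => refMeasure μ m) := by
  have h := sum_integral_density hφ hwd hZ (F := A.indicator 1) (measurable_one.indicator hA)
    (c := 1) fun z => by
      by_cases hz : z ∈ A <;> simp [hz]
  rw [← integral_indicator hA]
  convert h using 2 with f _ f
  · have hm : MeasurableSet {x : Fin m → Fin n → X | pointAt x ∘ f ∈ A} :=
      hA.preimage (measurable_pi_lambda _ fun i =>
        (measurable_pi_apply (f i)).comp measurable_pointAt)
    rw [← integral_indicator hm]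
    congr 1
    ext x
    by_cases hx : pointAt x ∘ f ∈ A <;> simp [hx]
  · ext z
    by_cases hz : z ∈ A <;> simp [hz]

variable [MeasurableSingletonClass X]

/-- The number of tuples of distinct points in `A` is a sum of indicators over embeddings of labels,
and its expectation is the sum of the corresponding probabilities. -/
theorem factorialMoment_configLaw (hZ : φ.partitionFunction μ m x₀ x₁ ≠ 0)
    (hp : ∀ᵐ x ∂(configMeasure μ m n),
      0 ≤ (φ.density μ m x₀ x₁ x).re ∧ (φ.density μ m x₀ x₁ x).im = 0)
    {k : ℕ} {A : Set (Fin k → Fin m × X)} (hA : MeasurableSet A) :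
    factorialMoment (φ.configLaw μ x₀ x₁ (m := m)) configPoints k A = ENNReal.ofReal
      (∑ f : Fin k ↪ Fin m × Fin n, ∫ x in {x | pointAt x ∘ f ∈ A}, (φ.density μ m x₀ x₁ x).re
        ∂(configMeasure μ m n)) := by
  have hm : ∀ f : Fin k ↪ Fin m × Fin n,
      MeasurableSet {x : Fin m → Fin n → X | pointAt x ∘ f ∈ A} := fun f =>
    hA.preimage (measurable_pi_lambda _ fun i =>
      (measurable_pi_apply (f i)).comp measurable_pointAt)
  have hnn : ∀ f : Fin k ↪ Fin m × Fin n,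
      0 ≤ᵐ[(configMeasure μ m n).restrict {x | pointAt x ∘ f ∈ A}]
        fun x => (φ.density μ m x₀ x₁ x).re := fun f =>
    ae_restrict_of_ae (hp.mono fun x hx => hx.1)
  rw [factorialMoment, ENNReal.ofReal_sum_of_nonneg fun f _ => integral_nonneg_of_ae (hnn f)]
  simp only [configPoints_eq_sum, tupleMeasure_sum_dirac, Measure.sum_apply _ hA, tsum_fintype]
  rw [lintegral_finsetSum']
  · refine Finset.sum_congr rfl fun f _ => ?_
    have h1 : ∀ x : Fin m → Fin n → X, (Measure.dirac fun i => pointAt x (f i)) A =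
        ({x | pointAt x ∘ f ∈ A} : Set (Fin m → Fin n → X)).indicator 1 x := fun x => by
      rw [Measure.dirac_apply' _ hA]
      rfl
    simp only [h1]
    rw [lintegral_indicator_one (hm f), configLaw, withDensity_apply _ (hm f),
      ofReal_integral_eq_lintegral_ofReal _ (hnn f)]
    exact (integrable_density hZ).re.restrict
  · intro f _
    exact (((Measure.measurable_coe hA).comp Measure.measurable_dirac).comp
      (measurable_pi_lambda _ fun i =>
        (measurable_pi_apply (f i)).comp measurable_pointAt)).aemeasurable

/-- The process of all points of all levels is determinantal. -/
theorem isDeterminantal_configPoints [SigmaFinite μ] [Bornology X] (hφ : φ.IsMeasurable m)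
    (hwd : φ.WellDefined μ m x₀ x₁) (hZ : φ.partitionFunction μ m x₀ x₁ ≠ 0)
    (hp : ∀ᵐ x ∂(configMeasure μ m n),
      0 ≤ (φ.density μ m x₀ x₁ x).re ∧ (φ.density μ m x₀ x₁ x).im = 0) :
    IsDeterminantal (φ.configLaw μ x₀ x₁ (m := m)) configPoints (refMeasure μ m)
      (φ.kernel μ m x₀ x₁) := by
  have hdens := integrable_density hZ
  have hdre : Integrable (fun x => (φ.density μ m x₀ x₁ x).re) (configMeasure μ m n) := hdens.re
  refine ⟨⟨⟨?_⟩, measurable_configPoints, isCountingMeasure_configPoints⟩, ?_, ?_⟩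
  · rw [configLaw, withDensity_apply _ MeasurableSet.univ, Measure.restrict_univ,
      ← ofReal_integral_eq_lintegral_ofReal hdre (hp.mono fun x hx => hx.1)]
    have h : ∫ x, (φ.density μ m x₀ x₁ x).re ∂(configMeasure μ m n) = 1 := by
      have := integral_re hdens
      rw [integral_density hZ] at this
      simpa using this
    exact (congrArg ENNReal.ofReal h).trans ENNReal.ofReal_one
  · intro k A hA _
    rw [factorialMoment_configLaw hZ hp hA]
    exact ENNReal.ofReal_lt_top
  · intro k
    set ρ : (Fin k → Fin m × X) → ℂ := fun z =>
      (Matrix.of fun i j : Fin k => φ.kernel μ m x₀ x₁ (z i) (z j)).det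
    have hρm : Measurable ρ := measurable_det fun i j => measurable_kernel_eval hφ (x₀ := x₀) (x₁ := x₁) i j
    have hρ : Integrable ρ (Measure.pi fun _ => refMeasure μ m) :=
      integrable_det_kernel hφ hwd hZ k
    have hre : ∀ A, MeasurableSet A → ∫ z in A, (ρ z).re ∂(Measure.pi fun _ => refMeasure μ m) =
        ∑ f : Fin k ↪ Fin m × Fin n, ∫ x in {x | pointAt x ∘ f ∈ A},
          (φ.density μ m x₀ x₁ x).re ∂(configMeasure μ m n) := by
      intro A hA
      have h := congrArg Complex.re (sum_setIntegral_density hφ hwd hZ hA)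
      rw [Complex.re_sum] at h
      refine (integral_re hρ.restrict).trans (h.symm.trans ?_)
      exact Finset.sum_congr rfl fun f _ => (integral_re hdens.restrict).symm
    have him : ∀ A, MeasurableSet A →
        ∫ z in A, (ρ z).im ∂(Measure.pi fun _ => refMeasure μ m) = 0 := by
      intro A hA
      have h := congrArg Complex.im (sum_setIntegral_density hφ hwd hZ hA)
      rw [Complex.im_sum] at h
      refine (integral_im hρ.restrict).trans (h.symm.trans ?_)
      refine Finset.sum_eq_zero fun f _ => (integral_im hdens.restrict).symm.trans ?_
      exact integral_eq_zero_of_ae (ae_restrict_of_ae (hp.mono fun x hx => hx.2))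
    -- The set integrals of `ρ` are sums of integrals of the density, hence real and nonnegative on
    -- every measurable set. This forces `ρ` itself to be real and nonnegative almost everywhere.
    have h1 : 0 ≤ᵐ[Measure.pi fun _ => refMeasure μ m] fun z => (ρ z).re := by
      refine ae_nonneg_of_forall_setIntegral_nonneg hρ.re fun A hA _ => ?_
      refine le_of_le_of_eq ?_ (hre A hA).symm
      exact Finset.sum_nonneg fun f _ => integral_nonneg_of_ae
        (ae_restrict_of_ae (hp.mono fun x hx => hx.1))
    have h2 : (fun z => (ρ z).im) =ᵐ[Measure.pi fun _ => refMeasure μ m] 0 :=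
      hρ.im.ae_eq_zero_of_forall_setIntegral_eq_zero fun A hA _ => him A hA
    refine ⟨hρm.aemeasurable, ?_, fun A hA => ?_⟩
    · filter_upwards [h1, h2] with z hz1 hz2 using ⟨hz1, hz2⟩
    · rw [factorialMoment_configLaw hZ hp hA, ← hre A hA,
        ofReal_integral_eq_lintegral_ofReal _ (ae_restrict_of_ae h1)]
      exact hρ.re.restrict

end TransitionSystem

namespace TransitionSystem

variable {X X₀ X₁ : Type*} {m n : ℕ}

/-! ### Tilted transition functions -/

/-- The transition system in which every arrival at the point `x` of level `t` is weighted by the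
factor `h t x`. -/
def tilt (φ : TransitionSystem ℂ X X₀ X₁) (h : ℕ → X → ℂ) : TransitionSystem ℂ X X₀ X₁ where
  init a x := φ.init a x * h 0 x
  step r x y := φ.step r x y * h (r + 1) y
  final := φ.final

variable {φ : TransitionSystem ℂ X X₀ X₁} {h : ℕ → X → ℂ} {x₀ : Fin n → X₀} {x₁ : Fin n → X₁}

/-- Each level is the target of exactly one determinant in the weight, and its factors come out of
the columns there. -/
theorem weight_tilt [NeZero m] (x : Fin m → Fin n → X) :
    (φ.tilt h).weight m x₀ x₁ x =
      (∏ r : Fin m, ∏ j : Fin n, h r (x r j)) * φ.weight m x₀ x₁ x := by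
  obtain ⟨k, rfl⟩ := Nat.exists_eq_succ_of_ne_zero (NeZero.ne m)
  have hdet : ∀ (M : Fin n → Fin n → ℂ) (v : Fin n → ℂ),
      (Matrix.of fun i j => M i j * v j).det = (∏ j, v j) * (Matrix.of M).det := fun M v => by
    rw [← Matrix.det_mul_row]
    simp only [mul_comm, Matrix.of_apply]
  have hmul : ∀ a b c d e : ℂ, (a * b) * (c * d) * e = (a * c) * (b * d * e) := by
    intros
    ring
  simp only [weight, tilt, hdet, Finset.prod_mul_distrib]
  rw [Fin.prod_univ_succ (n := k)]
  exact hmul _ _ _ _ _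

variable [MeasurableSpace X] {μ : Measure X}

theorem IsMeasurable.tilt (hφ : φ.IsMeasurable m) (hh : ∀ t, Measurable (h t)) :
    (φ.tilt h).IsMeasurable m where
  init a := (hφ.init a).mul (hh 0)
  step r hr := (hφ.step r hr).mul ((hh _).comp measurable_snd)
  final := hφ.final

variable {C : ℝ≥0∞}

/-- A transition to level `t` arrives at no more than the `t + 1` levels `0, …, t`, and each arrival
costs a factor at most `C`; `1 ≤ C` allows the same exponent for every source. -/
theorem abs_tilt_fromSource_le (hC : 1 ≤ C) (hC' : C ≠ ∞) (hh : ∀ t x, ‖h t x‖ₑ ≤ C)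
    {a : Fin n ⊕ (Fin m × X)} {t : ℕ}
    (ht : sourceLevel a ≤ t) (y : X) :
    (φ.tilt h).abs.fromSource (lebesgue[μ]) x₀ a t y ≤
      C ^ (t + 1) * φ.abs.fromSource (lebesgue[μ]) x₀ a t y := by
  induction t, ht using Nat.le_induction generalizing y with
  | base =>
    rcases a with i | z
    · simp only [fromSource, sourceLevel, Sum.elim_inl, fromInit, abs, TransitionSystem.tilt,
        enorm_mul, zero_add, pow_one, mul_comm C]
      exact mul_le_mul' le_rfl (hh _ _)
    · simp only [fromSource, sourceLevel, Sum.elim_inr, between_succ_self, abs,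
        TransitionSystem.tilt, enorm_mul, mul_comm (C ^ _)]
      exact mul_le_mul' le_rfl ((hh _ _).trans (le_self_pow₀ hC (Nat.succ_ne_zero _)))
  | succ t ht ih =>
    rw [fromSource_succ _ _ _ ht, fromSource_succ _ _ _ ht,
      ← lintegral_const_mul' _ _ (ENNReal.pow_ne_top hC')]
    refine lintegral_mono fun z => ?_
    have h1 : (φ.tilt h).abs.step t z y ≤ φ.abs.step t z y * C := by
      simp only [abs, TransitionSystem.tilt, enorm_mul]
      exact mul_le_mul' le_rfl (hh _ _)
    refine (mul_le_mul' (ih z) h1).trans_eq ?_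
    rw [pow_succ C (t + 1)]
    ring

theorem abs_tilt_transition_le (hC : 1 ≤ C) (hC' : C ≠ ∞) (hh : ∀ t x, ‖h t x‖ₑ ≤ C)
    (a b : Fin n ⊕ (Fin m × X)) :
    (φ.tilt h).abs.transition (lebesgue[μ]) x₀ x₁ a b ≤
      C ^ (m + 1) * φ.abs.transition (lebesgue[μ]) x₀ x₁ a b := by
  rcases lt_or_ge (targetLevel b) (sourceLevel a) with hab | hab
  · rw [transition_eq_zero _ _ _ _ hab]
    exact zero_le
  rcases b with j | w
  · have hab : sourceLevel a ≤ m := hab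
    have hfin : ∀ k, k ≤ m - 1 → sourceLevel a ≤ k →
        ∫⁻ z, (φ.tilt h).abs.fromSource (lebesgue[μ]) x₀ a k z * φ.abs.final z (x₁ j) ∂μ ≤
        C ^ (m + 1) * ∫⁻ z, φ.abs.fromSource (lebesgue[μ]) x₀ a k z * φ.abs.final z (x₁ j) ∂μ := by
      intro k hk ha
      rw [← lintegral_const_mul' _ _ (ENNReal.pow_ne_top hC')]
      refine lintegral_mono fun z => ?_
      rw [← mul_assoc]
      refine mul_le_mul' ((abs_tilt_fromSource_le hC hC' hh ha z).trans
        (mul_le_mul' (pow_le_pow_right₀ hC (by omega)) le_rfl)) le_rfl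
    rcases hab.lt_or_eq with hlt | heq
    · rw [transition_inl_of_lt _ _ _ _ hlt, transition_inl_of_lt _ _ _ _ hlt]
      exact hfin _ le_rfl (Nat.le_sub_one_of_lt hlt)
    · rcases a with i | z
      · exact hfin _ le_rfl (Nat.zero_le _)
      · have heq : (z.1 : ℕ) + 1 = m := heq
        simp only [transition, toFinal, if_pos heq]
        exact le_mul_of_one_le_left' (one_le_pow₀ hC)
  · rw [transition_inr, transition_inr]
    exact (abs_tilt_fromSource_le hC hC' hh hab _).trans
      (mul_le_mul' (pow_le_pow_right₀ hC (Nat.succ_le_succ w.1.2.le)) le_rfl)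

theorem WellDefined.tilt (hφ : φ.WellDefined μ m x₀ x₁) (hC : 1 ≤ C) (hC' : C ≠ ∞)
    (hh : ∀ t x, ‖h t x‖ₑ ≤ C) : (φ.tilt h).WellDefined μ m x₀ x₁ := by
  have key : ∀ a b : Fin n ⊕ (Fin m × X), φ.abs.transition (lebesgue[μ]) x₀ x₁ a b < ∞ →
      (φ.tilt h).abs.transition (lebesgue[μ]) x₀ x₁ a b < ∞ := fun a b hab =>
    (abs_tilt_transition_le hC hC' hh a b).trans_lt (ENNReal.mul_lt_top
      (lt_top_iff_ne_top.2 (ENNReal.pow_ne_top hC')) hab)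
  exact
  { between := fun r s hrs => (hφ.between r s hrs).mono fun p hp =>
      key (.inr (r, p.1)) (.inr (s, p.2)) hp
    fromInit := fun s i => (hφ.fromInit s i).mono fun y hy => key (.inl i) (.inr (s, y)) hy
    toFinal := fun r j => (hφ.toFinal r j).mono fun x hx => key (.inr (r, x)) (.inl j) hx
    total := fun i j => key (.inl i) (.inl j) (hφ.total i j) }

/-! ### The resolvent equation -/

theorem integrable_integral_mul_mul [SFinite μ] {f : X → ℂ} {g : X → X → ℂ} {q : X → ℂ}
    (hf : Measurable f) (hg : Measurable (Function.uncurry g)) (hq : Measurable q)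
    (hfin : ∫⁻ z, (∫⁻ u, ‖f u‖ₑ * ‖g u z‖ₑ ∂μ) * ‖q z‖ₑ ∂μ < ∞) :
    Integrable (fun z => (∫ u, f u * g u z ∂μ) * q z) μ := by
  have hm : Measurable (Function.uncurry fun z u => f u * g u z) :=
    (hf.comp measurable_snd).mul (hg.comp measurable_swap)
  refine ⟨(hm.stronglyMeasurable.integral_prod_right.measurable.mul hq).aestronglyMeasurable,
    (lintegral_mono fun z => ?_).trans_lt hfin⟩
  rw [enorm_mul]
  refine mul_le_mul' ((enorm_integral_le_lintegral_enorm _).trans_eq ?_) le_rfl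
  simp only [enorm_mul]

/-- This is the domination needed for Fubini's theorem: `h - 1` costs at most `C + 1`, the tilt at
most `C ^ (t + 1)`, and the untilted absolute transitions recombine into the one from `a` to level
`t`. -/
theorem lintegral_fromSource_mul_tilt_between_lt_top [SFinite μ] (hφ : φ.IsMeasurable m)
    (hC : 1 ≤ C) (hC' : C ≠ ∞) (hh : ∀ t x, ‖h t x‖ₑ ≤ C) {a : Fin n ⊕ (Fin m × X)} {s t : ℕ}
    (ha : sourceLevel a ≤ s) (hst : s < t) (ht : t < m) {q : X → ℂ}
    (hfin : ∫⁻ z, φ.abs.fromSource (lebesgue[μ]) x₀ a t z * ‖q z‖ₑ ∂μ < ∞) :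
    ∫⁻ z, (∫⁻ u, ‖φ.fromSource (bochner[μ]) x₀ a s u * (h s u - 1)‖ₑ *
      ‖(φ.tilt h).between (bochner[μ]) s t u z‖ₑ ∂μ) * ‖q z‖ₑ ∂μ < ∞ := by
  have hK : (C + 1) * C ^ (t + 1) ≠ ∞ :=
    ENNReal.mul_ne_top (ENNReal.add_ne_top.2 ⟨hC', ENNReal.one_ne_top⟩) (ENNReal.pow_ne_top hC')
  refine lt_of_le_of_lt ?_ (ENNReal.mul_lt_top (lt_top_iff_ne_top.2 hK) hfin)
  rw [← lintegral_const_mul' _ _ hK]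
  refine lintegral_mono fun z => ?_
  rw [← mul_assoc]
  refine mul_le_mul' ?_ le_rfl
  rw [← lintegral_fromSource_mul_between hφ ha hst ht, ← lintegral_const_mul' _ _ hK]
  refine lintegral_mono fun u => ?_
  have h1 : ‖h s u - 1‖ₑ ≤ C + 1 :=
    enorm_sub_le.trans (add_le_add (hh s u) (by simp))
  have h2 : ‖(φ.tilt h).between (bochner[μ]) s t u z‖ₑ ≤
      C ^ (t + 1) * φ.abs.between (lebesgue[μ]) s t u z := by
    have hle : sourceLevel (n := 0) (.inr ((⟨s, hst.trans ht⟩ : Fin m), u)) ≤ t := hst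
    exact (enorm_fromSource_le (x₀ := Fin.elim0) hle z).trans
      (abs_tilt_fromSource_le (x₀ := Fin.elim0) hC hC' hh hle z)
  rw [enorm_mul]
  refine (mul_le_mul' (mul_le_mul' (enorm_fromSource_le ha u) h1) h2).trans_eq ?_
  ring

/-- One more composition in the resolvent equation. -/
theorem integral_tilt_fromSource_mul [SFinite μ] (hφ : φ.IsMeasurable m)
    (hhm : ∀ t, Measurable (h t)) (hC : 1 ≤ C) (hC' : C ≠ ∞) (hh : ∀ t x, ‖h t x‖ₑ ≤ C)
    {a : Fin n ⊕ (Fin m × X)} {t : ℕ} (ha : sourceLevel a ≤ t) (ht : t < m) {q : X → ℂ}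
    (hq : Measurable q)
    (hfin : ∫⁻ z, φ.abs.fromSource (lebesgue[μ]) x₀ a t z * ‖q z‖ₑ ∂μ < ∞)
    (ih : ∀ z, φ.abs.fromSource (lebesgue[μ]) x₀ a t z < ∞ →
      (φ.tilt h).fromSource (bochner[μ]) x₀ a t z =
        h t z * φ.fromSource (bochner[μ]) x₀ a t z +
        ∑ s ∈ Finset.Ico (sourceLevel a) t, ∫ u, φ.fromSource (bochner[μ]) x₀ a s u *
          (h s u - 1) * (φ.tilt h).between (bochner[μ]) s t u z ∂μ) :
    ∫ z, (φ.tilt h).fromSource (bochner[μ]) x₀ a t z * q z ∂μ =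
      ∫ z, φ.fromSource (bochner[μ]) x₀ a t z * q z ∂μ +
      ∑ s ∈ Finset.Ico (sourceLevel a) (t + 1), ∫ u, φ.fromSource (bochner[μ]) x₀ a s u *
        (h s u - 1) * (if s = t then q u else
          ∫ z, (φ.tilt h).between (bochner[μ]) s t u z * q z ∂μ) ∂μ := by
  have hP := fun {s} (hs : s < m) => measurable_fromSource (μ := μ) (x₀ := x₀) hφ a hs
  have hPq : Integrable (fun z => φ.fromSource (bochner[μ]) x₀ a t z * q z) μ := by
    refine ⟨((hP ht).mul hq).aestronglyMeasurable, (lintegral_mono fun z => ?_).trans_lt hfin⟩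
    rw [enorm_mul]
    exact mul_le_mul' (enorm_fromSource_le ha z) le_rfl
  have hPgq : Integrable (fun z => φ.fromSource (bochner[μ]) x₀ a t z * (h t z - 1) * q z) μ := by
    have hg : ∀ z, ‖h t z - 1‖ ≤ C.toReal + 1 := fun z => by
      refine (norm_sub_le _ _).trans (add_le_add ?_ (by simp))
      rw [← toReal_enorm]
      exact ENNReal.toReal_mono hC' (hh t z)
    refine (integrable_bdd_mul' hPq ((hhm t).sub_const 1) hg).congr ?_
    exact Filter.Eventually.of_forall fun z => by
      simp only []
      ring
  have hS : ∀ s ∈ Finset.Ico (sourceLevel a) t,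
      ∫⁻ z, (∫⁻ u, ‖φ.fromSource (bochner[μ]) x₀ a s u * (h s u - 1)‖ₑ *
        ‖(φ.tilt h).between (bochner[μ]) s t u z‖ₑ ∂μ) * ‖q z‖ₑ ∂μ < ∞ := fun s hs =>
    lintegral_fromSource_mul_tilt_between_lt_top hφ hC hC' hh (Finset.mem_Ico.1 hs).1
      (Finset.mem_Ico.1 hs).2 ht hfin
  have hPm : ∀ s ∈ Finset.Ico (sourceLevel a) t,
      Measurable fun u => φ.fromSource (bochner[μ]) x₀ a s u * (h s u - 1) := fun s hs =>
    (hP ((Finset.mem_Ico.1 hs).2.trans ht)).mul ((hhm s).sub_const 1)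
  have hEm := fun s => measurable_between (μ := μ) (hφ.tilt hhm) s ht
  have hmeas : Measurable fun z => φ.abs.fromSource (lebesgue[μ]) x₀ a t z * ‖q z‖ₑ :=
    (measurable_abs_fromSource hφ a ht).mul hq.enorm
  -- Writing `h = 1 + (h - 1)` at level `t` splits off the new summand `s = t`. The induction
  -- hypothesis is available wherever the absolute transition is finite, which holds almost
  -- everywhere on the set where `q` does not vanish.
  have hcongr : ∫ z, (φ.tilt h).fromSource (bochner[μ]) x₀ a t z * q z ∂μ =
      ∫ z, (φ.fromSource (bochner[μ]) x₀ a t z * q z +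
        φ.fromSource (bochner[μ]) x₀ a t z * (h t z - 1) * q z) +
        ∑ s ∈ Finset.Ico (sourceLevel a) t, (∫ u, φ.fromSource (bochner[μ]) x₀ a s u *
          (h s u - 1) * (φ.tilt h).between (bochner[μ]) s t u z ∂μ) * q z ∂μ := by
    refine integral_congr_ae ?_
    filter_upwards [ae_lt_top hmeas hfin.ne] with z hz
    by_cases h0 : q z = 0
    · simp [h0]
    · rw [ih z, ← Finset.sum_mul]
      · ring
      · refine lt_top_iff_ne_top.2 fun htop => ?_
        rw [htop, ENNReal.top_mul (enorm_ne_zero.2 h0)] at hz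
        exact lt_irrefl _ hz
  have hadd : Integrable (fun z => φ.fromSource (bochner[μ]) x₀ a t z * q z +
      φ.fromSource (bochner[μ]) x₀ a t z * (h t z - 1) * q z) μ := hPq.add hPgq
  rw [hcongr, integral_add hadd (integrable_finsetSum _ fun s hs =>
      integrable_integral_mul_mul (hPm s hs) (hEm s) hq (hS s hs)),
    integral_add hPq hPgq, integral_finsetSum _ fun s hs =>
      integrable_integral_mul_mul (hPm s hs) (hEm s) hq (hS s hs),
    Finset.sum_Ico_succ_top ha, add_assoc, add_comm (∫ z, _ * (h t z - 1) * q z ∂μ)]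
  congr 2
  · refine Finset.sum_congr rfl fun s hs => ?_
    rw [integral_compose_assoc (hPm s hs) (hEm s) hq (hS s hs)]
    simp only [if_neg (Finset.mem_Ico.1 hs).2.ne]
  · simp only [if_true]

/-- Along each path the factors before level `t` telescope as `∏ h_s = 1 + ∑ (h_s - 1) ∏_{s' > s}
h_{s'}`. Up to level `s` the transition is untilted, from there on it is tilted. -/
theorem tilt_fromSource_eq [SFinite μ] (hφ : φ.IsMeasurable m)
    (hhm : ∀ t, Measurable (h t)) (hC : 1 ≤ C) (hC' : C ≠ ∞) (hh : ∀ t x, ‖h t x‖ₑ ≤ C)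
    {a : Fin n ⊕ (Fin m × X)} {t : ℕ} (ha : sourceLevel a ≤ t) (ht : t < m) {y : X}
    (hfin : φ.abs.fromSource (lebesgue[μ]) x₀ a t y < ∞) :
    (φ.tilt h).fromSource (bochner[μ]) x₀ a t y =
      h t y * φ.fromSource (bochner[μ]) x₀ a t y +
      ∑ s ∈ Finset.Ico (sourceLevel a) t, ∫ u, φ.fromSource (bochner[μ]) x₀ a s u *
        (h s u - 1) * (φ.tilt h).between (bochner[μ]) s t u y ∂μ := by
  induction t, ha using Nat.le_induction generalizing y with
  | base =>
    rw [Finset.Ico_self, Finset.sum_empty, add_zero, mul_comm]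
    rcases a with i | z
    · rfl
    · simp only [fromSource, sourceLevel, Sum.elim_inr, between_succ_self]
      rfl
  | succ t ha ih =>
    have ht' : t < m := by omega
    rw [φ.abs.fromSource_succ _ _ ha] at hfin
    have h1 := integral_tilt_fromSource_mul hφ hhm hC hC' hh ha ht'
      (hφ.step t ht).of_uncurry_right hfin fun z hz => ih ht' hz
    rw [fromSource_succ _ _ _ ha, fromSource_succ _ _ _ ha]
    have h2 : ∀ z, (φ.tilt h).step t z y = φ.step t z y * h (t + 1) y := fun z => rfl
    simp only [h2, ← mul_assoc]
    rw [integral_mul_const, h1, add_mul, mul_comm, Finset.sum_mul]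
    congr 1
    refine Finset.sum_congr rfl fun s hs => ?_
    rw [← integral_mul_const]
    refine integral_congr_ae (Filter.Eventually.of_forall fun u => ?_)
    simp only [mul_assoc]
    congr 2
    by_cases hst : s = t
    · subst hst
      rw [if_pos rfl, between_succ_self]
      rfl
    · have hs := Finset.mem_Ico.1 hs
      rw [if_neg hst, between_succ _ _ (by omega), ← integral_mul_const]
      simp only [compose, h2, mul_assoc]

/-- The resolvent equation for transitions to the final points. -/
theorem tilt_transition_inl [NeZero m] [SigmaFinite μ] (hφ : φ.IsMeasurable m)
    (hhm : ∀ t, Measurable (h t)) (hC : 1 ≤ C) (hC' : C ≠ ∞) (hh : ∀ t x, ‖h t x‖ₑ ≤ C)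
    {a : Fin n ⊕ (Fin m × X)} {j : Fin n}
    (hfin : φ.abs.transition (lebesgue[μ]) x₀ x₁ a (.inl j) < ∞) :
    Integrable (fun w => φ.transition (bochner[μ]) x₀ x₁ a (.inr w) * (h w.1 w.2 - 1) *
      (φ.tilt h).transition (bochner[μ]) x₀ x₁ (.inr w) (.inl j)) (refMeasure μ m) ∧
    (φ.tilt h).transition (bochner[μ]) x₀ x₁ a (.inl j) =
      φ.transition (bochner[μ]) x₀ x₁ a (.inl j) +
      ∫ w, φ.transition (bochner[μ]) x₀ x₁ a (.inr w) * (h w.1 w.2 - 1) *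
        (φ.tilt h).transition (bochner[μ]) x₀ x₁ (.inr w) (.inl j) ∂(refMeasure μ m) := by
  have hK : (C + 1) * C ^ (m + 1) ≠ ∞ :=
    ENNReal.mul_ne_top (ENNReal.add_ne_top.2 ⟨hC', ENNReal.one_ne_top⟩) (ENNReal.pow_ne_top hC')
  have hint : Integrable (fun w => φ.transition (bochner[μ]) x₀ x₁ a (.inr w) *
      (h w.1 w.2 - 1) * (φ.tilt h).transition (bochner[μ]) x₀ x₁ (.inr w) (.inl j))
      (refMeasure μ m) := by
    refine integrable_refMeasure_iff.2 fun s => ?_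
    rcases lt_or_ge (s : ℕ) (sourceLevel a) with hs | hs
    · simp only [transition_eq_zero φ _ x₀ x₁ (b := .inr (s, _)) hs, zero_mul]
      exact integrable_zero _ _ _
    · refine ⟨Measurable.aestronglyMeasurable ?_, ?_⟩
      · refine Measurable.mul (Measurable.mul ?_ ((hhm s).sub_const 1))
          (measurable_transition_left (hφ.tilt hhm) _ s)
        simp only [transition_inr]
        exact measurable_fromSource hφ a s.2
      · refine lt_of_le_of_lt ?_ (ENNReal.mul_lt_top (lt_top_iff_ne_top.2 hK) hfin)
        rw [← lintegral_transition_mul_transition hφ (b := .inl j) hs s.2, ← lintegral_const_mul' _ _ hK]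
        refine lintegral_mono fun u => ?_
        rw [enorm_mul, enorm_mul]
        have h1 : ‖h s u - 1‖ₑ ≤ C + 1 := enorm_sub_le.trans (add_le_add (hh s u) (by simp))
        refine (mul_le_mul' (mul_le_mul' (enorm_transition_le _ _) h1)
          ((enorm_transition_le _ _).trans (abs_tilt_transition_le hC hC' hh _ _))).trans_eq ?_
        ring
  refine ⟨hint, ?_⟩
  rw [integral_refMeasure hint]
  rcases lt_or_ge (sourceLevel a) m with ha | ha
  · have hm : m - 1 + 1 = m := Nat.sub_add_cancel (NeZero.pos m)
    have ha' : sourceLevel a ≤ m - 1 := Nat.le_sub_one_of_lt ha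
    rw [φ.abs.transition_inl_of_lt _ _ _ ha] at hfin
    have h1 := integral_tilt_fromSource_mul hφ hhm hC hC' hh ha' (by omega) (hφ.final (x₁ j)) hfin
      fun z hz => tilt_fromSource_eq hφ hhm hC hC' hh ha' (by omega) hz
    rw [transition_inl_of_lt _ _ _ _ ha, transition_inl_of_lt _ _ _ _ ha]
    refine h1.trans ?_
    congr 1
    rw [hm]
    set F : ℕ → ℂ := fun s => ∫ u, φ.fromSource (bochner[μ]) x₀ a s u * (h s u - 1) *
      (if s = m - 1 then φ.final u (x₁ j) else
        ∫ z, (φ.tilt h).between (bochner[μ]) s (m - 1) u z * φ.final z (x₁ j) ∂μ) ∂μ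
    have hF : ∀ r : Fin m, ∫ u, φ.transition (bochner[μ]) x₀ x₁ a (.inr (r, u)) * (h r u - 1) *
        (φ.tilt h).transition (bochner[μ]) x₀ x₁ (.inr (r, u)) (.inl j) ∂μ =
        if sourceLevel a ≤ r then F r else 0 := fun r => by
      split_ifs with hr
      · refine integral_congr_ae (Filter.Eventually.of_forall fun u => ?_)
        simp only [transition_inr]
        congr 1
        by_cases hrm : (r : ℕ) + 1 = m
        · have : (r : ℕ) = m - 1 := by omega
          simp only [transition, toFinal, if_pos hrm, if_pos this]
          rfl
        · have : ¬(r : ℕ) = m - 1 := by omega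
          simp only [transition, toFinal, if_neg hrm, if_neg this]
          rfl
      · simp only [transition_eq_zero φ _ x₀ x₁ (b := .inr (r, _)) (not_le.1 hr), zero_mul,
          integral_zero]
    rw [Finset.sum_congr rfl fun r _ => hF r,
      Fin.sum_univ_eq_sum_range (fun s => if sourceLevel a ≤ s then F s else 0) m,
      ← Finset.sum_filter]
    refine Finset.sum_congr ?_ fun _ _ => rfl
    ext s
    simp [and_comm]
  -- A source on the last level reaches the final points directly, so there is no intermediate level
  -- and nothing to correct.
  · rcases a with i | z
    · exact absurd ha (not_le.2 (NeZero.pos m))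
    have hz : (z.1 : ℕ) + 1 = m := le_antisymm z.1.2 ha
    have h0 : ∀ (s : Fin m) (u : X), φ.transition (bochner[μ]) x₀ x₁ (.inr z) (.inr (s, u)) = 0 :=
      fun s u => transition_eq_zero φ _ x₀ x₁ (lt_of_lt_of_le s.2 ha)
    simp only [h0, zero_mul, integral_zero, Finset.sum_const_zero, add_zero]
    simp only [transition, toFinal, if_pos hz]
    rfl

end TransitionSystem

/-! ### Trace class operators -/

section TraceClass

variable {H : Type*} [NormedAddCommGroup H] [InnerProductSpace ℂ H]

/-- The two nuclear representations are interleaved along the even and the odd indices. -/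
theorem IsTraceClass.add {S T : H →L[ℂ] H} (hS : IsTraceClass S) (hT : IsTraceClass T) :
    IsTraceClass (S + T) := by
  obtain ⟨u, v, h1, h2⟩ := hS
  obtain ⟨u', v', h1', h2'⟩ := hT
  have he : ∀ (a b : ℕ → H) (k : ℕ), (if (2 * k) % 2 = 0 then a (2 * k / 2) else b (2 * k / 2)) =
      a k := fun a b k => by simp
  have ho : ∀ (a b : ℕ → H) (k : ℕ), (if (2 * k + 1) % 2 = 0 then a ((2 * k + 1) / 2) else
      b ((2 * k + 1) / 2)) = b k := fun a b k => by
    rw [if_neg (by omega)]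
    congr 1
    omega
  refine ⟨fun k => if k % 2 = 0 then u (k / 2) else u' (k / 2),
    fun k => if k % 2 = 0 then v (k / 2) else v' (k / 2), ?_, fun f => ?_⟩
  · refine (HasSum.even_add_odd (m := ∑' k, ‖u k‖ * ‖v k‖) (m' := ∑' k, ‖u' k‖ * ‖v' k‖)
      ?_ ?_).summable
    · simp only [he]
      exact h1.hasSum
    · simp only [ho]
      exact h1'.hasSum
  · refine HasSum.even_add_odd ?_ ?_
    · simp only [he]
      exact h2 f
    · simp only [ho]
      exact h2' f

theorem IsTraceClass.neg {S : H →L[ℂ] H} (hS : IsTraceClass S) : IsTraceClass (-S) := by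
  obtain ⟨u, v, h1, h2⟩ := hS
  refine ⟨u, fun k => -v k, by simpa using h1, fun f => ?_⟩
  simpa using (h2 f).neg

theorem isTraceClass_rankOne (c b : H) : IsTraceClass (InnerProductSpace.rankOne ℂ c b) := by
  refine ⟨fun k => if k = 0 then b else 0, fun k => if k = 0 then c else 0, ?_, fun f => ?_⟩
  · exact (hasSum_single 0 fun k hk => by simp [hk]).summable
  · have h := hasSum_single (f := fun k : ℕ => ⟪if k = 0 then b else 0, f⟫_ℂ •
      if k = 0 then c else 0) 0 fun k hk => by simp [hk]
    simpa using h

theorem isTraceClass_zero : IsTraceClass (0 : H →L[ℂ] H) :=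
  ⟨0, 0, by simp, fun f => by simp⟩

theorem IsTraceClass.sum {ι : Type*} {s : Finset ι} {T : ι → H →L[ℂ] H}
    (hT : ∀ i ∈ s, IsTraceClass (T i)) : IsTraceClass (∑ i ∈ s, T i) :=
  Finset.sum_induction T IsTraceClass (fun _ _ => .add) isTraceClass_zero hT

end TraceClass

/-! ### Integral operators -/

section Kernels

variable {Λ : Type*} [MeasurableSpace Λ] {lam : Measure Λ}

theorem HasKernel.sub {S T : Lp ℂ 2 lam →L[ℂ] Lp ℂ 2 lam} {k l : Λ → Λ → ℂ} (hS : HasKernel S k)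
    (hT : HasKernel T l) : HasKernel (S - T) fun z w => k z w - l z w := by
  intro f
  have h : ∀ᵐ z ∂lam, Integrable (fun w => (k z w - l z w) * f w) lam ∧
      ∫ w, (k z w - l z w) * f w ∂lam = ∫ w, k z w * f w ∂lam - ∫ w, l z w * f w ∂lam := by
    filter_upwards [(hS f).1, (hT f).1] with z h1 h2
    simp only [sub_mul]
    exact ⟨h1.sub h2, integral_sub h1 h2⟩
  refine ⟨h.mono fun z hz => hz.1, ?_⟩
  rw [sub_apply]
  filter_upwards [Lp.coeFn_sub (S f) (T f), (hS f).2, (hT f).2, h] with z h1 h2 h3 h4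
  rw [h1, h4.2, Pi.sub_apply, h2, h3]

theorem HasKernel.add {S T : Lp ℂ 2 lam →L[ℂ] Lp ℂ 2 lam} {k l : Λ → Λ → ℂ} (hS : HasKernel S k)
    (hT : HasKernel T l) : HasKernel (S + T) fun z w => k z w + l z w := by
  intro f
  have h : ∀ᵐ z ∂lam, Integrable (fun w => (k z w + l z w) * f w) lam ∧
      ∫ w, (k z w + l z w) * f w ∂lam = ∫ w, k z w * f w ∂lam + ∫ w, l z w * f w ∂lam := by
    filter_upwards [(hS f).1, (hT f).1] with z h1 h2
    simp only [add_mul]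
    exact ⟨h1.add h2, integral_add h1 h2⟩
  refine ⟨h.mono fun z hz => hz.1, ?_⟩
  rw [add_apply]
  filter_upwards [Lp.coeFn_add (S f) (T f), (hS f).2, (hT f).2, h] with z h1 h2 h3 h4
  rw [h1, h4.2, Pi.add_apply, h2, h3]

theorem hasKernel_zero : HasKernel (0 : Lp ℂ 2 lam →L[ℂ] Lp ℂ 2 lam) fun _ _ => 0 := by
  intro f
  simp only [zero_mul, integral_zero]
  exact ⟨Filter.Eventually.of_forall fun _ => integrable_zero _ _ _, Lp.coeFn_zero ℂ 2 lam⟩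

theorem HasKernel.sum {ι : Type*} (s : Finset ι) {T : ι → Lp ℂ 2 lam →L[ℂ] Lp ℂ 2 lam}
    {k : ι → Λ → Λ → ℂ} (hT : ∀ i ∈ s, HasKernel (T i) (k i)) :
    HasKernel (∑ i ∈ s, T i) fun z w => ∑ i ∈ s, k i z w := by
  classical
  induction s using Finset.induction_on with
  | empty => simpa using hasKernel_zero
  | insert i s hi ih =>
    simp only [Finset.sum_insert hi]
    exact (hT i (Finset.mem_insert_self i s)).add
      (ih fun j hj => hT j (Finset.mem_insert_of_mem hj))

theorem inner_toLp_star {b : Λ → ℂ} (hb : MemLp b 2 lam) (f : Lp ℂ 2 lam) :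
    ⟪hb.star.toLp (star b), f⟫_ℂ = ∫ w, b w * f w ∂lam := by
  rw [L2.inner_def]
  refine integral_congr_ae ?_
  filter_upwards [hb.star.coeFn_toLp] with w hw
  rw [hw]
  simp [mul_comm]

theorem hasKernel_rankOne {b c : Λ → ℂ} (hb : MemLp b 2 lam) (hc : MemLp c 2 lam) :
    HasKernel (InnerProductSpace.rankOne ℂ (hc.toLp c) (hb.star.toLp (star b)))
      fun z w => c z * b w := by
  intro f
  have hbf : Integrable (fun w => b w * f w) lam := hb.integrable_mul (Lp.memLp f)
  simp only [mul_assoc]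
  refine ⟨Filter.Eventually.of_forall fun z => hbf.const_mul _, ?_⟩
  rw [InnerProductSpace.rankOne_apply, inner_toLp_star hb]
  filter_upwards [Lp.coeFn_smul (∫ w, b w * f w ∂lam) (hc.toLp c), hc.coeFn_toLp] with z h1 h2
  rw [h1, Pi.smul_apply, h2, integral_const_mul, smul_eq_mul, mul_comm]

variable {κ : Λ → Λ → ℂ} {level : Λ → ℕ} {m : ℕ}

/-- A Volterra equation has at most one solution. -/
theorem ae_eq_of_volterra (hlevel : ∀ z, level z < m) (hκ : ∀ z w, level w ≤ level z → κ z w = 0)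
    {F D G : Λ → ℂ} (hD : ∀ᵐ z ∂lam, D z = F z + ∫ w, κ z w * D w ∂lam)
    (hG : ∀ᵐ z ∂lam, G z = F z + ∫ w, κ z w * G w ∂lam) : D =ᵐ[lam] G := by
  -- The kernel sees only strictly higher levels, so uniqueness propagates downwards from the top
  -- level; no integrability of the solutions is needed.
  have h : ∀ k, ∀ᵐ z ∂lam, m ≤ level z + k → D z = G z := by
    intro k
    induction k with
    | zero => exact Filter.Eventually.of_forall fun z hz => absurd hz (not_le.2 (hlevel z))
    | succ k ih =>
      filter_upwards [hD, hG] with z h1 h2 hz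
      rw [h1, h2]
      congr 1
      refine integral_congr_ae (ih.mono fun w hw => ?_)
      rcases le_or_gt (level w) (level z) with hwz | hwz
      · simp only [hκ z w hwz, zero_mul]
      · simp only [hw (by omega)]
  exact (h m).mono fun z hz => hz (Nat.le_add_left _ _)

/-- The value of `Ψ f` on a level depends only on `f` at strictly higher levels, so `Ψ ^ k f`
vanishes on the top `k` levels. -/
theorem HasKernel.pow_eq_zero {Ψ : Lp ℂ 2 lam →L[ℂ] Lp ℂ 2 lam} (hΨ : HasKernel Ψ κ)
    (hlevel : ∀ z, level z < m) (hκ : ∀ z w, level w ≤ level z → κ z w = 0) :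
    (Ψ : Lp ℂ 2 lam →ₗ[ℂ] Lp ℂ 2 lam) ^ m = 0 := by
  have h : ∀ (k : ℕ) (f : Lp ℂ 2 lam), ∀ᵐ z ∂lam, m ≤ level z + k →
      ((Ψ : Lp ℂ 2 lam →ₗ[ℂ] Lp ℂ 2 lam) ^ k) f z = 0 := by
    intro k f
    induction k with
    | zero => exact Filter.Eventually.of_forall fun z hz => absurd hz (not_le.2 (hlevel z))
    | succ k ih =>
      rw [pow_succ', Module.End.mul_apply]
      filter_upwards [(hΨ (((Ψ : Lp ℂ 2 lam →ₗ[ℂ] Lp ℂ 2 lam) ^ k) f)).2] with z h1 hz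
      refine h1.trans (integral_eq_zero_of_ae (ih.mono fun w hw => ?_))
      rcases le_or_gt (level w) (level z) with hwz | hwz
      · simp only [hκ z w hwz, zero_mul, Pi.zero_apply]
      · simp only [hw (by omega), mul_zero, Pi.zero_apply]
  refine LinearMap.ext fun f => Lp.ext ?_
  filter_upwards [h m f, Lp.coeFn_zero ℂ 2 lam] with z hz h0
  rw [hz (Nat.le_add_left _ _), LinearMap.zero_apply, h0, Pi.zero_apply]

end Kernels

/-- The Fredholm determinant of a finite rank perturbation of a Volterra operator. -/
theorem exists_hasFredholmDet {Λ : Type*} [MeasurableSpace Λ] {lam : Measure Λ} {n m : ℕ}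
    {b c : Fin n → Λ → ℂ} (hb : ∀ i, MemLp (b i) 2 lam) (hc : ∀ i, MemLp (c i) 2 lam)
    (M : Matrix (Fin n) (Fin n) ℂ) {κ : Λ → Λ → ℂ} {level : Λ → ℕ} (hlevel : ∀ z, level z < m)
    (hκ : ∀ z w, level w ≤ level z → κ z w = 0) {Ψ : Lp ℂ 2 lam →L[ℂ] Lp ℂ 2 lam}
    (hΨ : HasKernel Ψ κ) (hΨ' : IsTraceClass Ψ) {G : Fin n → Λ → ℂ}
    (hG : ∀ j, ∀ᵐ z ∂lam, G j z = c j z + ∫ w, κ z w * G j w ∂lam) :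
    ∃ T : Lp ℂ 2 lam →L[ℂ] Lp ℂ 2 lam,
      HasKernel T (fun z w => (∑ i, ∑ j, c i z * M i j * b j w) - κ z w) ∧ IsTraceClass T ∧
      HasFredholmDet T (1 + (Matrix.of fun i j => ∫ w, b i w * G j w ∂lam) * M).det := by
  set B : Fin n → Lp ℂ 2 lam := fun j => (hb j).star.toLp (star (b j))
  set C : Fin n → Lp ℂ 2 lam := fun i => (hc i).toLp (c i)
  refine ⟨(∑ i, ∑ j, InnerProductSpace.rankOne ℂ (M i j • C i) (B j)) - Ψ, ?_, ?_, ?_⟩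
  · refine (HasKernel.sum _ fun i _ => HasKernel.sum _ fun j _ => ?_).sub hΨ
    have h := hasKernel_rankOne (hb j) ((hc i).const_smul (M i j))
    rw [MemLp.toLp_const_smul] at h
    simpa only [Pi.smul_apply, smul_eq_mul, mul_comm (M i j)] using h
  · rw [sub_eq_add_neg]
    exact (IsTraceClass.sum fun i _ => IsTraceClass.sum fun j _ => isTraceClass_rankOne _ _).add
      hΨ'.neg
  · let P : Lp ℂ 2 lam →ₗ[ℂ] Lp ℂ 2 lam := Ψ
    have hP : P ^ m = 0 := hΨ.pow_eq_zero hlevel hκ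
    let U : (Fin n → ℂ) →ₗ[ℂ] Lp ℂ 2 lam := Fintype.linearCombination ℂ C
    let V : Lp ℂ 2 lam →ₗ[ℂ] (Fin n → ℂ) := LinearMap.pi fun j => (innerSL ℂ (B j)).toLinearMap
    -- This is `(1 - Ψ)⁻¹ U`; the Neumann series stops since `Ψ` is nilpotent.
    let R : (Fin n → ℂ) →ₗ[ℂ] Lp ℂ 2 lam := (∑ k ∈ Finset.range m, P ^ k) ∘ₗ U
    have hR : R = U + P ∘ₗ R := by
      have h : (∑ k ∈ Finset.range m, P ^ k) = 1 + P * ∑ k ∈ Finset.range m, P ^ k := by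
        have h1 := Finset.sum_range_succ' (fun k => P ^ k) m
        rw [Finset.sum_range_succ, hP, add_zero] at h1
        have h2 : P * ∑ k ∈ Finset.range m, P ^ k = ∑ k ∈ Finset.range m, P ^ (k + 1) := by
          rw [Finset.mul_sum]
          exact Finset.sum_congr rfl fun k _ => (pow_succ' P k).symm
        rw [h2, h1, pow_zero, add_comm]
      exact LinearMap.ext fun v => LinearMap.congr_fun h (U v)
    -- Both functions solve the Volterra equation with inhomogeneity `c j`. In particular `G j`
    -- agrees almost everywhere with an element of `L²`.
    have hRG : ∀ j, R (Pi.single j 1) =ᵐ[lam] G j := by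
      intro j
      refine ae_eq_of_volterra hlevel hκ (F := c j) ?_ (hG j)
      have hU : U (Pi.single j 1) = C j := by
        simp [U, Fintype.linearCombination_apply_single]
      have h1 : R (Pi.single j 1) = C j + Ψ (R (Pi.single j 1)) := by
        conv_lhs => rw [hR]
        rw [LinearMap.add_apply, hU]
        rfl
      filter_upwards [Lp.coeFn_add (C j) (Ψ (R (Pi.single j 1))), (hΨ (R (Pi.single j 1))).2,
        (hc j).coeFn_toLp] with z h2 h3 h4
      rw [← h4, ← h3]
      conv_lhs => rw [h1]
      exact h2
    have hVR : V ∘ₗ R = Matrix.toLin' (Matrix.of fun i j => ∫ w, b i w * G j w ∂lam) := by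
      refine LinearMap.pi_ext' fun j => LinearMap.ext_ring ?_
      ext i
      simp only [LinearMap.comp_apply, LinearMap.single_apply, Matrix.toLin'_apply,
        Matrix.mulVec_single_one]
      refine (inner_toLp_star (hb i) _).trans (integral_congr_ae ?_)
      filter_upwards [hRG j] with w hw
      rw [hw]
    have h := hasProd_eigenvalues_finiteRank_sub_nilpotent P hP (U ∘ₗ Matrix.toLin' M) V
      (R ∘ₗ Matrix.toLin' M) (by rw [← LinearMap.comp_assoc, ← LinearMap.add_comp, ← hR])
    rw [← LinearMap.comp_assoc, hVR, ← Matrix.toLin'_mul, Module.End.one_eq_id, ← Matrix.toLin'_one,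
      ← map_add, LinearMap.det_toLin'] at h
    have hT : (((∑ i, ∑ j, InnerProductSpace.rankOne ℂ (M i j • C i) (B j)) - Ψ :
        Lp ℂ 2 lam →L[ℂ] Lp ℂ 2 lam) : Lp ℂ 2 lam →ₗ[ℂ] Lp ℂ 2 lam) =
        (U ∘ₗ Matrix.toLin' M) ∘ₗ V - P := by
      refine LinearMap.ext fun f => ?_
      change (_ - Ψ) f = U (Matrix.toLin' M (V f)) - Ψ f
      rw [sub_apply]
      congr 1
      simp only [U, V, Fintype.linearCombination_apply, Matrix.toLin'_apply, Matrix.mulVec,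
        dotProduct, sum_apply, InnerProductSpace.rankOne_apply, Finset.sum_smul, smul_smul]
      refine Finset.sum_congr rfl fun i _ => Finset.sum_congr rfl fun j _ => ?_
      rw [mul_comm]
      rfl
    rw [HasFredholmDet, hT]
    exact h

/-! ### The generating functional as a Fredholm determinant -/

namespace TransitionSystem

variable {X X₀ X₁ : Type*} {m n : ℕ}

/-- The factors `1 + g` at the levels below `m`. -/
def factor (g : Fin m × X → ℂ) (t : ℕ) (x : X) : ℂ :=
  if ht : t < m then 1 + g (⟨t, ht⟩, x) else 1

theorem factor_coe (g : Fin m × X → ℂ) (r : Fin m) (x : X) : factor g r x = 1 + g (r, x) :=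
  dif_pos r.2

theorem measurable_factor [MeasurableSpace X] {g : Fin m × X → ℂ} (hg : Measurable g) (t : ℕ) :
    Measurable (factor g t) := by
  unfold factor
  by_cases ht : t < m
  · simp only [dif_pos ht]
    exact (hg.comp measurable_prodMk_left).const_add 1
  · simp only [dif_neg ht]
    exact measurable_const

theorem enorm_factor_le {g : Fin m × X → ℂ} {c : ℝ} (hc : ∀ z, ‖g z‖ ≤ c) (t : ℕ) (x : X) :
    ‖factor g t x‖ₑ ≤ 1 + ENNReal.ofReal c := by
  unfold factor
  split_ifs with ht
  · refine (enorm_add_le _ _).trans (add_le_add (by simp) ?_)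
    rw [← ofReal_norm]
    exact ENNReal.ofReal_le_ofReal (hc _)
  · simp

variable [MeasurableSpace X] {φ : TransitionSystem ℂ X X₀ X₁}
  {μ : Measure X} [SigmaFinite μ] {x₀ : Fin n → X₀} {x₁ : Fin n → X₁} [NeZero m]

/-- The generating functional is a ratio of determinants. -/
theorem integral_prod_mul_density (hφ : φ.IsMeasurable m) (hwd : φ.WellDefined μ m x₀ x₁)
    (hZ : φ.partitionFunction μ m x₀ x₁ ≠ 0) {g : Fin m × X → ℂ} (hg : Measurable g) {c : ℝ}
    (hc : ∀ z, ‖g z‖ ≤ c) :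
    ∫ x, (∏ r : Fin m, ∏ j : Fin n, (1 + g (r, x r j))) * φ.density μ m x₀ x₁ x
        ∂(configMeasure μ m n) =
      ((φ.tilt (factor g)).totalMatrix μ m x₀ x₁).det * (φ.totalMatrix μ m x₀ x₁).det⁻¹ := by
  have hdens := (generatingFunctional_expansion hφ hwd hZ hg hc).1
  have hI := integral_weight_ne_zero hZ
  -- The numerator is, up to normalisation, the integral of the weight of the tilted system, so
  -- `integral_weight` applies to both systems and the constant `levelConst` cancels.
  have hw : ∀ x, (φ.tilt (factor g)).weight m x₀ x₁ x =
      (∫ x, φ.weight m x₀ x₁ x ∂(configMeasure μ m n)) *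
        ((∏ r : Fin m, ∏ j : Fin n, (1 + g (r, x r j))) * φ.density μ m x₀ x₁ x) := fun x => by
    rw [weight_tilt, density_eq]
    simp only [factor_coe]
    field_simp
  have hint : Integrable ((φ.tilt (factor g)).weight m x₀ x₁) (configMeasure μ m n) := by
    rw [show (φ.tilt (factor g)).weight m x₀ x₁ = _ from funext hw]
    exact hdens.const_mul _
  have h := integral_weight (hφ.tilt (measurable_factor hg)) (hwd.tilt le_self_add
    (ENNReal.add_ne_top.2 ⟨ENNReal.one_ne_top, ENNReal.ofReal_ne_top⟩) (enorm_factor_le hc)) hint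
  simp only [hw] at h
  rw [integral_const_mul, integral_weight hφ hwd (integrable_weight hZ), mul_assoc] at h
  have hdet := ((Matrix.isUnit_iff_isUnit_det _).1 (isUnit_totalMatrix hφ hwd hZ)).ne_zero
  rw [eq_mul_inv_iff_mul_eq₀ hdet, mul_comm]
  exact mul_left_cancel₀ (levelConst_ne_zero m n) h

/-- The generating functional is a Fredholm determinant. -/
theorem generatingFunctional_fredholmDet (hφ : φ.IsMeasurable m)
    (hwd : φ.WellDefined μ m x₀ x₁) (hZ : φ.partitionFunction μ m x₀ x₁ ≠ 0)
    {g g' : Fin m × X → ℂ} (hg : Measurable g') {c : ℝ} (hc : ∀ z, ‖g' z‖ ≤ c)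
    (hgg' : g =ᵐ[refMeasure μ m] g') {B : Set (Fin m × X)} (hB : ∀ z, z ∉ B → g z = 0)
    (hinit : ∀ i : Fin n, MemLp (fun w => φ.fromInitialPoint μ m x₀ i w * g w) 2 (refMeasure μ m))
    (hfinal : ∀ j : Fin n, MemLp (B.indicator (φ.toFinalPoint μ m x₁ j)) 2 (refMeasure μ m))
    {Ψ : Lp ℂ 2 (refMeasure μ m) →L[ℂ] Lp ℂ 2 (refMeasure μ m)}
    (hΨ : HasKernel Ψ fun z w => B.indicator 1 z * φ.transitionKernel μ m z w * g w)
    (hΨ' : IsTraceClass Ψ) :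
    ∃ T : Lp ℂ 2 (refMeasure μ m) →L[ℂ] Lp ℂ 2 (refMeasure μ m),
      HasKernel T (fun z w => B.indicator 1 z * φ.kernel μ m x₀ x₁ z w * g w) ∧
      IsTraceClass T ∧
      HasFredholmDet T
        (∫ x, (∏ r : Fin m, ∏ j : Fin n, (1 + g' (r, x r j))) * φ.density μ m x₀ x₁ x
          ∂(configMeasure μ m n)) := by
  have hA := isUnit_totalMatrix hφ hwd hZ
  have hC : (1 : ℝ≥0∞) + ENNReal.ofReal c ≠ ∞ :=
    ENNReal.add_ne_top.2 ⟨ENNReal.one_ne_top, ENNReal.ofReal_ne_top⟩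
  have hres := fun a j => tilt_transition_inl (μ := μ) (x₀ := x₀) (x₁ := x₁) (a := a) (j := j) hφ
    (measurable_factor hg) le_self_add hC (enorm_factor_le hc)
  -- The tilted transitions to the final points, cut off to `B`: the resolvent equation shows that
  -- they solve the Volterra equation for `Ψ`.
  set G : Fin n → Fin m × X → ℂ := fun j =>
    B.indicator ((φ.tilt (factor g')).toFinalPoint μ m x₁ j)
  -- Here `factor g' - 1` equals `g` almost everywhere, and `g` vanishes off `B`, so the cutoff to
  -- `B` may be inserted under the integral.
  have hgG : ∀ j (f : Fin m × X → ℂ),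
      ∫ w, f w * (factor g' w.1 w.2 - 1) *
        (φ.tilt (factor g')).transition (bochner[μ]) x₀ x₁ (.inr w) (.inl j) ∂(refMeasure μ m) =
      ∫ w, f w * g w * G j w ∂(refMeasure μ m) := fun j f => by
    refine integral_congr_ae ?_
    filter_upwards [hgg'] with w hw
    rw [factor_coe, add_sub_cancel_left]
    by_cases hwB : w ∈ B
    · simp only [G, Set.indicator_of_mem hwB, hw]
      rfl
    · have h0 := hB w hwB
      simp only [← hw, h0, mul_zero, zero_mul]
  have hfin : ∀ j, ∀ᵐ z ∂(refMeasure μ m),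
      φ.abs.transition (lebesgue[μ]) x₀ x₁ (.inr z) (.inl j) < ∞ := fun j =>
    ae_refMeasure_iff.2 fun r => hwd.toFinal r j
  obtain ⟨T, h1, h2, h3⟩ := exists_hasFredholmDet hinit hfinal (φ.totalMatrix μ m x₀ x₁)⁻¹
    (level := fun z => z.1) (fun z => z.1.2)
    (fun z w hzw => by
      simp only [transitionKernel, φ.between_eq_zero _ hzw, mul_zero, zero_mul]) hΨ hΨ'
    (G := G) (fun j => by
      filter_upwards [hfin j] with z hz
      by_cases hzB : z ∈ B
      · have h := (hres (.inr z) j hz).2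
        rw [hgG j fun w => φ.transition (bochner[μ]) x₀ x₁ (.inr z) (.inr w)] at h
        simp only [G, Set.indicator_of_mem hzB, Pi.one_apply, one_mul]
        exact h
      · simp only [G, Set.indicator_of_notMem hzB, zero_mul, integral_zero, add_zero])
  refine ⟨T, ?_, h2, ?_⟩
  · convert h1 using 3 with z w
    by_cases hzB : z ∈ B
    · simp only [Set.indicator_of_mem hzB, Pi.one_apply, one_mul, kernel, sub_mul, Finset.sum_mul,
        mul_assoc]
    · simp only [Set.indicator_of_notMem hzB, zero_mul, Finset.sum_const_zero, sub_zero]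
  · rw [integral_prod_mul_density hφ hwd hZ hg hc]
    -- The resolvent equation with initial points as sources, where absolute convergence holds
    -- without exceptions.
    have hN : (Matrix.of fun i j => ∫ w, φ.fromInitialPoint μ m x₀ i w * g w * G j w
        ∂(refMeasure μ m)) =
        (φ.tilt (factor g')).totalMatrix μ m x₀ x₁ - φ.totalMatrix μ m x₀ x₁ := by
      ext i j
      have h := (hres (.inl i) j (hwd.total i j)).2
      rw [hgG j fun w => φ.transition (bochner[μ]) x₀ x₁ (.inl i) (.inr w)] at h
      exact (sub_eq_of_eq_add' h).symm
    have hdet : (1 + ((φ.tilt (factor g')).totalMatrix μ m x₀ x₁ - φ.totalMatrix μ m x₀ x₁) *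
        (φ.totalMatrix μ m x₀ x₁)⁻¹).det =
        ((φ.tilt (factor g')).totalMatrix μ m x₀ x₁).det * (φ.totalMatrix μ m x₀ x₁).det⁻¹ := by
      rw [sub_mul, Matrix.mul_nonsing_inv _ ((Matrix.isUnit_iff_isUnit_det _).1 hA),
        add_sub_cancel, Matrix.det_mul, Matrix.det_nonsing_inv, Ring.inverse_eq_inv']
    rwa [hN, hdet] at h3

end TransitionSystem

end EynardMehta

end

/-! ### Assembly of the theorem -/

theorem proposition1p9 {X X₀ X₁ : Type*} [MetricSpace X] [CompleteSpace X]
    [SecondCountableTopology X] [MeasurableSpace X] [BorelSpace X]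
    (μ : Measure X) [SigmaFinite μ] (m n : ℕ) [NeZero m] [NeZero n]
    (φ : TransitionSystem ℂ X X₀ X₁) (hφ : φ.IsMeasurable m)
    (x₀ : Fin n → X₀) (x₁ : Fin n → X₁) (hwd : φ.WellDefined μ m x₀ x₁)
    (hZ : φ.partitionFunction μ m x₀ x₁ ≠ 0) :
    -- the matrix that is inverted in the kernel is invertible
    IsUnit (φ.totalMatrix μ m x₀ x₁) ∧
    -- the generating functional
    (∀ g : Fin m × X → ℂ, MemLp g ∞ (refMeasure μ m) →
      -- expansion
      (Integrable (fun x => (∏ r : Fin m, ∏ j : Fin n, (1 + g (r, x r j))) *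
          φ.density μ m x₀ x₁ x) (configMeasure μ m n) ∧
        (∀ k : ℕ, Integrable (fun z : Fin k → Fin m × X => (∏ j, g (z j)) *
            (Matrix.of fun i j : Fin k => φ.kernel μ m x₀ x₁ (z i) (z j)).det)
          (Measure.pi fun _ => refMeasure μ m)) ∧
        HasSum (fun k : ℕ => ((k.factorial : ℂ))⁻¹ *
            ∫ z : Fin k → Fin m × X, (∏ j, g (z j)) *
              (Matrix.of fun i j : Fin k => φ.kernel μ m x₀ x₁ (z i) (z j)).det
              ∂(Measure.pi fun _ => refMeasure μ m))
          (∫ x, (∏ r : Fin m, ∏ j : Fin n, (1 + g (r, x r j))) * φ.density μ m x₀ x₁ x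
            ∂(configMeasure μ m n))) ∧
      -- Fredholm determinant
      (∀ B : Set (Fin m × X), MeasurableSet B → (∀ z, z ∉ B → g z = 0) →
        (∀ i : Fin n, MemLp (fun w => φ.fromInitialPoint μ m x₀ i w * g w) 2 (refMeasure μ m)) →
        (∀ j : Fin n, MemLp (B.indicator (φ.toFinalPoint μ m x₁ j)) 2 (refMeasure μ m)) →
        ∀ Ψ : Lp ℂ 2 (refMeasure μ m) →L[ℂ] Lp ℂ 2 (refMeasure μ m),
          HasKernel Ψ (fun z w => B.indicator 1 z * φ.transitionKernel μ m z w * g w) →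
          IsTraceClass Ψ →
          trace Ψ = ∫ z, B.indicator 1 z * φ.transitionKernel μ m z z * g z ∂(refMeasure μ m) →
          ∃ T : Lp ℂ 2 (refMeasure μ m) →L[ℂ] Lp ℂ 2 (refMeasure μ m),
            HasKernel T (fun z w => B.indicator 1 z * φ.kernel μ m x₀ x₁ z w * g w) ∧
            IsTraceClass T ∧
            HasFredholmDet T
              (∫ x, (∏ r : Fin m, ∏ j : Fin n, (1 + g (r, x r j))) * φ.density μ m x₀ x₁ x
                ∂(configMeasure μ m n)))) ∧
    -- the point process
    ((∀ᵐ x ∂(configMeasure μ m n),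
        0 ≤ (φ.density μ m x₀ x₁ x).re ∧ (φ.density μ m x₀ x₁ x).im = 0) →
      IsDeterminantal
        ((configMeasure μ m n).withDensity fun x => ENNReal.ofReal (φ.density μ m x₀ x₁ x).re)
        configPoints (refMeasure μ m) (φ.kernel μ m x₀ x₁)) := by
  refine ⟨TransitionSystem.isUnit_totalMatrix hφ hwd hZ, fun g hg => ?_,
    TransitionSystem.isDeterminantal_configPoints hφ hwd hZ⟩
  -- A bounded measurable representative provides the pointwise bounds used for the tilted system.
  -- The exchange alters the integrands only on null sets, because evaluation at each coordinate
  -- pulls null sets back to null sets.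
  obtain ⟨g', hgm, ⟨c, hc⟩, hgg'⟩ := exists_measurable_bounded_ae_eq hg
  have h1 : (fun x => (∏ r : Fin m, ∏ j : Fin n, (1 + g' (r, x r j))) *
      φ.density μ m x₀ x₁ x) =ᵐ[configMeasure μ m n]
      fun x => (∏ r : Fin m, ∏ j : Fin n, (1 + g (r, x r j))) * φ.density μ m x₀ x₁ x := by
    filter_upwards [ae_config (n := n) hgg'] with x hx
    congr 1
    exact Finset.prod_congr rfl fun r _ => Finset.prod_congr rfl fun j _ =>
      congrArg (1 + ·) (hx (r, j)).symm
  have h2 : ∀ k : ℕ, (fun z : Fin k → Fin m × X => (∏ j, g' (z j)) *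
      (Matrix.of fun i j : Fin k => φ.kernel μ m x₀ x₁ (z i) (z j)).det)
      =ᵐ[Measure.pi fun _ => refMeasure μ m] fun z => (∏ j, g (z j)) *
      (Matrix.of fun i j : Fin k => φ.kernel μ m x₀ x₁ (z i) (z j)).det := fun k => by
    have h : ∀ᵐ z : Fin k → Fin m × X ∂(Measure.pi fun _ => refMeasure μ m),
        ∀ j, g (z j) = g' (z j) := ae_all_iff.2 fun j =>
      (Measure.quasiMeasurePreserving_eval (fun _ : Fin k => refMeasure μ m) j).ae hgg'
    filter_upwards [h] with z hz
    simp only [hz]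
  obtain ⟨e1, e2, e3⟩ := TransitionSystem.generatingFunctional_expansion hφ hwd hZ hgm hc
  rw [← integral_congr_ae h1]
  refine ⟨⟨e1.congr h1, fun k => (e2 k).congr (h2 k), ?_⟩,
    fun B _ hB hinit hfinal Ψ hΨ hΨ' _ =>
      TransitionSystem.generatingFunctional_fredholmDet hφ hwd hZ hgm hc hgg' hB hinit hfinal
        hΨ hΨ'⟩
  simpa only [fun k => integral_congr_ae (h2 k)] using e3
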